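/- Let $\mathbb K$ be a field of characteristic zero and $V=\bigoplus_{d\in\mathbb Z}V^d$ a finite-dimensional graded $\mathbb K$-vector space. All signs follow the Koszul rule (there are none beyond those written if $V=V^0$). **Representations.** For $m\ge 1$, $n\ge 0$ let $D(m,n)$ be the graded vector space with one basis element ("corolla"), of degree $1-k$, for every $k\geq 1$ and every ordered partition $[m]=I_1\sqcup\dots\sqcup I_k$ into nonempty blocks; $\mathbb S_m$ acts by permuting the elements of $[m]$ (the output legs; legs in the same block are symmetric), and $\mathbb S_n$ acts trivially. Its differential is $$\delta(I_1,\dots,I_k)=\sum_{i=1}^{k-1}(-1)^{i+1}(I_1,\dots,I_i\sqcup I_{i+1},\dots,I_k).$$ Let $\mathcal D=\mathcal F^\uparrow\langle D\rangle$ be the dg free prop generated by the dg $\mathbb S$-bimodule $D$. A (not necessarily homogeneous) representation of $\mathcal D$ in $V$ is given by its values on the generators, so the space of representations is the space of morphisms of $\mathbb S$-bimodules $\rho\colon D\to\mathcal End_V=\{\mathrm{Hom}(V^{\otimes n},V^{\otimes m})\}$; let $\mathrm{Rep}_V(\mathcal D)$ be the space of those that vanish on $D(m,n)$ for all but finitely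 many $(m,n)$, with the differential $\delta\rho:=\rho\circ\delta$, and let $\mathrm{Rep}_V(\mathcal D)_k$ be the part that lives on the corollas with $k$ blocks. An element of $\mathrm{Rep}_V(\mathcal D)_k$ whose values are linear maps of degree $e$ has degree $k-1+e$. **Polydifferential operators.** Let $\mathcal O_V=\odot^\bullet V^*$ be the free graded commutative algebra on $V^*$, and let $d_H$ be the Hochschild differential $$(d_H\Phi)(f_0,\dots,f_k)=-(-1)^{|f_0||\Phi|}f_0\Phi(f_1,\dots,f_k)+\sum_{i=0}^{k-1}(-1)^i\Phi(f_0,\dots,f_if_{i+1},\dots,f_k)+(-1)^k\Phi(f_0,\dots,f_{k-1})f_k$$ on $C^{\bullet}(\mathcal O_V)=\bigoplus_{k}\mathrm{Hom}(\mathcal O_V^{\otimes k},\mathcal O_V)[1-k]$. For $k\ge1$ let $C^k_{diff}(\mathcal O_V)\subset \mathrm{Hom}(\mathcal O_V^{\otimes k},\mathcal O_V)[1-k]$ be the span of the operators $$x^J\frac{\partial^{|I_1|}}{\partial x^{I_1}}\otimes\dots\otimes\frac{\partial^{|I_k|}}{\partial x^{I_k}},\qquad |J|\ge 0,\quad |I_1|,\dots,|I_k|\ge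 1,$$ and let $C^{\bullet\ge1}_{diff}(\mathcal O_V)=\bigoplus_{k\ge1}C^k_{diff}(\mathcal O_V)$. **Proposition 3.3.2.** $\delta^2=0$ on $\mathrm{Rep}_V(\mathcal D)$, $d_H^2=0$, and $C^{\bullet\ge1}_{diff}(\mathcal O_V)$ is a subcomplex of $(C^\bullet(\mathcal O_V),d_H)$. There is a canonical isomorphism of complexes $$i\colon(\mathrm{Rep}_V(\mathcal D),\delta)\to(C^{\bullet\ge1}_{diff}(\mathcal O_V),d_H).$$ It consists of linear isomorphisms $\mathrm{Rep}_V(\mathcal D)_k\to C^k_{diff}(\mathcal O_V)$, $k\geq1$, with $i\circ\delta=d_H\circ i$; it preserves degrees; it carries the representations supported on $D(m,n)$ onto the span of the operators as above with $|I_1|+\dots+|I_k|=m$ and $|J|=n$; and for every basis $\{e_\alpha\}$ of $V$ that consists of homogeneous vectors, with the dual basis $\{x^\alpha\}$ of $V^*$, it is given by $$i(\rho)=\sum_{I_1,\dots,I_k,J}\frac{1}{|J|!\,|I_1|!\cdots|I_k|!}\,\Gamma^{I_1,\dots,I_k}_J\,x^J\frac{\partial^{|I_1|}}{\partial x^{I_1}}\otimes\dots\otimes\frac{\partial^{|I_k|}}{\partial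 x^{I_k}}.$$ Here the sum runs over all words $J,I_1,\dots,I_k$ in the indices $\alpha$ with $|I_j|\ge1$, and $\Gamma^{I_1,\dots,I_k}_J$ is the coefficient of the tensor $e_{I_1}\otimes\dots\otimes e_{I_k}\in V^{\otimes m}$, $m=|I_1|+\dots+|I_k|$, in the value at $e_J\in V^{\otimes n}$, $n=|J|$, of $\rho$ on the corolla in $D(m,n)$ whose blocks are the consecutive intervals of $[m]$ of the lengths $|I_1|,\dots,|I_k|$. -/

import Mathlib

open scoped TensorProduct DirectSum

noncomputable section

namespace PolyHoch

universe u v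

section Signs

/-- The Koszul sign `(-1)^a`, for an integer `a`, as a scalar. -/
def sgn (K : Type u) [Field K] (a : ℤ) : K := ((Int.negOnePow a : ℤˣ) : ℤ)

variable {K : Type u} [Field K]

theorem sgn_add (a b : ℤ) : sgn K (a + b) = sgn K a * sgn K b := by
  simp [sgn, Int.negOnePow_add]

theorem sgn_mul_self (a : ℤ) : sgn K a * sgn K a = 1 := by
  rw [← sgn_add]
  simp [sgn, Int.negOnePow_even (a + a) ⟨a, rfl⟩]

theorem sgn_neg (a : ℤ) : sgn K (-a) = sgn K a := by
  simp [sgn, Int.negOnePow_neg]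

end Signs

section Graded

variable {K : Type u} [Field K] {V : Type v} [AddCommGroup V] [Module K V]
  (𝒱 : ℤ → Submodule K V) [DirectSum.Decomposition 𝒱]

/-- The operator on `V` that multiplies the homogeneous part of degree `e` by the scalar `c e`. -/
def scaleDeg (c : ℤ → K) : V →ₗ[K] V :=
  DirectSum.coeLinearMap 𝒱 ∘ₗ DirectSum.lmap (fun e => c e • LinearMap.id) ∘ₗ
    (DirectSum.decomposeLinearEquiv 𝒱).toLinearMap

theorem scaleDeg_of_mem (c : ℤ → K) {e : ℤ} {w : V} (hw : w ∈ 𝒱 e) :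
    scaleDeg 𝒱 c w = c e • w := by
  simp only [scaleDeg, LinearMap.comp_apply, LinearEquiv.coe_coe,
    DirectSum.decomposeLinearEquiv_apply, DirectSum.decompose_of_mem 𝒱 hw]
  rw [← DirectSum.lof_eq_of K, DirectSum.lmap_lof, DirectSum.coeLinearMap_lof]
  simp

/-! ### The endomorphism prop of a graded vector space -/

/-- Projection of `V` to its even part (`false`) or its odd part (`true`). -/
def parityPart (odd : Bool) : V →ₗ[K] V :=
  scaleDeg 𝒱 (fun e => if decide (Odd e) = odd then 1 else 0)

/-- The sign that arises when homogeneous elements with the parities `ε` (`true` is odd) are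
permuted by `σ`: one factor `-1` for every inversion of `σ` between two odd elements. -/
def koszulSign (K : Type u) [Field K] {m : ℕ} (σ : Equiv.Perm (Fin m)) (ε : Fin m → Bool) : K :=
  ∏ i : Fin m, ∏ j : Fin m,
    if i < j ∧ σ j < σ i ∧ ε i = true ∧ ε j = true then -1 else 1

/-- The action of `σ` on `V^{⊗m}`: it puts the `i`-th tensor factor at the place `σ i`, with the
Koszul sign. -/
def permTensor {m : ℕ} (σ : Equiv.Perm (Fin m)) :
    (⨂[K] _ : Fin m, V) →ₗ[K] (⨂[K] _ : Fin m, V) :=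
  ∑ ε : Fin m → Bool, koszulSign K σ ε •
    ((PiTensorProduct.reindex K (fun _ : Fin m => V) σ).toLinearMap ∘ₗ
      PiTensorProduct.map (fun i => parityPart 𝒱 (ε i)))

/-- The component `End_V(m, n) = Hom(V^{⊗n}, V^{⊗m})` of the endomorphism prop of `V`. -/
abbrev EndV (K : Type u) [Field K] (V : Type v) [AddCommGroup V] [Module K V] (m n : ℕ) :
    Type (max u v) :=
  (⨂[K] _ : Fin n, V) →ₗ[K] (⨂[K] _ : Fin m, V)

/-- The part of degree `e` of `V^{⊗m}`. -/
def tensorDeg (m : ℕ) (e : ℤ) : Submodule K (⨂[K] _ : Fin m, V) :=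
  Submodule.span K {t | ∃ (w : Fin m → V) (a : Fin m → ℤ),
    (∀ i, w i ∈ 𝒱 (a i)) ∧ ∑ i, a i = e ∧ t = PiTensorProduct.tprod K w}

/-- The linear maps `V^{⊗n} → V^{⊗m}` of degree `e`. -/
def IsEndDeg {m n : ℕ} (e : ℤ) (f : EndV K V m n) : Prop :=
  ∀ a : ℤ, ∀ t ∈ tensorDeg 𝒱 n a, f t ∈ tensorDeg 𝒱 m (a + e)

end Graded

/-! ### The dg bimodule of generators -/

/-- Ordered partitions `[m] = I_1 ⊔ … ⊔ I_k` into `k` nonempty blocks, as surjections `[m] → [k]`: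
the block `I_j` is the fibre over `j`. -/
abbrev OrdPart (m k : ℕ) : Type := {c : Fin m → Fin k // Function.Surjective c}

/-- The permutation `σ` of the output legs sends the blocks `I_j` to the blocks `σ (I_j)`. -/
def OrdPart.perm {m k : ℕ} (σ : Equiv.Perm (Fin m)) (c : OrdPart m k) : OrdPart m k :=
  ⟨c.1 ∘ σ.symm, c.2.comp σ.symm.surjective⟩

/-- Union of the two consecutive blocks with the numbers `i` and `i + 1` (counted from `0`). -/
def OrdPart.merge {m p : ℕ} (i : Fin (p + 1)) (c : OrdPart m (p + 2)) : OrdPart m (p + 1) :=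
  ⟨i.predAbove ∘ c.1, (Fin.predAbove_surjective i).comp c.2⟩

/-- The part of degree `-p` of `D(m, n)`. It has a basis of corollas with `n` symmetric input legs
and `m` output legs, one for each ordered partition of `[m]` into `k = p + 1` blocks, with the
legs in each block symmetric. It does not depend on `n`. -/
abbrev Gen (K : Type u) [Field K] (m p : ℕ) : Type u := OrdPart m (p + 1) →₀ K

section Generators

variable (K : Type u) [Field K]

/-- The action of the permutations of the output legs on the generators. (The permutations of the
input legs act trivially.) -/
def permGen {m p : ℕ} (σ : Equiv.Perm (Fin m)) : Gen K m p →ₗ[K] Gen K m p :=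
  Finsupp.lmapDomain K K (OrdPart.perm σ)

/-- The differential on generators, from degree `-(p+1)` to degree `-p`: the alternating sum over
all unions of two consecutive blocks, with the sign `+` for the union of the first two. -/
def genDiff (m p : ℕ) : Gen K m (p + 1) →ₗ[K] Gen K m p :=
  ∑ i : Fin (p + 1), (-1 : K) ^ (i : ℕ) • Finsupp.lmapDomain K K (OrdPart.merge i)

theorem genDiff_permGen {m p : ℕ} (σ : Equiv.Perm (Fin m)) :
    genDiff K m p ∘ₗ permGen K σ = permGen K σ ∘ₗ genDiff K m p := by
  ext c : 2
  simp [genDiff, permGen, Finsupp.mapDomain_single, OrdPart.merge, OrdPart.perm,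
    Function.comp_assoc]

end Generators

section Representations

variable {K : Type u} [Field K] {V : Type v} [AddCommGroup V] [Module K V]
  (𝒱 : ℤ → Submodule K V) [DirectSum.Decomposition 𝒱]

/-- The part of `Hom_𝕊(D, End_V)` that lives on the generators of degree `-p`: families of linear
maps `D(m, n) → End_V(m, n)`, compatible with the left actions of `S_m` and the right actions of
`S_n`. A representation in `V` of the free prop on `D` is determined by its arbitrary values on
the generators, so these are the representations; they need not be homogeneous. -/
def Rep (p : ℕ) : Submodule K (∀ m n : ℕ, Gen K m p →ₗ[K] EndV K V m n) where
  carrier := {ρ | (∀ (m n : ℕ) (σ : Equiv.Perm (Fin m)) (x : Gen K m p),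
      ρ m n (permGen K σ x) = permTensor 𝒱 σ ∘ₗ ρ m n x) ∧
    (∀ (m n : ℕ) (τ : Equiv.Perm (Fin n)) (x : Gen K m p),
      ρ m n x ∘ₗ permTensor 𝒱 τ = ρ m n x)}
  add_mem' := by
    rintro ρ ρ' ⟨h1, h2⟩ ⟨h1', h2'⟩
    refine ⟨fun m n σ x => ?_, fun m n τ x => ?_⟩
    · simp [h1, h1', LinearMap.comp_add]
    · simp [h2, h2', LinearMap.add_comp]
  zero_mem' := by
    refine ⟨fun m n σ x => ?_, fun m n τ x => ?_⟩ <;> simp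
  smul_mem' := by
    rintro a ρ ⟨h1, h2⟩
    refine ⟨fun m n σ x => ?_, fun m n τ x => ?_⟩
    · simp [h1, LinearMap.comp_smul]
    · simp [h2, LinearMap.smul_comp]

/-- The representations that vanish on `D(m, n)` for all but finitely many `(m, n)`. -/
def RepFin (p : ℕ) : Submodule K (∀ m n : ℕ, Gen K m p →ₗ[K] EndV K V m n) where
  carrier := {ρ | ρ ∈ Rep 𝒱 p ∧ {mn : ℕ × ℕ | ρ mn.1 mn.2 ≠ 0}.Finite}
  add_mem' := by
    rintro ρ ρ' ⟨h1, h2⟩ ⟨h1', h2'⟩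
    refine ⟨add_mem h1 h1', (h2.union h2').subset fun mn h => ?_⟩
    by_contra hc
    simp only [Set.mem_union, Set.mem_ofPred_eq, not_or, not_not] at hc
    exact h (by simp [hc.1, hc.2])
  zero_mem' := ⟨zero_mem _, by simp⟩
  smul_mem' := by
    rintro a ρ ⟨h1, h2⟩
    refine ⟨Submodule.smul_mem _ a h1, h2.subset fun mn h hc => h ?_⟩
    simp [hc]

/-- The differential `δρ = ρ ∘ δ` of the complex of representations. -/
def repDiff (p : ℕ) : RepFin 𝒱 p →ₗ[K] RepFin 𝒱 (p + 1) where
  toFun ρ := ⟨fun m n => ρ.1 m n ∘ₗ genDiff K m p, by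
    obtain ⟨ρ, ⟨h1, h2⟩, h3⟩ := ρ
    refine ⟨⟨fun m n σ x => ?_, fun m n τ x => ?_⟩, h3.subset fun mn h hc => h ?_⟩
    · have := LinearMap.congr_fun (genDiff_permGen K (p := p) σ) x
      simp only [LinearMap.comp_apply] at this
      simp only [LinearMap.comp_apply, this, h1]
    · simp only [LinearMap.comp_apply, h2]
    · simp [hc]⟩
  map_add' ρ ρ' := by
    ext : 1
    funext m n
    simp [LinearMap.add_comp]
  map_smul' a ρ := by
    ext : 1
    funext m n
    simp [LinearMap.smul_comp]

/-- The family `ρ` takes values of degree `e` on the corollas, that is, it has internal degree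
`e`. Its total degree in the complex of representations is then `p + e`. -/
def IsRepDeg {p : ℕ} (e : ℤ) (ρ : RepFin 𝒱 p) : Prop :=
  ∀ (m n : ℕ) (x : Gen K m p), IsEndDeg 𝒱 e (ρ.1 m n x)

end Representations

/-! ### The graded commutative algebra of polynomial functions -/

section Polynomials

variable {K : Type u} [Field K] {V : Type v} [AddCommGroup V] [Module K V]
  (𝒱 : ℤ → Submodule K V)

/-- The linear forms of degree `a` on `V`: they vanish on all parts of degree other than `-a`. -/
def dualDeg (a : ℤ) : Submodule K (Module.Dual K V) where
  carrier := {ξ | ∀ e : ℤ, e ≠ -a → ∀ w ∈ 𝒱 e, ξ w = 0}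
  add_mem' := by
    intro ξ η hξ hη e he w hw
    simp [hξ e he w hw, hη e he w hw]
  zero_mem' := by
    intro e he w hw
    simp
  smul_mem' := by
    intro c ξ hξ e he w hw
    simp [hξ e he w hw]

/-- Graded commutativity `ξ η = (-1)^{ab} η ξ` of linear forms of the degrees `a` and `b`. -/
inductive CommRel : TensorAlgebra K (Module.Dual K V) → TensorAlgebra K (Module.Dual K V) → Prop
  | comm (a b : ℤ) (ξ η : Module.Dual K V) (hξ : ξ ∈ dualDeg 𝒱 a) (hη : η ∈ dualDeg 𝒱 b) :
      CommRel (TensorAlgebra.ι K ξ * TensorAlgebra.ι K η)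
        (sgn K (a * b) • (TensorAlgebra.ι K η * TensorAlgebra.ι K ξ))

/-- `𝒪_V`, the free graded commutative algebra on the dual space `V^*`. -/
def OV : Type (max u v) := RingQuot (CommRel 𝒱)

instance : Ring (OV 𝒱) := inferInstanceAs (Ring (RingQuot (CommRel 𝒱)))

instance : Algebra K (OV 𝒱) := inferInstanceAs (Algebra K (RingQuot (CommRel 𝒱)))

/-- The quotient map from the tensor algebra of `V^*` to `𝒪_V`. -/
def OV.mk : TensorAlgebra K (Module.Dual K V) →ₐ[K] OV 𝒱 := RingQuot.mkAlgHom K (CommRel 𝒱)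

theorem OV.mk_surjective : Function.Surjective (OV.mk 𝒱) :=
  RingQuot.mkAlgHom_surjective K (CommRel 𝒱)

/-- The universal property of `𝒪_V` as a quotient of the tensor algebra. -/
def OV.lift {B : Type*} [Ring B] [Algebra K B] (f : TensorAlgebra K (Module.Dual K V) →ₐ[K] B)
    (hf : ∀ ⦃x y⦄, CommRel 𝒱 x y → f x = f y) : OV 𝒱 →ₐ[K] B :=
  RingQuot.liftAlgHom K ⟨f, hf⟩

theorem OV.lift_mk {B : Type*} [Ring B] [Algebra K B]
    (f : TensorAlgebra K (Module.Dual K V) →ₐ[K] B) (hf : ∀ ⦃x y⦄, CommRel 𝒱 x y → f x = f y)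
    (t : TensorAlgebra K (Module.Dual K V)) : OV.lift 𝒱 f hf (OV.mk 𝒱 t) = f t :=
  RingQuot.liftAlgHom_mkAlgHom_apply K f hf t

/-- A linear form as an element of `𝒪_V`. -/
def coord : Module.Dual K V →ₗ[K] OV 𝒱 :=
  (OV.mk 𝒱).toLinearMap ∘ₗ TensorAlgebra.ι K

/-- The part of degree `e` of `𝒪_V`. -/
def ovDeg (e : ℤ) : Submodule K (OV 𝒱) :=
  Submodule.span K {f | ∃ (n : ℕ) (ξ : Fin n → Module.Dual K V) (a : Fin n → ℤ),
    (∀ i, ξ i ∈ dualDeg 𝒱 (a i)) ∧ ∑ i, a i = e ∧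
      f = (List.ofFn fun i => coord 𝒱 (ξ i)).prod}

theorem coord_comm {a b : ℤ} {ξ η : Module.Dual K V} (hξ : ξ ∈ dualDeg 𝒱 a)
    (hη : η ∈ dualDeg 𝒱 b) :
    coord 𝒱 ξ * coord 𝒱 η = sgn K (a * b) • (coord 𝒱 η * coord 𝒱 ξ) := by
  have h : OV.mk 𝒱 _ = OV.mk 𝒱 _ := RingQuot.mkAlgHom_rel K (CommRel.comm a b ξ η hξ hη)
  simpa [coord] using h

variable [DirectSum.Decomposition 𝒱]

theorem dual_comp_scaleDeg (c : ℤ → K) {a : ℤ} {ξ : Module.Dual K V} (hξ : ξ ∈ dualDeg 𝒱 a) :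
    ξ ∘ₗ scaleDeg 𝒱 c = c (-a) • ξ := by
  ext w
  induction w using DirectSum.Decomposition.inductionOn 𝒱 with
  | zero => simp
  | @homogeneous e w =>
    simp only [LinearMap.comp_apply, scaleDeg_of_mem 𝒱 c w.2, map_smul, LinearMap.smul_apply]
    by_cases he : e = -a
    · have hc : c e = c (-a) := by rw [he]
      rw [hc]
    · simp [hξ e he w.1 w.2]
  | add w w' h h' => rw [map_add, map_add, h, h']

/-- The algebra endomorphism of `𝒪_V` that is multiplication by `(-1)^{de}` on the part of
degree `e`. -/
def twist (d : ℤ) : OV 𝒱 →ₐ[K] OV 𝒱 :=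
  OV.lift 𝒱 (TensorAlgebra.lift K
    (coord 𝒱 ∘ₗ (Module.Dual.transpose (R := K) (scaleDeg 𝒱 fun e => sgn K (d * e))))) (by
    rintro _ _ ⟨a, b, ξ, η, hξ, hη⟩
    have h1 := dual_comp_scaleDeg 𝒱 (fun e => sgn K (d * e)) hξ
    have h2 := dual_comp_scaleDeg 𝒱 (fun e => sgn K (d * e)) hη
    simp only [map_mul, map_smul, TensorAlgebra.lift_ι_apply, LinearMap.comp_apply,
      Module.Dual.transpose_apply, h1, h2, smul_mul_smul_comm, coord_comm 𝒱 hξ hη, smul_smul]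
    congr 1
    ring)

theorem twist_coord (d : ℤ) {a : ℤ} {ξ : Module.Dual K V} (hξ : ξ ∈ dualDeg 𝒱 a) :
    twist 𝒱 d (coord 𝒱 ξ) = sgn K (d * a) • coord 𝒱 ξ := by
  have h1 := dual_comp_scaleDeg 𝒱 (fun e => sgn K (d * e)) hξ
  simp only [twist, coord, LinearMap.comp_apply, AlgHom.toLinearMap_apply,
    OV.lift_mk, TensorAlgebra.lift_ι_apply,
    Module.Dual.transpose_apply, h1, map_smul, mul_neg, sgn_neg]

/-- For a vector `w` of degree `d`, the algebra homomorphism from `𝒪_V` to upper triangular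
`2 × 2` matrices with the diagonal entries `(-1)^{d|f|} f` and `f`; the off-diagonal entry is the
partial derivative of `f` along `w`. -/
def derivMatrix (d : ℤ) (w : 𝒱 d) : OV 𝒱 →ₐ[K] Matrix (Fin 2) (Fin 2) (OV 𝒱) :=
  OV.lift 𝒱 (TensorAlgebra.lift K
    { toFun := fun ξ => !![twist 𝒱 d (coord 𝒱 ξ), algebraMap K (OV 𝒱) (ξ w); 0, coord 𝒱 ξ]
      map_add' := by
        intro ξ η
        ext i j
        fin_cases i <;> fin_cases j <;> simp
      map_smul' := by
        intro c ξ
        ext i j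
        fin_cases i <;> fin_cases j <;> simp [Algebra.smul_def] }) (by
    rintro _ _ ⟨a, b, ξ, η, hξ, hη⟩
    have key : ∀ {a b : ℤ} {ξ η : Module.Dual K V}, ξ ∈ dualDeg 𝒱 a → η ∈ dualDeg 𝒱 b →
        ξ (w : V) • coord 𝒱 η =
          (sgn K (a * b) * sgn K (d * b) * ξ (w : V)) • coord 𝒱 η := by
      intro a b ξ η hξ hη
      by_cases h : d = -a
      · subst h
        rw [neg_mul, sgn_neg, sgn_mul_self, one_mul]
      · simp [hξ d h w.1 w.2]
    have k1 := key hξ hη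
    have k2 := key hη hξ
    have k3 : (η (w : V) * sgn K (d * a)) • coord 𝒱 ξ =
        (sgn K (a * b) * η (w : V)) • coord 𝒱 ξ := by
      have h := congrArg (fun f => sgn K (d * a) • f) k2
      simp only [smul_smul] at h
      rw [mul_comm, h, mul_comm b a]
      congr 1
      linear_combination (sgn K (a * b) * η (w : V)) * sgn_mul_self (K := K) (d * a)
    have hc := coord_comm 𝒱 hξ hη
    simp only [map_mul, map_smul, TensorAlgebra.lift_ι_apply, LinearMap.coe_mk, AddHom.coe_mk,
      twist_coord 𝒱 d hξ, twist_coord 𝒱 d hη]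
    ext i j
    fin_cases i <;> fin_cases j
    · simp [Matrix.mul_apply, Fin.sum_univ_two, hc, smul_smul]
      congr 1
      ring
    · simp only [Matrix.mul_apply, Fin.sum_univ_two, Matrix.smul_apply, Matrix.of_apply,
        Matrix.cons_val', Matrix.cons_val_zero, Matrix.cons_val_one, Matrix.cons_val_fin_one,
        Fin.zero_eta, Fin.mk_one, Fin.isValue]
      rw [← Algebra.commutes, ← Algebra.commutes, ← Algebra.smul_def, ← Algebra.smul_def,
        ← Algebra.smul_def, ← Algebra.smul_def, smul_smul, smul_smul, smul_add, smul_smul,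
        smul_smul, k1, k3, add_comm]
      congr 2
      ring
    · simp [Matrix.mul_apply, Fin.sum_univ_two]
    · simp [Matrix.mul_apply, Fin.sum_univ_two, hc])

/-- The partial derivative along a homogeneous vector `w` of degree `d`: the derivation of `𝒪_V`
of degree `d`, acting from the left, with `ξ ↦ ξ w` on linear forms. -/
def partialD (d : ℤ) (w : 𝒱 d) : OV 𝒱 →ₗ[K] OV 𝒱 where
  toFun f := derivMatrix 𝒱 d w f 0 1
  map_add' f g := by simp
  map_smul' c f := by simp

theorem derivMatrix_diag (d : ℤ) (w : 𝒱 d) (f : OV 𝒱) :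
    derivMatrix 𝒱 d w f 0 0 = twist 𝒱 d f ∧ derivMatrix 𝒱 d w f 1 0 = 0 ∧
      derivMatrix 𝒱 d w f 1 1 = f := by
  obtain ⟨t, rfl⟩ := OV.mk_surjective 𝒱 f
  induction t using TensorAlgebra.induction with
  | algebraMap r => simp [Matrix.algebraMap_matrix_apply]
  | ι ξ =>
    simp only [derivMatrix, OV.lift_mk, TensorAlgebra.lift_ι_apply]
    simp [coord]
  | mul s t hs ht =>
    obtain ⟨h1, h2, h3⟩ := hs
    obtain ⟨g1, g2, g3⟩ := ht
    simp [Matrix.mul_apply, Fin.sum_univ_two, h1, h2, h3, g1, g2, g3]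
  | add s t hs ht =>
    obtain ⟨h1, h2, h3⟩ := hs
    obtain ⟨g1, g2, g3⟩ := ht
    simp [h1, h2, h3, g1, g2, g3]

theorem partialD_coord (d : ℤ) (w : 𝒱 d) (ξ : Module.Dual K V) :
    partialD 𝒱 d w (coord 𝒱 ξ) = algebraMap K (OV 𝒱) (ξ w) := by
  simp [partialD, derivMatrix, coord, OV.lift_mk]

theorem partialD_mul (d : ℤ) (w : 𝒱 d) (f g : OV 𝒱) :
    partialD 𝒱 d w (f * g) = partialD 𝒱 d w f * g + twist 𝒱 d f * partialD 𝒱 d w g := by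
  simp [partialD, Matrix.mul_apply, Fin.sum_univ_two, derivMatrix_diag, add_comm]

/-! ### Hochschild cochains -/

/-- Hochschild cochains `𝒪_V^{⊗k} → 𝒪_V`. -/
abbrev Cochain (k : ℕ) : Type (max u v) := MultilinearMap K (fun _ : Fin k => OV 𝒱) (OV 𝒱)

/-- `Φ ↦ (f_0, …, f_k ↦ h(f_0) Φ(f_1, …, f_k))`, for a linear operator `h` on `𝒪_V`. -/
def leftMul {k : ℕ} (h : OV 𝒱 →ₗ[K] OV 𝒱) : Cochain 𝒱 k →ₗ[K] Cochain 𝒱 (k + 1) where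
  toFun Φ := LinearMap.uncurryLeft
    { toFun := fun f => (LinearMap.mulLeft K (h f)).compMultilinearMap Φ
      map_add' := by intro f g; ext; simp [add_mul]
      map_smul' := by intro c f; ext; simp }
  map_add' Φ Ψ := by ext; simp
  map_smul' c Φ := by ext; simp

/-- `Φ ↦ (f_0, …, f_k ↦ Φ(f_0, …, f_{k-1}) f_k)`. -/
def rightMul {k : ℕ} : Cochain 𝒱 k →ₗ[K] Cochain 𝒱 (k + 1) where
  toFun Φ := MultilinearMap.uncurryRight ((LinearMap.mul K (OV 𝒱)).compMultilinearMap Φ)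
  map_add' Φ Ψ := by ext; simp
  map_smul' c Φ := by ext; simp

/-- `(f_0, …, f_k) ↦ (f_0, …, f_i f_{i+1}, …, f_k)`. -/
def mulAt {A : Type*} [Ring A] {k : ℕ} (i : Fin k) (f : Fin (k + 1) → A) : Fin k → A :=
  fun j => if j < i then f j.castSucc else if j = i then f j.castSucc * f j.succ else f j.succ

theorem mulAt_update {A : Type*} [Ring A] [Algebra K A] {k : ℕ} (i : Fin k) (f : Fin (k + 1) → A)
    (l : Fin (k + 1)) :
    ∃ (j : Fin k) (T : A →ₗ[K] A), ∀ x,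
      mulAt i (Function.update f l x) = Function.update (mulAt i f) j (T x) := by
  rcases lt_trichotomy (l : ℕ) (i : ℕ) with h | h | h
  · refine ⟨⟨l, by omega⟩, LinearMap.id, fun x => ?_⟩
    funext j
    simp only [mulAt, Function.update_apply, Fin.ext_iff, Fin.lt_def, Fin.val_castSucc,
      Fin.val_succ, LinearMap.id_apply]
    grind
  · refine ⟨i, LinearMap.mulRight K (f i.succ), fun x => ?_⟩
    funext j
    simp only [mulAt, Function.update_apply, Fin.ext_iff, Fin.lt_def, Fin.val_castSucc,
      Fin.val_succ, LinearMap.mulRight_apply]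
    grind
  · by_cases h' : (l : ℕ) = i + 1
    · refine ⟨i, LinearMap.mulLeft K (f i.castSucc), fun x => ?_⟩
      funext j
      simp only [mulAt, Function.update_apply, Fin.ext_iff, Fin.lt_def, Fin.val_castSucc,
        Fin.val_succ, LinearMap.mulLeft_apply]
      grind
    · refine ⟨⟨l - 1, by omega⟩, LinearMap.id, fun x => ?_⟩
      funext j
      simp only [mulAt, Function.update_apply, Fin.ext_iff, Fin.lt_def, Fin.val_castSucc,
        Fin.val_succ, LinearMap.id_apply]
      grind

/-- `Φ ↦ (f_0, …, f_k ↦ Φ(f_0, …, f_i f_{i+1}, …, f_k))`. -/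
def innerMul {k : ℕ} (i : Fin k) : Cochain 𝒱 k →ₗ[K] Cochain 𝒱 (k + 1) where
  toFun Φ :=
    { toFun := fun f => Φ (mulAt i f)
      map_update_add' := by
        intro inst f l x y
        rw [Subsingleton.elim inst (instDecidableEqFin (k + 1))]
        obtain ⟨j, T, hT⟩ := mulAt_update (K := K) i f l
        simp [hT]
      map_update_smul' := by
        intro inst f l c x
        rw [Subsingleton.elim inst (instDecidableEqFin (k + 1))]
        obtain ⟨j, T, hT⟩ := mulAt_update (K := K) i f l
        simp [hT] }
  map_add' Φ Ψ := by ext; simp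
  map_smul' c Φ := by ext; simp

/-- `Φ ↦ s ∘ Φ ∘ s^{⊗k}` with the parity automorphism `s = (-1)^{deg}`: this is `(-1)^{|Φ|} Φ` for
homogeneous `Φ`. -/
def parityConj {k : ℕ} : Cochain 𝒱 k →ₗ[K] Cochain 𝒱 k where
  toFun Φ := (twist 𝒱 1).toLinearMap.compMultilinearMap
    (Φ.compLinearMap fun _ => (twist 𝒱 1).toLinearMap)
  map_add' Φ Ψ := by ext; simp
  map_smul' c Φ := by ext; simp

/-- Projection of `𝒪_V` to its even part. -/
def evenPart : OV 𝒱 →ₗ[K] OV 𝒱 := (2⁻¹ : K) • (LinearMap.id + (twist 𝒱 1).toLinearMap)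

/-- Projection of `𝒪_V` to its odd part. -/
def oddPart : OV 𝒱 →ₗ[K] OV 𝒱 := (2⁻¹ : K) • (LinearMap.id - (twist 𝒱 1).toLinearMap)

/-- The Hochschild differential
`(d_H Φ)(f_0, …, f_k) = - (-1)^{|f_0||Φ|} f_0 Φ(f_1, …, f_k)
  + ∑_{i=0}^{k-1} (-1)^i Φ(f_0, …, f_i f_{i+1}, …, f_k) + (-1)^k Φ(f_0, …, f_{k-1}) f_k`. -/
def hochDiff (k : ℕ) : Cochain 𝒱 k →ₗ[K] Cochain 𝒱 (k + 1) :=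
  -(leftMul 𝒱 (evenPart 𝒱) + leftMul 𝒱 (oddPart 𝒱) ∘ₗ parityConj 𝒱) +
    ∑ i : Fin k, (-1 : K) ^ (i : ℕ) • innerMul 𝒱 i + (-1 : K) ^ k • rightMul 𝒱

/-- The cochains of degree `e` with respect to the grading of `𝒪_V`. -/
def IsCochainDeg {k : ℕ} (e : ℤ) (Φ : Cochain 𝒱 k) : Prop :=
  ∀ (a : Fin k → ℤ) (f : Fin k → OV 𝒱), (∀ j, f j ∈ ovDeg 𝒱 (a j)) →
    Φ f ∈ ovDeg 𝒱 (∑ j, a j + e)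

/-! ### Polydifferential operators -/

/-- Words in homogeneous vectors of `V`, each letter given with its degree. -/
abbrev Word : Type v := List (Σ d : ℤ, 𝒱 d)

/-- The total degree of a word. -/
def wordDeg {𝒱 : ℤ → Submodule K V} (I : Word 𝒱) : ℤ := (I.map Sigma.fst).sum

/-- The iterated partial derivative `∂^{|I|} / ∂x^I` along the letters of `I`. -/
def partialWord (I : Word 𝒱) : OV 𝒱 →ₗ[K] OV 𝒱 :=
  (I.map fun l => (partialD 𝒱 l.1 l.2 : Module.End K (OV 𝒱))).prod

/-- The operator `a ∂^{I_1} ⊗ … ⊗ ∂^{I_k}`, that is,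
`(f_1, …, f_k) ↦ ± a ∂^{I_1} f_1 ⋯ ∂^{I_k} f_k` with the Koszul sign `(-1)^{|I_l||f_j|}` for every
pair `j < l`. -/
def polyDiffOp {k : ℕ} (a : OV 𝒱) (I : Fin k → Word 𝒱) : Cochain 𝒱 k :=
  (LinearMap.mulLeft K a).compMultilinearMap
    ((MultilinearMap.mkPiAlgebraFin K k (OV 𝒱)).compLinearMap fun j =>
      partialWord 𝒱 (I j) ∘ₗ (twist 𝒱 (∑ l ∈ Finset.Ioi j, wordDeg (I l))).toLinearMap)

/-- The polydifferential operators in `Hom(𝒪_V^{⊗k}, 𝒪_V)`, for `k = p + 1`: the span of the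
operators `a ∂^{I_1} ⊗ … ⊗ ∂^{I_k}` with nonempty words `I_1, …, I_k`. -/
def PolyDiff (p : ℕ) : Submodule K (Cochain 𝒱 (p + 1)) :=
  Submodule.span K {Φ | ∃ (a : OV 𝒱) (I : Fin (p + 1) → Word 𝒱),
    (∀ j, I j ≠ []) ∧ Φ = polyDiffOp 𝒱 a I}

/-- The span of the operators `ξ_1 ⋯ ξ_n ∂^{I_1} ⊗ … ⊗ ∂^{I_k}`, `k = p + 1`, with linear forms
`ξ_1, …, ξ_n` and with nonempty words `I_1, …, I_k` of total length `m`. -/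
def PolyDiffBi (p m n : ℕ) : Submodule K (Cochain 𝒱 (p + 1)) :=
  Submodule.span K {Φ | ∃ (ξ : Fin n → Module.Dual K V) (I : Fin (p + 1) → Word 𝒱),
    (∀ j, I j ≠ []) ∧ ∑ j, (I j).length = m ∧
      Φ = polyDiffOp 𝒱 (List.ofFn fun i => coord 𝒱 (ξ i)).prod I}

/-! ### The operator attached to a representation -/

variable {ι : Type*} [Fintype ι] (b : Module.Basis ι K V) (deg : ι → ℤ)

/-- The coefficient of the tensor `e_{A_1} ⊗ … ⊗ e_{A_m}` in an element of `V^{⊗m}`. -/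
def tensorCoeff {m : ℕ} (A : Fin m → ι) : (⨂[K] _ : Fin m, V) →ₗ[K] K :=
  PiTensorProduct.lift
    ((MultilinearMap.mkPiAlgebra K (Fin m) K).compLinearMap fun i => b.coord (A i))

/-- The word of those letters of `e_{A_1} ⋯ e_{A_m}` that sit at the places in the `j`-th block of
the ordered partition `c`, in increasing order. -/
def blockWord (hdeg : ∀ α, b α ∈ 𝒱 (deg α)) {m k : ℕ} (c : OrdPart m k) (A : Fin m → ι)
    (j : Fin k) : Word 𝒱 :=
  ((List.finRange m).filter fun i => c.1 i = j).map fun i => ⟨deg (A i), b (A i), hdeg (A i)⟩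

/-- The contribution of the corollas with `m` output and `n` input legs to the operator attached
to `ρ`. The sum runs over the corollas whose blocks `I_1, …, I_k` are consecutive intervals of
`[m]`, and over the multi-indices `J` and `A = I_1 ⋯ I_k`; the summand is
`Γ_J^{I_1, …, I_k} / (|J|! |I_1|! ⋯ |I_k|!) x^J ∂^{I_1} ⊗ … ⊗ ∂^{I_k}`, where `Γ_J^{I_1, …, I_k}` is
the coefficient at `e_{I_1} ⊗ … ⊗ e_{I_k}` of the value at `e_J` of `ρ` on the corolla. -/
def symbolPart (hdeg : ∀ α, b α ∈ 𝒱 (deg α)) {p : ℕ} (ρ : RepFin 𝒱 p) (m n : ℕ) :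
    Cochain 𝒱 (p + 1) :=
  open Classical in
  ∑ c : {c : OrdPart m (p + 1) // Monotone c.1}, ∑ J : Fin n → ι, ∑ A : Fin m → ι,
    (tensorCoeff b A (ρ.1 m n (Finsupp.single c.1 1) (PiTensorProduct.tprod K fun i => b (J i))) /
      ((Nat.factorial n : K) *
        ∏ j, (Nat.factorial (blockWord 𝒱 b deg hdeg c.1 A j).length : K))) •
      polyDiffOp 𝒱 (List.ofFn fun i => coord 𝒱 (b.coord (J i))).prod
        (blockWord 𝒱 b deg hdeg c.1 A)

/-- The polydifferential operator attached to `ρ`; the sum over `(m, n)` has finitely many nonzero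
terms. -/
def symbolOp (hdeg : ∀ α, b α ∈ 𝒱 (deg α)) {p : ℕ} (ρ : RepFin 𝒱 p) : Cochain 𝒱 (p + 1) :=
  ∑ᶠ mn : ℕ × ℕ, symbolPart 𝒱 b deg hdeg ρ mn.1 mn.2

end Polynomials

end PolyHoch

end

open scoped TensorProduct DirectSum

noncomputable section

namespace PolyHoch

universe u v

/-! Polydifferential operators form a Fock space. On `Cochain 𝒱 k` the derivative of the j-th
argument along a basis vector e_α is a creation operator (`createB`), the graded commutator with
multiplication of that argument by x^α is an annihilation operator (`annihB`), and the operators f ↦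
a f_1 ⋯ f_k (`prodOp`) are the vacua. In the same way 𝒪_V is a Fock space with creation operators
x^α, annihilation operators ∂_α and vacuum 1. Both systems satisfy the canonical commutation
relations `CCR`, with Koszul signs.

A representation amounts to a function `coeff` of two words, one in pairs (block, index) for the
outputs and one in indices for the inputs. It is symmetric up to Koszul signs in each word, vanishes
when some block is missing, and is supported in finitely many pairs of lengths (`exists_repFin`,
`repFin_ext`). An orbit count in characteristic zero replaces the sum over interval corollas with
the weights 1/∏|I_j|! by 1/m! times the sum over all words (`symbolPart_eq`). The operator attached
to a representation is thus a symmetric sum of creation operators in both Fock spaces. Annihilating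
and then evaluating at 1 and at the origin returns the coefficients (`extract_symbolOp`, by
`CCR.pairing_wordSum`), which gives injectivity. Conversely, `CCR.sum_create_annihilate` together
with Taylor's formula rebuilds an operator from its extracted coefficients (`exists_symbolOp_eq`),
which gives surjectivity. That each argument carries at least one derivative enters as vanishing on
constants, and this forces the coefficients with a missing block to be zero.

For the differentials, the Leibniz rule shows that each summand of d_H sends a sum over words to a
sum over words, with coefficients pulled back along a codegeneracy of the positions; the two outer
summands only see words that avoid the first or the last position. On words that use all positions
only the inner summands survive, and they are the merging of blocks in δ. On words that miss a
position everything cancels (`sum_codegeneracies`). Hence the isomorphism commutes with the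
differentials, and d_H preserves its image. Both squares vanish by the simplicial cancellation
`alternating_sum_fin`. Degrees and bidegrees are read off from coefficients, and the basis does not
matter because coefficients and extraction functionals change by the same matrices
(`symbolOp_basis_change`). -/

set_option linter.unusedSectionVars false

/-! ### Koszul signs of permutations. -/

section KoszulSigns

variable {K : Type u} [Field K]

/-- The sign of the exchange of two elements with given parities. -/
def swapSign (K : Type u) [Field K] (a b : Bool) : K := if a = true ∧ b = true then -1 else 1

theorem swapSign_comm (a b : Bool) : swapSign K a b = swapSign K b a := by
  cases a <;> cases b <;> simp [swapSign]

theorem swapSign_mul_self (a b : Bool) : swapSign K a b * swapSign K a b = 1 := by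
  cases a <;> cases b <;> simp [swapSign]

theorem sgn_eq_ite (a : ℤ) : sgn K a = if Odd a then -1 else 1 := by
  split_ifs with h
  · simp [sgn, Int.negOnePow_odd a h]
  · simp [sgn, Int.negOnePow_even a (Int.not_odd_iff_even.1 h)]

theorem sgn_mul_eq_swapSign (a b : ℤ) :
    sgn K (a * b) = swapSign K (decide (Odd a)) (decide (Odd b)) := by
  simp [sgn_eq_ite, swapSign, Int.odd_mul]

/-- A product over `finPairsLT` can be reindexed by `signBijAux`, the bijection of pairs behind the
multiplicativity of the ordinary sign. -/
theorem koszulSign_eq_prod_pairs {m : ℕ} (σ : Equiv.Perm (Fin m)) (ε : Fin m → Bool) :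
    koszulSign K σ ε = ∏ x ∈ Equiv.Perm.finPairsLT m,
      if σ x.2 < σ x.1 then 1 else swapSign K (ε x.2) (ε x.1) := by
  rw [Equiv.Perm.finPairsLT, Finset.prod_sigma, koszulSign, Finset.prod_comm]
  refine Finset.prod_congr rfl fun j _ => ?_
  rw [← Finset.prod_subset (Finset.subset_univ (Finset.Iio j))]
  · have : Finset.Iio j = (Finset.range j).attachFin fun k hk =>
        (Finset.mem_range.1 hk).trans j.2 := by
      ext i
      simp only [Finset.mem_Iio, Finset.mem_attachFin, Finset.mem_range, Fin.val_fin_lt]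
    rw [this]
    refine Finset.prod_congr rfl fun i hi => ?_
    have hij : i < j := by
      simpa only [Finset.mem_attachFin, Finset.mem_range, Fin.val_fin_lt] using hi
    have hne : σ i ≠ σ j := fun h => hij.ne (σ.injective h)
    by_cases h : σ i < σ j
    · simp [h, h.not_gt]
    · have h' : σ j < σ i := lt_of_le_of_ne (not_lt.1 h) hne.symm
      simp [h, h', hij, swapSign]
  · intro i _ hi
    have : ¬ i < j := by simpa using hi
    simp [this]

/-- A pair is inverted by σ τ exactly when one, but not both, of the following holds: τ inverts it,
or σ inverts its image under τ. When both hold, the two factors multiply to 1. -/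
theorem koszulSign_mul {m : ℕ} (σ τ : Equiv.Perm (Fin m)) (ε : Fin m → Bool) :
    koszulSign K (σ * τ) ε = koszulSign K σ (ε ∘ τ.symm) * koszulSign K τ ε := by
  -- The factors of σ are transported along τ to the original pairs. Since τ may reverse a pair, the
  -- absence of an inversion becomes an equivalence of two comparisons.
  have h : koszulSign K σ (ε ∘ τ.symm) = ∏ x ∈ Equiv.Perm.finPairsLT m,
      if (σ (τ x.2) < σ (τ x.1) ↔ τ x.2 < τ x.1) then 1 else swapSign K (ε x.2) (ε x.1) := by
    rw [koszulSign_eq_prod_pairs]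
    refine (Finset.prod_nbij (Equiv.Perm.signBijAux τ) Equiv.Perm.signBijAux_mem
      Equiv.Perm.signBijAux_injOn Equiv.Perm.signBijAux_surj ?_).symm
    rintro ⟨a, b⟩ hab
    have hba : b < a := Equiv.Perm.mem_finPairsLT.1 hab
    by_cases h : τ b < τ a
    · simp [Equiv.Perm.signBijAux, h]
    · have h1 : τ a < τ b := lt_of_le_of_ne (not_lt.1 h) fun e => hba.ne (τ.injective e).symm
      have h2 : σ (τ a) ≠ σ (τ b) := fun e => hba.ne (τ.injective (σ.injective e)).symm
      by_cases h3 : σ (τ b) < σ (τ a)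
      · simp [Equiv.Perm.signBijAux, h, h3, h3.not_gt, swapSign_comm]
      · have h4 : σ (τ a) < σ (τ b) := lt_of_le_of_ne (not_lt.1 h3) h2
        simp [Equiv.Perm.signBijAux, h, h4, h4.not_gt]
  rw [h, koszulSign_eq_prod_pairs, koszulSign_eq_prod_pairs, ← Finset.prod_mul_distrib]
  refine Finset.prod_congr rfl fun x _ => ?_
  by_cases h1 : τ x.2 < τ x.1 <;> by_cases h2 : σ (τ x.2) < σ (τ x.1) <;>
    simp [h1, h2, swapSign_mul_self]

theorem koszulSign_one {m : ℕ} (ε : Fin m → Bool) : koszulSign K 1 ε = 1 := by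
  refine Finset.prod_eq_one fun i _ => Finset.prod_eq_one fun j _ => if_neg ?_
  rintro ⟨h1, h2, -⟩
  exact absurd h1 (not_lt.2 h2.le)

/-- An adjacent transposition has a single inversion. -/
theorem koszulSign_swap {m : ℕ} (i : Fin m) (ε : Fin (m + 1) → Bool) :
    koszulSign K (Equiv.swap i.castSucc i.succ) ε = swapSign K (ε i.castSucc) (ε i.succ) := by
  have key : ∀ x y : Fin (m + 1), x < y →
      Equiv.swap i.castSucc i.succ y < Equiv.swap i.castSucc i.succ x →
      x = i.castSucc ∧ y = i.succ := by
    intro x y hxy h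
    simp only [Equiv.swap_apply_def, Fin.ext_iff, Fin.val_castSucc, Fin.val_succ] at h ⊢
    rw [Fin.lt_def] at hxy
    split_ifs at h <;> simp only [Fin.lt_def, Fin.val_castSucc, Fin.val_succ] at h <;> omega
  rw [koszulSign, Finset.prod_eq_single i.castSucc, Finset.prod_eq_single i.succ]
  · simp [swapSign]
  · intro y _ hy
    exact if_neg fun h => hy (key _ _ h.1 h.2.1).2
  · simp
  · intro x _ hx
    exact Finset.prod_eq_one fun y _ => if_neg fun h => hx (key _ _ h.1 h.2.1).1
  · simp

theorem koszulSign_mul_self {m : ℕ} (σ : Equiv.Perm (Fin m)) (ε : Fin m → Bool) :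
    koszulSign K σ ε * koszulSign K σ ε = 1 := by
  rw [koszulSign_eq_prod_pairs, ← Finset.prod_mul_distrib]
  refine Finset.prod_eq_one fun x _ => ?_
  split_ifs <;> simp [swapSign_mul_self]

/-! ### Functions of words that are symmetric up to Koszul signs -/

variable {L : Type*} {M : Type*} [AddCommGroup M] [Module K M]

/-- A function of words that changes by the Koszul sign when two neighbouring letters are
exchanged. -/
def SignSym (K : Type u) [Field K] {L : Type*} {M : Type*} [AddCommGroup M] [Module K M]
    (par : L → Bool) (h : List L → M) : Prop :=
  ∀ u a b v, h (u ++ a :: b :: v) = swapSign K (par a) (par b) • h (u ++ b :: a :: v)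

theorem SignSym.cons {par : L → Bool} {h : List L → M} (hh : SignSym K par h) (x : L) :
    SignSym K par fun l => h (x :: l) := fun u a b v => hh (x :: u) a b v

theorem SignSym.reverse {par : L → Bool} {h : List L → M} (hh : SignSym K par h) :
    SignSym K par fun l => h l.reverse := by
  intro u a b v
  have := hh v.reverse b a u.reverse
  simp only [List.reverse_append, List.reverse_cons, List.append_assoc,
    swapSign_comm (par a) (par b), List.cons_append, List.nil_append, this]

/-- The two equal signs cancel, so coefficient times operator is symmetric without signs. -/
theorem SignSym.smul {par : L → Bool} {g : List L → K} {h : List L → M} (hg : SignSym K par g)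
    (hh : SignSym K par h) (u : List L) (a b : L) (v : List L) :
    g (u ++ a :: b :: v) • h (u ++ a :: b :: v) = g (u ++ b :: a :: v) • h (u ++ b :: a :: v) := by
  rw [hg, hh, smul_eq_mul, smul_smul, mul_right_comm, swapSign_mul_self, one_mul]

theorem swap_succ_comp_succ {m : ℕ} (i : Fin m) (x : Fin (m + 1)) :
    Equiv.swap i.succ.castSucc i.succ.succ x.succ = (Equiv.swap i.castSucc i.succ x).succ := by
  rw [← Fin.succ_castSucc]
  simp only [Equiv.swap_apply_def, Fin.succ_inj]
  split_ifs <;> rfl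

theorem swap_succ_zero {m : ℕ} (i : Fin m) :
    Equiv.swap i.succ.castSucc i.succ.succ (0 : Fin (m + 2)) = 0 := by
  rw [← Fin.succ_castSucc]
  exact Equiv.swap_apply_of_ne_of_ne (Fin.succ_ne_zero _).symm (Fin.succ_ne_zero _).symm

theorem ofFn_comp_swap {m : ℕ} (Λ : Fin (m + 1) → L) (i : Fin m) :
    ∃ u v, List.ofFn Λ = u ++ Λ i.castSucc :: Λ i.succ :: v ∧
      List.ofFn (Λ ∘ Equiv.swap i.castSucc i.succ) = u ++ Λ i.succ :: Λ i.castSucc :: v := by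
  induction m with
  | zero => exact i.elim0
  | succ m ih =>
    induction i using Fin.cases with
    | zero =>
      refine ⟨[], List.ofFn fun t => Λ t.succ.succ, by simp [List.ofFn_succ], ?_⟩
      have h : ∀ t : Fin m, Equiv.swap (0 : Fin (m + 2)) 1 t.succ.succ = t.succ.succ := fun t =>
        Equiv.swap_apply_of_ne_of_ne (by simp [Fin.ext_iff]) (by simp [Fin.ext_iff])
      simp [List.ofFn_succ, h]
    | succ i =>
      obtain ⟨u, v, h1, h2⟩ := ih (fun t => Λ t.succ) i
      refine ⟨Λ 0 :: u, v, ?_, ?_⟩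
      · rw [List.ofFn_succ, h1, Fin.succ_castSucc]; rfl
      · rw [List.ofFn_succ]
        simp only [Function.comp_apply, swap_succ_comp_succ, swap_succ_zero]
        have h3 : (fun t => Λ (Equiv.swap i.castSucc i.succ t).succ) =
          (fun t => Λ t.succ) ∘ Equiv.swap i.castSucc i.succ := rfl
        rw [h3, h2, Fin.succ_castSucc]; rfl

/-- Adjacent transpositions generate the symmetric group, and `koszulSign_mul` is the cocycle rule
that makes the signs compose. -/
theorem SignSym.ofFn_perm {par : L → Bool} {h : List L → M} (hh : SignSym K par h) {m : ℕ}
    (σ : Equiv.Perm (Fin m)) (Λ : Fin m → L) :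
    h (List.ofFn (Λ ∘ σ.symm)) = koszulSign K σ (par ∘ Λ) • h (List.ofFn Λ) := by
  rcases m with _ | m
  · have : σ = 1 := Subsingleton.elim _ _
    subst this
    rw [koszulSign_one, one_smul]; rfl
  have hσ : σ ∈ Submonoid.closure (Set.range fun i : Fin m => Equiv.swap i.castSucc i.succ) := by
    rw [Equiv.Perm.mclosure_swap_castSucc_succ]; trivial
  induction hσ using Submonoid.closure_induction generalizing Λ with
  | mem σ hσ =>
    obtain ⟨i, rfl⟩ := hσ
    obtain ⟨u, v, h1, h2⟩ := ofFn_comp_swap Λ i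
    simp only [Equiv.symm_swap, h2, koszulSign_swap, h1]
    rw [hh, swapSign_comm]; rfl
  | one => rw [koszulSign_one, one_smul]; rfl
  | mul σ τ _ _ h1 h2 =>
    have h3 : Λ ∘ (σ * τ).symm = (Λ ∘ τ.symm) ∘ σ.symm := rfl
    rw [h3, h1, h2, koszulSign_mul, smul_smul, Function.comp_assoc]

/-- Presents any two neighbouring letters of a word as places exchanged by an adjacent
transposition; in this form equivariance under permutations yields `SignSym`. -/
theorem exists_ofFn_swap (u : List L) (a b : L) (v : List L) :
    ∃ (m : ℕ) (Λ : Fin (m + 1) → L) (i : Fin m), List.ofFn Λ = u ++ b :: a :: v ∧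
      List.ofFn (Λ ∘ Equiv.swap i.castSucc i.succ) = u ++ a :: b :: v ∧
      Λ i.castSucc = b ∧ Λ i.succ = a := by
  induction u with
  | nil =>
    refine ⟨v.length + 1, Fin.cons b (Fin.cons a v.get), 0, by simp, ?_, rfl, rfl⟩
    have h : ∀ t : Fin v.length, Equiv.swap (0 : Fin (v.length + 2)) 1 t.succ.succ = t.succ.succ :=
      fun t => Equiv.swap_apply_of_ne_of_ne (by simp [Fin.ext_iff]) (by simp [Fin.ext_iff])
    rw [List.ofFn_succ, List.ofFn_succ]
    have h2 : (fun t : Fin v.length => (Fin.cons b (Fin.cons a v.get : Fin (v.length + 1) → L) :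
        Fin (v.length + 2) → L) t.succ.succ) = v.get := rfl
    simp only [Function.comp_apply, Fin.castSucc_zero, Fin.succ_zero_eq_one, Equiv.swap_apply_left,
      Equiv.swap_apply_right, h]
    rw [h2, List.ofFn_get]; rfl
  | cons x u ih =>
    obtain ⟨m, Λ, i, h1, h2, h3, h4⟩ := ih
    refine ⟨m + 1, Fin.cons x Λ, i.succ, by rw [List.ofFn_cons, h1]; rfl, ?_, ?_, by simpa using h4⟩
    · rw [List.ofFn_succ]
      simp only [Function.comp_apply, swap_succ_comp_succ, swap_succ_zero, Fin.cons_zero,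
        Fin.cons_succ]
      rw [List.cons_append, ← h2]; rfl
    · rw [← Fin.succ_castSucc, Fin.cons_succ, h3]

end KoszulSigns

/-! ### Canonical commutation relations on an abstract Fock space. -/

section Fock

variable {K : Type u} [Field K] {L : Type*} [Fintype L] {C : Type*} [AddCommGroup C] [Module K C]

theorem sum_words_succ {M : Type*} [AddCommMonoid M] (m : ℕ) (F : List L → M) :
    ∑ Λ : Fin (m + 1) → L, F (List.ofFn Λ) = ∑ x : L, ∑ Λ : Fin m → L, F (x :: List.ofFn Λ) := by
  rw [← (Fin.consEquiv fun _ : Fin (m + 1) => L).sum_comp, Fintype.sum_prod_type]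
  refine Finset.sum_congr rfl fun x _ => Finset.sum_congr rfl fun Λ _ => ?_
  congr 1
  simp [Fin.consEquiv, List.ofFn_succ]

theorem sum_words_reverse {M : Type*} [AddCommMonoid M] (m : ℕ) (F : List L → M) :
    ∑ Λ : Fin m → L, F (List.ofFn Λ).reverse = ∑ Λ : Fin m → L, F (List.ofFn Λ) := by
  rw [← (Equiv.arrowCongr Fin.revPerm (Equiv.refl L)).sum_comp]
  refine Finset.sum_congr rfl fun Λ _ => ?_
  congr 1
  apply List.ext_getElem
  · simp
  · intro i h1 h2
    simp only [List.getElem_reverse, List.getElem_ofFn, List.length_ofFn]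
    simp only [Equiv.arrowCongr_apply, Equiv.coe_refl, Function.comp_apply, id_eq,
      Fin.revPerm_symm, Fin.revPerm_apply]
    congr 1
    simp [Fin.ext_iff, Fin.rev]
    simp at h1
    omega

/-- The composition of the operators attached to the letters of a word. -/
def opWord (T : L → Module.End K C) (l : List L) : Module.End K C := (l.map T).prod

theorem opWord_nil (T : L → Module.End K C) : opWord T [] = 1 := rfl

theorem opWord_cons (T : L → Module.End K C) (x : L) (l : List L) :
    opWord T (x :: l) = T x * opWord T l := by simp [opWord]

theorem opWord_append (T : L → Module.End K C) (l l' : List L) :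
    opWord T (l ++ l') = opWord T l * opWord T l' := by simp [opWord]

theorem opWord_signSym {par : L → Bool} {T : L → Module.End K C}
    (hT : ∀ a b, T a * T b = swapSign K (par a) (par b) • (T b * T a)) :
    SignSym K par (opWord T) := by
  intro u a b v
  rw [opWord_append, opWord_append]
  simp only [opWord_cons, ← mul_assoc _ _ (opWord T v), hT a b]
  simp

/-- The sum of `G(l) Cr_l v` over all words `l` with `m` letters. -/
def wordSum (Cr : L → Module.End K C) (m : ℕ) (G : List L → K) (v : C) : C :=
  ∑ Λ : Fin m → L, G (List.ofFn Λ) • opWord Cr (List.ofFn Λ) v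

theorem wordSum_succ (Cr : L → Module.End K C) (m : ℕ) (G : List L → K) (v : C) :
    wordSum Cr (m + 1) G v = ∑ x, Cr x (wordSum Cr m (fun l => G (x :: l)) v) := by
  rw [wordSum, sum_words_succ m fun l => G l • opWord Cr l v]
  refine Finset.sum_congr rfl fun x _ => ?_
  simp [wordSum, opWord_cons]

theorem wordSum_zero (Cr : L → Module.End K C) (G : List L → K) (v : C) :
    wordSum Cr 0 G v = G [] • v := by
  simp [wordSum, opWord]

theorem wordSum_smul (Cr : L → Module.End K C) (m : ℕ) (c : K) (G : List L → K) (v : C) :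
    wordSum Cr m (fun l => c * G l) v = c • wordSum Cr m G v := by
  simp [wordSum, Finset.smul_sum, mul_smul]

variable [DecidableEq L] {A Cr : L → Module.End K C} {par : L → Bool}

/-- Annihilation operators `A` and creation operators `Cr` satisfy the canonical commutation
relations. -/
def CCR (K : Type u) [Field K] {L : Type*} [DecidableEq L] {C : Type*} [AddCommGroup C]
    [Module K C] (par : L → Bool) (A Cr : L → Module.End K C) : Prop :=
  ∀ x y, A x * Cr y = (if x = y then 1 else 0) + swapSign K (par x) (par y) • (Cr y * A x)

theorem CCR.apply (hAC : CCR K par A Cr) (x y : L) (v : C) :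
    A x (Cr y v) = (if x = y then v else 0) + swapSign K (par x) (par y) • Cr y (A x v) := by
  have := LinearMap.congr_fun (hAC x y) v
  simp only [Module.End.mul_apply, LinearMap.add_apply, LinearMap.smul_apply] at this
  rw [this]
  split_ifs <;> simp

/-- This is the derivative of a symmetric form: each of the m + 1 letters can be the one removed,
and by symmetry all contribute equally. The leading letter gives the Kronecker term of `CCR`, and
induction gives the other m. -/
theorem CCR.annihilate_wordSum (hAC : CCR K par A Cr) {v : C} (hv : ∀ x, A x v = 0) (x : L)
    (m : ℕ) {G : List L → K} (hG : SignSym K par G) :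
    A x (wordSum Cr (m + 1) G v) = ((m + 1 : ℕ) : K) • wordSum Cr m (fun l => G (x :: l)) v := by
  induction m generalizing G with
  | zero =>
    rw [wordSum_succ]
    simp [map_sum, wordSum_zero, hAC.apply, hv]
  | succ m ih =>
    have h1 : ∀ y, A x (Cr y (wordSum Cr (m + 1) (fun l => G (y :: l)) v)) =
        (if x = y then wordSum Cr (m + 1) (fun l => G (y :: l)) v else 0) +
          ((m + 1 : ℕ) : K) • Cr y (wordSum Cr m (fun l => G (x :: y :: l)) v) := by
      intro y
      rw [hAC.apply, ih (hG.cons y)]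
      congr 1
      -- Moving x in front of y in the coefficient costs the sign that `A x` picked up in passing
      -- `Cr y`; the two cancel.
      have h2 : (fun l => G (y :: x :: l)) =
          fun l => swapSign K (par x) (par y) * G (x :: y :: l) := by
        funext l
        rw [swapSign_comm]
        exact hG [] y x l
      rw [h2, wordSum_smul, map_smul, map_smul, smul_smul, smul_smul, mul_right_comm,
        swapSign_mul_self, one_mul]
    rw [wordSum_succ, map_sum, Finset.sum_congr rfl fun y _ => h1 y, Finset.sum_add_distrib,
      ← Finset.smul_sum, ← wordSum_succ Cr m (fun l => G (x :: l))]
    simp only [Finset.sum_ite_eq, Finset.mem_univ, if_true]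
    rw [Nat.cast_succ (m + 1), add_smul, one_smul, add_comm]

/-- The functional kills everything created and the annihilators kill the vacuum, so only equal
lengths survive. The successive annihilations contribute m, m - 1, …, 1. The reversal makes the head
of `l` act first, and so strip the first letter of the argument of `G`. -/
theorem CCR.pairing_wordSum (hAC : CCR K par A Cr) {v : C} (hv : ∀ x, A x v = 0)
    {N : Type*} [AddCommGroup N] [Module K N] (θ : C →ₗ[K] N) (hθ : ∀ x, θ ∘ₗ Cr x = 0)
    (l : List L) (m : ℕ) {G : List L → K} (hG : SignSym K par G) :
    θ (opWord A l.reverse (wordSum Cr m G v)) =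
      if l.length = m then (m.factorial * G l : K) • θ v else 0 := by
  induction l generalizing m G with
  | nil =>
    rcases m with _ | m
    · simp [opWord, wordSum_zero]
    · have h : ∀ x w, θ (Cr x w) = 0 := fun x w => LinearMap.congr_fun (hθ x) w
      simp [opWord, wordSum_succ, map_sum, h]
  | cons x l ih =>
    rw [List.reverse_cons, opWord_append]
    simp only [opWord_cons, opWord_nil, mul_one, Module.End.mul_apply]
    rcases m with _ | m
    · simp [wordSum_zero, hv]
    · rw [hAC.annihilate_wordSum hv x m hG, map_smul, map_smul, ih m (hG.cons x)]
      simp only [List.length_cons, Nat.add_right_cancel_iff]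
      split_ifs
      · rw [smul_smul, Nat.factorial_succ, Nat.cast_mul, mul_assoc]
      · simp

/-- The span of the vectors obtained from a space of vacuum vectors by `m` creation operators. -/
def fockDeg (Cr : L → Module.End K C) (W : Submodule K C) (m : ℕ) : Submodule K C :=
  Submodule.span K {Φ | ∃ (l : List L) (v : C), l.length = m ∧ v ∈ W ∧ Φ = opWord Cr l v}

theorem create_mem_fockDeg {W : Submodule K C} {m : ℕ} (x : L) {Φ : C}
    (hΦ : Φ ∈ fockDeg Cr W m) : Cr x Φ ∈ fockDeg Cr W (m + 1) := by
  induction hΦ using Submodule.span_induction with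
  | mem Φ h =>
    obtain ⟨l, v, hl, hv, rfl⟩ := h
    exact Submodule.subset_span ⟨x :: l, v, by simp [hl], hv, by rw [opWord_cons]; rfl⟩
  | zero => simp
  | add Φ Ψ _ _ h1 h2 => rw [map_add]; exact add_mem h1 h2
  | smul c Φ _ h => rw [map_smul]; exact Submodule.smul_mem _ _ h

theorem annihilate_vacuum {W : Submodule K C}
    (hW : ∀ v ∈ W, ∀ x, A x v = 0) (x : L) {Φ : C} (hΦ : Φ ∈ fockDeg Cr W 0) : A x Φ = 0 := by
  induction hΦ using Submodule.span_induction with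
  | mem Φ h =>
    obtain ⟨l, v, hl, hv, rfl⟩ := h
    rw [List.length_eq_zero_iff] at hl
    subst hl
    exact hW v hv x
  | zero => simp
  | add Φ Ψ _ _ h1 h2 => rw [map_add, h1, h2, add_zero]
  | smul c Φ _ h => rw [map_smul, h, smul_zero]

theorem CCR.annihilate_mem_fockDeg (hAC : CCR K par A Cr) {W : Submodule K C}
    (hW : ∀ v ∈ W, ∀ x, A x v = 0) (x : L) {m : ℕ} {Φ : C}
    (hΦ : Φ ∈ fockDeg Cr W (m + 1)) : A x Φ ∈ fockDeg Cr W m := by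
  induction hΦ using Submodule.span_induction with
  | mem Φ h =>
    obtain ⟨l, v, hl, hv, rfl⟩ := h
    induction l generalizing m with
    | nil => simp at hl
    | cons y l ih =>
      rw [opWord_cons, Module.End.mul_apply, hAC.apply]
      have hl' : l.length = m := by simpa using hl
      refine add_mem ?_ (Submodule.smul_mem _ _ ?_)
      · split_ifs
        · exact Submodule.subset_span ⟨l, v, hl', hv, rfl⟩
        · exact zero_mem _
      · rcases m with _ | m
        · rw [List.length_eq_zero_iff] at hl'
          subst hl'
          simp [opWord_nil, hW v hv]
        · exact create_mem_fockDeg y (ih hl')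
  | zero => simp
  | add Φ Ψ _ _ h1 h2 => rw [map_add]; exact add_mem h1 h2
  | smul c Φ _ h => rw [map_smul]; exact Submodule.smul_mem _ _ h

theorem CCR.opWord_mem_fockDeg (hAC : CCR K par A Cr) {W : Submodule K C}
    (hW : ∀ v ∈ W, ∀ x, A x v = 0) (l : List L) {m : ℕ} {Φ : C}
    (hΦ : Φ ∈ fockDeg Cr W (l.length + m)) : opWord A l Φ ∈ fockDeg Cr W m := by
  induction l generalizing m with
  | nil => simpa [opWord_nil] using hΦ
  | cons x l ih =>
    rw [opWord_cons, Module.End.mul_apply]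
    refine hAC.annihilate_mem_fockDeg hW x (ih ?_)
    rwa [List.length_cons, add_right_comm, add_assoc] at hΦ

theorem CCR.opWord_eq_zero (hAC : CCR K par A Cr) {W : Submodule K C}
    (hW : ∀ v ∈ W, ∀ x, A x v = 0) (l : List L) {m : ℕ} {Φ : C}
    (hΦ : Φ ∈ fockDeg Cr W m) (hl : m < l.length) : opWord A l Φ = 0 := by
  induction l with
  | nil => simp at hl
  | cons x l ih =>
    rw [opWord_cons, Module.End.mul_apply]
    rcases Nat.lt_succ_iff_lt_or_eq.1 hl with h | h
    · rw [ih h, map_zero]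
    · subst h
      exact annihilate_vacuum hW x (hAC.opWord_mem_fockDeg hW l (m := 0) hΦ)

/-- On a word each letter is counted once: in passing a letter y, the Kronecker term contributes 1,
and the sign from `CCR` cancels the sign from exchanging `Cr x` with `Cr y`. -/
theorem CCR.number_operator (hAC : CCR K par A Cr)
    (hC : ∀ x y, Cr x * Cr y = swapSign K (par x) (par y) • (Cr y * Cr x)) {W : Submodule K C}
    (hW : ∀ v ∈ W, ∀ x, A x v = 0) {m : ℕ} {Φ : C} (hΦ : Φ ∈ fockDeg Cr W m) :
    ∑ x, Cr x (A x Φ) = (m : K) • Φ := by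
  induction hΦ using Submodule.span_induction with
  | mem Φ h =>
    obtain ⟨l, v, rfl, hv, rfl⟩ := h
    induction l with
    | nil => simp [opWord_nil, hW v hv]
    | cons y l ih =>
      have hC' : ∀ x w, swapSign K (par x) (par y) • Cr x (Cr y w) = Cr y (Cr x w) := by
        intro x w
        have := LinearMap.congr_fun (hC x y) w
        simp only [Module.End.mul_apply, LinearMap.smul_apply] at this
        rw [this, smul_smul, swapSign_mul_self, one_smul]
      rw [opWord_cons, Module.End.mul_apply]
      simp only [hAC.apply, map_add, map_smul, hC', Finset.sum_add_distrib, ← map_sum]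
      rw [ih]
      have h1 : ∀ x, Cr x (if x = y then opWord Cr l v else 0) =
          if x = y then Cr y (opWord Cr l v) else 0 := by
        intro x
        split_ifs with h
        · rw [h]
        · simp
      simp only [h1, Finset.sum_ite_eq', Finset.mem_univ, if_true, List.length_cons, map_smul]
      push_cast
      rw [add_smul, one_smul, add_comm]
  | zero => simp
  | add Φ Ψ _ _ h1 h2 => simp only [map_add, Finset.sum_add_distrib, h1, h2, smul_add]
  | smul c Φ _ h => simp only [map_smul, ← Finset.smul_sum, h, smul_comm c]

/-- Iterated number operator, used as a resolution of the identity: a vector of Fock degree m is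
recovered from its m-fold annihilations up to m!. Surjectivity rests on this. -/
theorem CCR.sum_create_annihilate (hAC : CCR K par A Cr)
    (hC : ∀ x y, Cr x * Cr y = swapSign K (par x) (par y) • (Cr y * Cr x)) {W : Submodule K C}
    (hW : ∀ v ∈ W, ∀ x, A x v = 0) {m : ℕ} {Φ : C} (hΦ : Φ ∈ fockDeg Cr W m) :
    ∑ Λ : Fin m → L, opWord Cr (List.ofFn Λ) (opWord A (List.ofFn Λ).reverse Φ) =
      (m.factorial : K) • Φ := by
  induction m generalizing Φ with
  | zero => simp [opWord_nil]
  | succ m ih =>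
    rw [sum_words_succ m fun l => opWord Cr l (opWord A l.reverse Φ)]
    have h1 : ∀ x (l : List L), opWord Cr (x :: l) (opWord A (x :: l).reverse Φ) =
        Cr x (opWord Cr l (opWord A l.reverse (A x Φ))) := by
      intro x l
      rw [List.reverse_cons, opWord_append]
      simp [opWord_cons, opWord_nil]
    simp only [h1, ← map_sum]
    simp only [ih (hAC.annihilate_mem_fockDeg hW _ hΦ), map_smul, ← Finset.smul_sum,
      hAC.number_operator hC hW hΦ]
    rw [smul_smul, Nat.factorial_succ, mul_comm]
    push_cast
    rfl

end Fock

/-! ### Homogeneous bases and their coordinate forms. -/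

section ScaleDeg

variable {K : Type u} [Field K] {V : Type v} [AddCommGroup V] [Module K V]
  (𝒱 : ℤ → Submodule K V) [DirectSum.Decomposition 𝒱]

theorem scaleDeg_scaleDeg (c c' : ℤ → K) (w : V) :
    scaleDeg 𝒱 c (scaleDeg 𝒱 c' w) = scaleDeg 𝒱 (fun e => c e * c' e) w := by
  induction w using DirectSum.Decomposition.inductionOn 𝒱 with
  | zero => simp
  | homogeneous w => simp only [scaleDeg_of_mem 𝒱 _ w.2, map_smul, smul_smul, mul_comm]
  | add w w' h h' => simp only [map_add, h, h']

theorem scaleDeg_one (w : V) : scaleDeg 𝒱 (fun _ => (1 : K)) w = w := by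
  induction w using DirectSum.Decomposition.inductionOn 𝒱 with
  | zero => simp
  | homogeneous w => simp [scaleDeg_of_mem 𝒱 _ w.2]
  | add w w' h h' => simp only [map_add, h, h']

theorem basis_coord_of_mem {ι : Type*} (b : Module.Basis ι K V) {deg : ι → ℤ}
    (hdeg : ∀ α, b α ∈ 𝒱 (deg α)) (α : ι) {e : ℤ} (he : e ≠ deg α) {w : V} (hw : w ∈ 𝒱 e) :
    b.coord α w = 0 := by
  classical
  -- This scaling is the projection to degree e. The coordinate form is an eigenvector of its
  -- transpose, as can be checked on the basis.
  let c : ℤ → K := fun d => if d = e then 1 else 0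
  have h1 : b.coord α ∘ₗ scaleDeg 𝒱 c = c (deg α) • b.coord α := by
    refine b.ext fun β => ?_
    simp only [LinearMap.comp_apply, scaleDeg_of_mem 𝒱 c (hdeg β), map_smul, LinearMap.smul_apply]
    by_cases h : β = α
    · rw [h]
    · simp [h]
  have h2 := LinearMap.congr_fun h1 w
  rw [LinearMap.comp_apply, scaleDeg_of_mem 𝒱 c hw] at h2
  simpa [c, he.symm] using h2

theorem basis_coord_mem_dualDeg {ι : Type*} (b : Module.Basis ι K V) {deg : ι → ℤ}
    (hdeg : ∀ α, b α ∈ 𝒱 (deg α)) (α : ι) : b.coord α ∈ dualDeg 𝒱 (-deg α) := by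
  intro e he w hw
  exact basis_coord_of_mem 𝒱 b hdeg α (by simpa using he) hw

end ScaleDeg

/-! ### Gradings, twists and partial derivatives on 𝒪_V. -/

section Algebra

variable {K : Type u} [Field K] {V : Type v} [AddCommGroup V] [Module K V]
  (𝒱 : ℤ → Submodule K V)

theorem OV.induction {P : OV 𝒱 → Prop} (h0 : ∀ r : K, P (algebraMap K (OV 𝒱) r))
    (h1 : ∀ ξ, P (coord 𝒱 ξ)) (hm : ∀ f g, P f → P g → P (f * g))
    (ha : ∀ f g, P f → P g → P (f + g)) (f : OV 𝒱) : P f := by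
  obtain ⟨t, rfl⟩ := OV.mk_surjective 𝒱 f
  induction t using TensorAlgebra.induction with
  | algebraMap r => simpa using h0 r
  | ι ξ => exact h1 ξ
  | mul s t hs ht => rw [map_mul]; exact hm _ _ hs ht
  | add s t hs ht => rw [map_add]; exact ha _ _ hs ht

theorem OV.algHom_ext {B : Type*} [Ring B] [Algebra K B] {f g : OV 𝒱 →ₐ[K] B}
    (h : ∀ ξ, f (coord 𝒱 ξ) = g (coord 𝒱 ξ)) : f = g := by
  ext x
  induction x using OV.induction with
  | h0 r => simp
  | h1 ξ => exact h ξ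
  | hm x y hx hy => rw [map_mul, map_mul, hx, hy]
  | ha x y hx hy => rw [map_add, map_add, hx, hy]

/-- The value at the origin of a polynomial function. -/
def evalZero : OV 𝒱 →ₐ[K] K :=
  OV.lift 𝒱 (TensorAlgebra.lift K 0) (by
    rintro _ _ ⟨a, b, ξ, η, hξ, hη⟩
    simp)

theorem evalZero_coord (ξ : Module.Dual K V) : evalZero 𝒱 (coord 𝒱 ξ) = 0 := by
  simp [evalZero, coord, OV.lift_mk]

theorem ovDeg_one : (1 : OV 𝒱) ∈ ovDeg 𝒱 0 :=
  Submodule.subset_span ⟨0, Fin.elim0, Fin.elim0, fun i => i.elim0, by simp, by simp⟩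

theorem coord_mul_mem_ovDeg {a e : ℤ} {ξ : Module.Dual K V} (hξ : ξ ∈ dualDeg 𝒱 a) {f : OV 𝒱}
    (hf : f ∈ ovDeg 𝒱 e) : coord 𝒱 ξ * f ∈ ovDeg 𝒱 (a + e) := by
  induction hf using Submodule.span_induction with
  | mem f h =>
    obtain ⟨n, η, c, hη, hc, rfl⟩ := h
    refine Submodule.subset_span ⟨n + 1, Fin.cons ξ η, Fin.cons a c, ?_, ?_, ?_⟩
    · intro i
      induction i using Fin.cases with
      | zero => exact hξ
      | succ i => exact hη i
    · simp [Fin.sum_univ_succ, hc]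
    · simp [List.ofFn_succ]
  | zero => simp
  | add f g _ _ h1 h2 => rw [mul_add]; exact add_mem h1 h2
  | smul c f _ h => rw [mul_smul_comm]; exact Submodule.smul_mem _ _ h

theorem ovDeg_induction {P : ℤ → OV 𝒱 → Prop} (h1 : P 0 1)
    (hc : ∀ a e ξ f, ξ ∈ dualDeg 𝒱 a → f ∈ ovDeg 𝒱 e → P e f → P (a + e) (coord 𝒱 ξ * f))
    (h0 : ∀ e, P e 0) (ha : ∀ e f g, P e f → P e g → P e (f + g))
    (hs : ∀ e (c : K) f, P e f → P e (c • f)) {e : ℤ} {f : OV 𝒱} (hf : f ∈ ovDeg 𝒱 e) :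
    P e f := by
  induction hf using Submodule.span_induction with
  | mem f h =>
    obtain ⟨n, ξ, a, hξ, rfl, rfl⟩ := h
    induction n with
    | zero => simpa using h1
    | succ n ih =>
      rw [List.ofFn_succ, List.prod_cons, Fin.sum_univ_succ]
      exact hc _ _ _ _ (hξ 0) (Submodule.subset_span ⟨n, _, _, fun i => hξ i.succ, rfl, rfl⟩)
        (ih _ _ fun i => hξ i.succ)
  | zero => exact h0 e
  | add f g _ _ h1 h2 => exact ha _ _ _ h1 h2
  | smul c f _ h => exact hs _ _ _ h

theorem mul_mem_ovDeg {a e : ℤ} {f g : OV 𝒱} (hf : f ∈ ovDeg 𝒱 a) (hg : g ∈ ovDeg 𝒱 e) :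
    f * g ∈ ovDeg 𝒱 (a + e) := by
  refine ovDeg_induction 𝒱 (P := fun a f => f * g ∈ ovDeg 𝒱 (a + e))
    ?h1 ?hc ?h0 ?ha ?hs hf
  case h1 => simpa using hg
  case hc => intro a' e' ξ f hξ _ h; rw [mul_assoc, add_assoc]; exact coord_mul_mem_ovDeg 𝒱 hξ h
  case h0 => intros; simp
  case ha => intro e f g h1 h2; rw [add_mul]; exact add_mem h1 h2
  case hs => intro e c f h; rw [smul_mul_assoc]; exact Submodule.smul_mem _ _ h

theorem evalZero_of_mem {e : ℤ} {f : OV 𝒱} (hf : f ∈ ovDeg 𝒱 e) : e ≠ 0 → evalZero 𝒱 f = 0 := by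
  refine ovDeg_induction 𝒱 (P := fun e f => e ≠ 0 → evalZero 𝒱 f = 0)
    ?h1 ?hc ?h0 ?ha ?hs hf
  case h1 => exact fun h => absurd rfl h
  case hc => intro a' e' ξ f _ _ _; simp [evalZero_coord]
  case h0 => intros; simp
  case ha => intro e f g h1 h2 h; rw [map_add, h1 h, h2 h, add_zero]
  case hs => intro e c f h1 h; rw [map_smul, h1 h, smul_zero]

variable [DirectSum.Decomposition 𝒱]

theorem twist_coord_scaleDeg (d : ℤ) (ξ : Module.Dual K V) :
    twist 𝒱 d (coord 𝒱 ξ) = coord 𝒱 (ξ ∘ₗ scaleDeg 𝒱 fun e => sgn K (d * e)) := by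
  simp only [twist, coord, LinearMap.comp_apply, AlgHom.toLinearMap_apply,
    OV.lift_mk, TensorAlgebra.lift_ι_apply]
  rfl

theorem twist_twist (d e : ℤ) (f : OV 𝒱) : twist 𝒱 d (twist 𝒱 e f) = twist 𝒱 (d + e) f := by
  have : (twist 𝒱 d).comp (twist 𝒱 e) = twist 𝒱 (d + e) := by
    refine OV.algHom_ext 𝒱 fun ξ => ?_
    simp only [AlgHom.comp_apply, twist_coord_scaleDeg]
    congr 1
    ext w
    simp only [LinearMap.comp_apply, scaleDeg_scaleDeg, add_mul, sgn_add,
      mul_comm (sgn K (e * _))]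
  exact DFunLike.congr_fun this f

theorem twist_of_even {d : ℤ} (hd : Even d) (f : OV 𝒱) : twist 𝒱 d f = f := by
  have : twist 𝒱 d = AlgHom.id K (OV 𝒱) := by
    refine OV.algHom_ext 𝒱 fun ξ => ?_
    rw [twist_coord_scaleDeg]
    have h : (fun e => sgn K (d * e)) = fun _ => (1 : K) := by
      funext e
      simp [sgn, Int.negOnePow_even _ (hd.mul_right e)]
    rw [h, AlgHom.id_apply]
    congr 1
    ext w
    rw [LinearMap.comp_apply, scaleDeg_one]
  rw [this, AlgHom.id_apply]

theorem twist_zero (f : OV 𝒱) : twist 𝒱 0 f = f := twist_of_even 𝒱 Even.zero f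

theorem twist_self (d : ℤ) (f : OV 𝒱) : twist 𝒱 d (twist 𝒱 d f) = f := by
  rw [twist_twist, twist_of_even 𝒱 ⟨d, rfl⟩]

theorem twist_of_odd {d : ℤ} (hd : Odd d) (f : OV 𝒱) : twist 𝒱 d f = twist 𝒱 1 f := by
  obtain ⟨k, rfl⟩ := hd
  rw [add_comm, ← twist_twist, twist_of_even 𝒱 (even_two_mul k)]

theorem twist_comm (d e : ℤ) (f : OV 𝒱) :
    twist 𝒱 d (twist 𝒱 e f) = twist 𝒱 e (twist 𝒱 d f) := by
  rw [twist_twist, twist_twist, add_comm]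

theorem twist_of_mem (d : ℤ) {e : ℤ} {f : OV 𝒱} (hf : f ∈ ovDeg 𝒱 e) :
    twist 𝒱 d f = sgn K (d * e) • f := by
  refine ovDeg_induction 𝒱 (P := fun e f => twist 𝒱 d f = sgn K (d * e) • f)
    ?h1 ?hc ?h0 ?ha ?hs hf
  case h1 => simp [sgn]
  case hc =>
    intro a e ξ f hξ _ h
    rw [map_mul, twist_coord 𝒱 d hξ, h, smul_mul_smul_comm, ← sgn_add, mul_add]
  case h0 => intros; simp
  case ha => intro e f g h1 h2; rw [map_add, h1, h2, smul_add]
  case hs => intro e c f h; rw [map_smul, h, smul_comm]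

theorem partialD_algebraMap (d : ℤ) (w : 𝒱 d) (r : K) :
    partialD 𝒱 d w (algebraMap K (OV 𝒱) r) = 0 := by
  simp [partialD, Matrix.algebraMap_matrix_apply]

theorem partialD_one (d : ℤ) (w : 𝒱 d) : partialD 𝒱 d w 1 = 0 := by
  rw [← map_one (algebraMap K (OV 𝒱)), partialD_algebraMap]

theorem partialD_coord_mul (d : ℤ) (w : 𝒱 d) {a : ℤ} {ξ : Module.Dual K V} (hξ : ξ ∈ dualDeg 𝒱 a)
    (f : OV 𝒱) : partialD 𝒱 d w (coord 𝒱 ξ * f) =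
      ξ (w : V) • f + sgn K (d * a) • (coord 𝒱 ξ * partialD 𝒱 d w f) := by
  rw [partialD_mul, partialD_coord, twist_coord 𝒱 d hξ, smul_mul_assoc, ← Algebra.smul_def]

theorem partialD_mem_ovDeg (d : ℤ) (w : 𝒱 d) {e : ℤ} {f : OV 𝒱} (hf : f ∈ ovDeg 𝒱 e) :
    partialD 𝒱 d w f ∈ ovDeg 𝒱 (e + d) := by
  refine ovDeg_induction 𝒱 (P := fun e f => partialD 𝒱 d w f ∈ ovDeg 𝒱 (e + d))
    ?h1 ?hc ?h0 ?ha ?hs hf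
  case h1 => rw [partialD_one]; exact zero_mem _
  case hc =>
    intro a e ξ f hξ hf h
    rw [partialD_coord_mul 𝒱 d w hξ]
    refine add_mem ?_ (Submodule.smul_mem _ _ ?_)
    · by_cases ha : d = -a
      · have hd : a + e + d = e := by omega
        rw [hd]
        exact Submodule.smul_mem _ _ hf
      · rw [hξ d ha w w.2, zero_smul]
        exact zero_mem _
    · rw [add_assoc]
      exact coord_mul_mem_ovDeg 𝒱 hξ h
  case h0 => intros; simp
  case ha => intro e f g h1 h2; rw [map_add]; exact add_mem h1 h2
  case hs => intro e c f h; rw [map_smul]; exact Submodule.smul_mem _ _ h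

/-- A linear operator that is homogeneous of degree `d` as far as signs are concerned. -/
def HasParity (d : ℤ) (T : OV 𝒱 →ₗ[K] OV 𝒱) : Prop :=
  ∀ e f, twist 𝒱 e (T f) = sgn K (e * d) • T (twist 𝒱 e f)

theorem hasParity_partialD (d : ℤ) (w : 𝒱 d) : HasParity 𝒱 d (partialD 𝒱 d w) := by
  intro e f
  induction f using OV.induction with
  | h0 r => simp [partialD_algebraMap]
  | h1 ξ =>
    rw [twist_coord_scaleDeg, partialD_coord, partialD_coord, AlgHom.commutes,
      LinearMap.comp_apply, scaleDeg_of_mem 𝒱 _ w.2, map_smul, smul_eq_mul, map_mul,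
      ← Algebra.smul_def, smul_smul, sgn_mul_self, one_smul]
  | hm f g hf hg =>
    rw [partialD_mul, map_add, map_mul, map_mul, hf, hg, map_mul, partialD_mul, twist_comm,
      smul_mul_assoc, mul_smul_comm, smul_add]
  | ha f g hf hg => rw [map_add, map_add, map_add, map_add, hf, hg, smul_add]

theorem hasParity_mulLeft {a : ℤ} {ξ : Module.Dual K V} (hξ : ξ ∈ dualDeg 𝒱 a) :
    HasParity 𝒱 a (LinearMap.mulLeft K (coord 𝒱 ξ)) := by
  intro e f
  rw [LinearMap.mulLeft_apply, map_mul, twist_coord 𝒱 e hξ, smul_mul_assoc,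
    LinearMap.mulLeft_apply]

/-- Signs only see degrees modulo 2. So a coordinate form of degree -d and the derivative of degree
d dual to it can be treated with the same d. -/
theorem HasParity.neg {d : ℤ} {T : OV 𝒱 →ₗ[K] OV 𝒱} (h : HasParity 𝒱 (-d) T) :
    HasParity 𝒱 d T := by
  intro e f
  rw [h, mul_neg, sgn_neg]

/-- Both composites vanish on generators, and on products the twisted Leibniz rule gives matching
terms, since a twist passes a derivative at the cost of the Koszul sign. -/
theorem partialD_comm (d d' : ℤ) (w : 𝒱 d) (w' : 𝒱 d') (f : OV 𝒱) :
    partialD 𝒱 d w (partialD 𝒱 d' w' f) =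
      sgn K (d * d') • partialD 𝒱 d' w' (partialD 𝒱 d w f) := by
  induction f using OV.induction with
  | h0 r => simp [partialD_algebraMap]
  | h1 ξ => simp [partialD_coord, partialD_algebraMap]
  | hm f g hf hg =>
    have h1 := hasParity_partialD 𝒱 d w d' f
    have h2 := hasParity_partialD 𝒱 d' w' d f
    have hs := sgn_mul_self (K := K) (d * d')
    simp only [partialD_mul, map_add, hf, hg, h1, h2, mul_comm d' d, smul_add, smul_mul_assoc,
      mul_smul_comm, smul_smul, hs, one_smul, twist_comm 𝒱 d d']
    abel
  | ha f g hf hg => simp only [map_add, hf, hg, smul_add]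

/-! ### Even and odd parts -/

theorem evenPart_apply (f : OV 𝒱) : evenPart 𝒱 f = (2⁻¹ : K) • (f + twist 𝒱 1 f) := rfl

theorem oddPart_apply (f : OV 𝒱) : oddPart 𝒱 f = (2⁻¹ : K) • (f - twist 𝒱 1 f) := rfl

theorem evenPart_twist (d : ℤ) (f : OV 𝒱) : evenPart 𝒱 (twist 𝒱 d f) = evenPart 𝒱 f := by
  rw [evenPart_apply, evenPart_apply]
  rcases Int.even_or_odd d with h | h
  · rw [twist_of_even 𝒱 h]
  · rw [twist_of_odd 𝒱 h, twist_self, add_comm]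

theorem oddPart_twist (d : ℤ) (f : OV 𝒱) :
    oddPart 𝒱 (twist 𝒱 d f) = sgn K d • oddPart 𝒱 f := by
  rw [oddPart_apply, oddPart_apply]
  rcases Int.even_or_odd d with h | h
  · rw [twist_of_even 𝒱 h, sgn, Int.negOnePow_even _ h]
    simp
  · rw [twist_of_odd 𝒱 h, twist_self, sgn, Int.negOnePow_odd _ h, ← neg_sub, smul_neg]
    simp

theorem twist_evenPart (f : OV 𝒱) : twist 𝒱 1 (evenPart 𝒱 f) = evenPart 𝒱 f := by
  rw [evenPart_apply, map_smul, map_add, twist_self, add_comm]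

theorem twist_oddPart (f : OV 𝒱) : twist 𝒱 1 (oddPart 𝒱 f) = -oddPart 𝒱 f := by
  rw [oddPart_apply, map_smul, map_sub, twist_self, ← smul_neg, neg_sub]

variable [CharZero K]

theorem evenPart_add_oddPart (f : OV 𝒱) : evenPart 𝒱 f + oddPart 𝒱 f = f := by
  rw [evenPart_apply, oddPart_apply, ← smul_add, add_add_sub_cancel, ← two_smul K f, smul_smul,
    inv_mul_cancel₀ two_ne_zero, one_smul]

theorem evenPart_mul (f g : OV 𝒱) : evenPart 𝒱 (f * g) =
    evenPart 𝒱 f * evenPart 𝒱 g + oddPart 𝒱 f * oddPart 𝒱 g := by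
  simp only [evenPart_apply, oddPart_apply, map_mul, smul_mul_smul_comm, ← smul_add]
  have h : (f + twist 𝒱 1 f) * (g + twist 𝒱 1 g) + (f - twist 𝒱 1 f) * (g - twist 𝒱 1 g) =
      (2 : K) • (f * g + twist 𝒱 1 f * twist 𝒱 1 g) := by
    rw [two_smul]; noncomm_ring
  rw [h, smul_smul, mul_assoc, inv_mul_cancel₀ two_ne_zero, mul_one]

theorem oddPart_mul (f g : OV 𝒱) : oddPart 𝒱 (f * g) =
    evenPart 𝒱 f * oddPart 𝒱 g + oddPart 𝒱 f * evenPart 𝒱 g := by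
  simp only [evenPart_apply, oddPart_apply, map_mul, smul_mul_smul_comm, ← smul_add]
  have h : (f + twist 𝒱 1 f) * (g - twist 𝒱 1 g) + (f - twist 𝒱 1 f) * (g + twist 𝒱 1 g) =
      (2 : K) • (f * g - twist 𝒱 1 f * twist 𝒱 1 g) := by
    rw [two_smul]; noncomm_ring
  rw [h, smul_smul, mul_assoc, inv_mul_cancel₀ two_ne_zero, mul_one]

end Algebra

/-! ### 𝒪_V as the Fock space of the operators x^α and ∂_α. -/

section AlgebraBasis

variable {K : Type u} [Field K] {V : Type v} [AddCommGroup V] [Module K V]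
  (𝒱 : ℤ → Submodule K V) [DirectSum.Decomposition 𝒱]
  {ι : Type*} [Fintype ι] [DecidableEq ι] (b : Module.Basis ι K V) {deg : ι → ℤ}
  (hdeg : ∀ α, b α ∈ 𝒱 (deg α))

/-- The parity of an index. -/
def par (deg : ι → ℤ) (α : ι) : Bool := decide (Odd (deg α))

/-- Multiplication by the coordinate function `x^α`. -/
def mulX (α : ι) : Module.End K (OV 𝒱) := LinearMap.mulLeft K (coord 𝒱 (b.coord α))

/-- The partial derivative along the basis vector `e_α`. -/
def partialB (α : ι) : Module.End K (OV 𝒱) := partialD 𝒱 (deg α) ⟨b α, hdeg α⟩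

theorem coord_eq_sum (ξ : Module.Dual K V) :
    coord 𝒱 ξ = ∑ α, ξ (b α) • coord 𝒱 (b.coord α) := by
  simp only [← map_smul, ← map_sum]
  congr 1
  refine b.ext fun β => ?_
  simp

include hdeg in
theorem mulX_mul_mulX (α β : ι) : mulX 𝒱 b α * mulX 𝒱 b β =
    swapSign K (par deg α) (par deg β) • (mulX 𝒱 b β * mulX 𝒱 b α) := by
  ext f
  have h := coord_comm 𝒱 (basis_coord_mem_dualDeg 𝒱 b hdeg α) (basis_coord_mem_dualDeg 𝒱 b hdeg β)
  rw [neg_mul_neg, sgn_mul_eq_swapSign] at h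
  simp only [mulX, Module.End.mul_apply, LinearMap.mulLeft_apply, LinearMap.smul_apply,
    ← mul_assoc, h, smul_mul_assoc, par]

theorem partialB_mul_partialB (α β : ι) : partialB 𝒱 b hdeg α * partialB 𝒱 b hdeg β =
    swapSign K (par deg α) (par deg β) • (partialB 𝒱 b hdeg β * partialB 𝒱 b hdeg α) := by
  ext f
  have h := partialD_comm 𝒱 (deg α) (deg β) ⟨b α, hdeg α⟩ ⟨b β, hdeg β⟩ f
  rwa [sgn_mul_eq_swapSign] at h

/-- This is the twisted Leibniz rule for a coordinate times f. The degree of x^β is `-deg β`, which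
has the parity of `deg β`. -/
theorem ccr_polynomials : CCR K (par deg) (partialB 𝒱 b hdeg) (mulX 𝒱 b) := by
  intro α β
  ext f
  have h := partialD_coord_mul 𝒱 (deg α) ⟨b α, hdeg α⟩ (basis_coord_mem_dualDeg 𝒱 b hdeg β) f
  rw [mul_neg, sgn_neg, sgn_mul_eq_swapSign] at h
  simp only [mulX, partialB, Module.End.mul_apply, LinearMap.mulLeft_apply, LinearMap.smul_apply,
    LinearMap.add_apply, h, par]
  congr 1
  rcases eq_or_ne α β with rfl | h
  · simp
  · simp [h]

theorem partialB_one (α : ι) : partialB 𝒱 b hdeg α 1 = 0 := partialD_one 𝒱 _ _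

theorem OV.basis_induction {P : OV 𝒱 → Prop} (h0 : ∀ r : K, P (algebraMap K (OV 𝒱) r))
    (h1 : ∀ α, P (coord 𝒱 (b.coord α))) (hm : ∀ f g, P f → P g → P (f * g))
    (ha : ∀ f g, P f → P g → P (f + g)) (f : OV 𝒱) : P f := by
  induction f using OV.induction with
  | h0 r => exact h0 r
  | h1 ξ =>
    rw [coord_eq_sum 𝒱 b]
    refine Finset.sum_induction _ P ha (by simpa using h0 0) fun α _ => ?_
    rw [Algebra.smul_def]
    exact hm _ _ (h0 _) (h1 α)
  | hm f g hf hg => exact hm f g hf hg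
  | ha f g hf hg => exact ha f g hf hg

-- Commutation with a linear form extends from generators to all of 𝒪_V once the sign is written as
-- the automorphism `twist`.
include hdeg in
theorem coord_mul_eq {a : ℤ} {ξ : Module.Dual K V} (hξ : ξ ∈ dualDeg 𝒱 a) (f : OV 𝒱) :
    coord 𝒱 ξ * f = twist 𝒱 a f * coord 𝒱 ξ := by
  induction f using OV.basis_induction 𝒱 b with
  | h0 r => rw [AlgHom.commutes, Algebra.commutes]
  | h1 α =>
    have hα := basis_coord_mem_dualDeg 𝒱 b hdeg α
    rw [coord_comm 𝒱 hξ hα, twist_coord 𝒱 a hα, smul_mul_assoc]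
  | hm f g hf hg => rw [← mul_assoc, hf, mul_assoc, hg, map_mul, mul_assoc]
  | ha f g hf hg => rw [mul_add, hf, hg, map_add, add_mul]

/-- The monomial `x^J`. -/
def monomialX (J : List ι) : OV 𝒱 := opWord (mulX 𝒱 b) J 1

theorem monomialX_eq (J : List ι) :
    monomialX 𝒱 b J = (J.map fun α => coord 𝒱 (b.coord α)).prod := by
  induction J with
  | nil => rfl
  | cons α J ih =>
    rw [List.map_cons, List.prod_cons, ← ih]
    simp [monomialX, opWord_cons, mulX]

theorem span_monomialX : Submodule.span K (Set.range (monomialX 𝒱 b)) = ⊤ := by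
  rw [eq_top_iff]
  rintro f -
  induction f using OV.basis_induction 𝒱 b with
  | h0 r =>
    rw [Algebra.algebraMap_eq_smul_one]
    exact Submodule.smul_mem _ _ (Submodule.subset_span ⟨[], rfl⟩)
  | h1 α => exact Submodule.subset_span ⟨[α], by simp [monomialX_eq]⟩
  | hm f g hf hg =>
    have : f * g ∈ Submodule.span K (Set.range (monomialX 𝒱 b)) *
      Submodule.span K (Set.range (monomialX 𝒱 b)) := Submodule.mul_mem_mul hf hg
    rw [Submodule.span_mul_span] at this
    refine Submodule.span_mono ?_ this
    rintro _ ⟨_, ⟨J, rfl⟩, _, ⟨J', rfl⟩, rfl⟩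
    exact ⟨J ++ J', by simp [monomialX_eq]⟩
  | ha f g hf hg => exact add_mem hf hg

/-- The span of the monomials of polynomial degree `n`. -/
def monomialSpan (n : ℕ) : Submodule K (OV 𝒱) :=
  Submodule.span K {f | ∃ J : List ι, J.length = n ∧ f = monomialX 𝒱 b J}

theorem monomialSpan_le_fockDeg (n : ℕ) :
    monomialSpan 𝒱 b n ≤ fockDeg (mulX 𝒱 b) (Submodule.span K {1}) n := by
  refine Submodule.span_mono ?_
  rintro _ ⟨J, hJ, rfl⟩
  exact ⟨J, 1, hJ, Submodule.mem_span_singleton_self 1, rfl⟩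

theorem vacuum_polynomials : ∀ f ∈ Submodule.span K {(1 : OV 𝒱)}, ∀ α,
    partialB 𝒱 b hdeg α f = 0 := by
  intro f hf α
  obtain ⟨c, rfl⟩ := Submodule.mem_span_singleton.1 hf
  rw [map_smul, partialB_one, smul_zero]

/-- Taylor expansion of a homogeneous polynomial. -/
theorem sum_taylor {n : ℕ} {f : OV 𝒱} (hf : f ∈ monomialSpan 𝒱 b n) :
    ∑ J : Fin n → ι, evalZero 𝒱 (opWord (partialB 𝒱 b hdeg) (List.ofFn J).reverse f) •
      monomialX 𝒱 b (List.ofFn J) = (n.factorial : K) • f := by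
  have hf' := monomialSpan_le_fockDeg 𝒱 b n hf
  rw [← (ccr_polynomials 𝒱 b hdeg).sum_create_annihilate (mulX_mul_mulX 𝒱 b hdeg)
    (vacuum_polynomials 𝒱 b hdeg) hf']
  refine Finset.sum_congr rfl fun J _ => ?_
  -- After n derivatives a polynomial of degree n is a constant, so `evalZero` loses nothing and the
  -- resolution of the identity becomes Taylor's formula.
  have h : opWord (partialB 𝒱 b hdeg) (List.ofFn J).reverse f ∈
      fockDeg (mulX 𝒱 b) (Submodule.span K {(1 : OV 𝒱)}) 0 :=
    (ccr_polynomials 𝒱 b hdeg).opWord_mem_fockDeg (vacuum_polynomials 𝒱 b hdeg) _ (by simpa)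
  have h' : ∃ c : K, opWord (partialB 𝒱 b hdeg) (List.ofFn J).reverse f = c • 1 := by
    generalize opWord (partialB 𝒱 b hdeg) (List.ofFn J).reverse f = g at h
    induction h using Submodule.span_induction with
    | mem g h =>
      obtain ⟨l, v, hl, hv, rfl⟩ := h
      rw [List.length_eq_zero_iff] at hl
      subst hl
      obtain ⟨c, rfl⟩ := Submodule.mem_span_singleton.1 hv
      exact ⟨c, rfl⟩
    | zero => exact ⟨0, by simp⟩
    | add f g _ _ h1 h2 =>
      obtain ⟨c, rfl⟩ := h1
      obtain ⟨c', rfl⟩ := h2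
      exact ⟨c + c', by rw [add_smul]⟩
    | smul c f _ h =>
      obtain ⟨c', rfl⟩ := h
      exact ⟨c * c', by rw [mul_smul]⟩
  obtain ⟨c, hc⟩ := h'
  rw [hc, map_smul, map_one, map_smul, smul_eq_mul, mul_one]
  rfl

theorem evalZero_comp_mulX (α : ι) : (evalZero 𝒱).toLinearMap ∘ₗ mulX 𝒱 b α = 0 := by
  ext f
  simp [mulX, evalZero_coord]

theorem evalZero_partial_wordSum (w : List ι) (n : ℕ) {G : List ι → K}
    (hG : SignSym K (par deg) G) :
    evalZero 𝒱 (opWord (partialB 𝒱 b hdeg) w.reverse (wordSum (mulX 𝒱 b) n G 1)) =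
      if w.length = n then (n.factorial * G w : K) else 0 := by
  have := (ccr_polynomials 𝒱 b hdeg).pairing_wordSum (partialB_one 𝒱 b hdeg)
    (evalZero 𝒱).toLinearMap (evalZero_comp_mulX 𝒱 b) w n hG
  simpa using this

theorem partialD_eq_sum (d : ℤ) (w : 𝒱 d) :
    partialD 𝒱 d w = ∑ α, b.coord α (w : V) • partialB 𝒱 b hdeg α := by
  ext f
  have hf : f ∈ Submodule.span K (Set.range (monomialX 𝒱 b)) := by
    rw [span_monomialX]; trivial
  induction hf using Submodule.span_induction with
  | mem f h =>
    obtain ⟨J, rfl⟩ := h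
    induction J with
    | nil => simp [monomialX, opWord_nil, partialD_one, partialB_one]
    | cons β J ih =>
      have hβ := basis_coord_mem_dualDeg 𝒱 b hdeg β
      have h1 : monomialX 𝒱 b (β :: J) = coord 𝒱 (b.coord β) * monomialX 𝒱 b J := by
        simp [monomialX, opWord_cons, mulX]
      rw [h1, partialD_coord_mul 𝒱 d w hβ, ih]
      simp only [LinearMap.sum_apply, LinearMap.smul_apply, partialB,
        partialD_coord_mul 𝒱 _ _ hβ, smul_add, Finset.sum_add_distrib, Finset.mul_sum,
        Finset.smul_sum]
      congr 1
      · simp [Finsupp.single_apply]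
      · refine Finset.sum_congr rfl fun α _ => ?_
        -- The Leibniz sign of `partialB` involves `deg α` rather than d, but the coefficient
        -- vanishes when they differ.
        by_cases h : deg α = d
        · subst h
          rw [mul_smul_comm, smul_comm]
        · rw [basis_coord_of_mem 𝒱 b hdeg α (Ne.symm h) w.2]
          simp
  | zero => simp
  | add f g _ _ h1 h2 => rw [map_add, map_add, h1, h2]
  | smul c f _ h => rw [map_smul, map_smul, h]

variable [CharZero K]

-- Even parts are central and odd parts commute up to the parity automorphism. With this the signed
-- left multiplication in d_H maps `prodOp` to `prodOp`, for an arbitrary first argument.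
include b hdeg in
theorem evenPart_oddPart_comm (f : OV 𝒱) : (∀ a, evenPart 𝒱 f * a = a * evenPart 𝒱 f) ∧
    ∀ a, oddPart 𝒱 f * twist 𝒱 1 a = a * oddPart 𝒱 f := by
  induction f using OV.basis_induction 𝒱 b with
  | h0 r =>
    have h1 : evenPart 𝒱 (algebraMap K (OV 𝒱) r) = algebraMap K (OV 𝒱) r := by
      rw [evenPart_apply, AlgHom.commutes, ← two_smul K, smul_smul,
        inv_mul_cancel₀ two_ne_zero, one_smul]
    have h2 : oddPart 𝒱 (algebraMap K (OV 𝒱) r) = 0 := by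
      rw [oddPart_apply, AlgHom.commutes, sub_self, smul_zero]
    simp [h1, h2, Algebra.commutes]
  | h1 α =>
    have hα := basis_coord_mem_dualDeg 𝒱 b hdeg α
    have hc := coord_mul_eq 𝒱 b hdeg hα
    have ht := twist_coord 𝒱 1 hα
    rw [one_mul, sgn_neg, sgn_eq_ite] at ht
    rcases Int.even_or_odd (deg α) with h | h
    · rw [if_neg (Int.not_odd_iff_even.2 h), one_smul] at ht
      have h1 : evenPart 𝒱 (coord 𝒱 (b.coord α)) = coord 𝒱 (b.coord α) := by
        rw [evenPart_apply, ht, ← two_smul K, smul_smul, inv_mul_cancel₀ two_ne_zero, one_smul]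
      have h2 : oddPart 𝒱 (coord 𝒱 (b.coord α)) = 0 := by
        rw [oddPart_apply, ht, sub_self, smul_zero]
      refine ⟨fun a => ?_, fun a => by simp [h2]⟩
      rw [h1, hc, twist_of_even 𝒱 h.neg]
    · rw [if_pos h, neg_one_smul] at ht
      have h1 : evenPart 𝒱 (coord 𝒱 (b.coord α)) = 0 := by
        rw [evenPart_apply, ht, add_neg_cancel, smul_zero]
      have h2 : oddPart 𝒱 (coord 𝒱 (b.coord α)) = coord 𝒱 (b.coord α) := by
        rw [oddPart_apply, ht, sub_neg_eq_add, ← two_smul K, smul_smul,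
          inv_mul_cancel₀ two_ne_zero, one_smul]
      refine ⟨fun a => by simp [h1], fun a => ?_⟩
      rw [h2, hc, twist_of_odd 𝒱 h.neg, twist_self]
  | hm f g hf hg =>
    obtain ⟨f0, f1⟩ := hf
    obtain ⟨g0, g1⟩ := hg
    refine ⟨fun a => ?_, fun a => ?_⟩
    · rw [evenPart_mul, add_mul, mul_add, mul_assoc, g0, ← mul_assoc, f0, mul_assoc, mul_assoc]
      -- A product of two odd parts twists a twice, hence not at all.
      have h := g1 (twist 𝒱 1 a)
      rw [twist_self] at h
      rw [h, ← mul_assoc (oddPart 𝒱 f), f1, mul_assoc]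
    · rw [oddPart_mul, add_mul, mul_add, mul_assoc, g1, ← mul_assoc, f0, mul_assoc, mul_assoc, g0,
        ← mul_assoc (oddPart 𝒱 f), f1, mul_assoc]
  | ha f g hf hg =>
    refine ⟨fun a => ?_, fun a => ?_⟩
    · rw [map_add, add_mul, mul_add, hf.1, hg.1]
    · rw [map_add, add_mul, mul_add, hf.2, hg.2]

end AlgebraBasis

/-! ### Operators acting on one argument of a cochain. -/

section Slots

variable {K : Type u} [Field K] {V : Type v} [AddCommGroup V] [Module K V]
  (𝒱 : ℤ → Submodule K V) [DirectSum.Decomposition 𝒱]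

/-- Sign comparisons below reduce to two tuples that differ in one argument only. -/
theorem cochain_eq_smul {k : ℕ} (Φ : Cochain 𝒱 k) (j : Fin k) (c : K) {f g : Fin k → OV 𝒱}
    (hj : f j = c • g j) (h : ∀ q, q ≠ j → f q = g q) : Φ f = c • Φ g := by
  have : f = Function.update g j (c • g j) := by
    funext q
    by_cases hq : q = j
    · subst hq; simp [hj]
    · simp [hq, h q hq]
  rw [this, MultilinearMap.map_update_smul, Function.update_eq_self]

theorem cochain_eq_add {k : ℕ} (Φ : Cochain 𝒱 k) (j : Fin k) {f g g' : Fin k → OV 𝒱}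
    (hj : f j = g j + g' j) (h : ∀ q, q ≠ j → f q = g q) (h' : ∀ q, q ≠ j → f q = g' q) :
    Φ f = Φ g + Φ g' := by
  have h1 : f = Function.update f j (g j + g' j) := by rw [← hj, Function.update_eq_self]
  have h2 : Function.update f j (g j) = g := by
    funext q
    by_cases hq : q = j
    · subst hq; simp
    · simp [hq, h q hq]
  have h3 : Function.update f j (g' j) = g' := by
    funext q
    by_cases hq : q = j
    · subst hq; simp
    · simp [hq, h' q hq]
  rw [h1, MultilinearMap.map_update_add, h2, h3]

/-- The operator `T` of degree `d` acting on the `j`-th argument of a cochain, with the Koszul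
sign from the passage over the preceding arguments. -/
def slot {k : ℕ} (j : Fin k) (d : ℤ) (T : Module.End K (OV 𝒱)) : Module.End K (Cochain 𝒱 k) :=
  MultilinearMap.compLinearMapₗ fun q =>
    if q < j then (twist 𝒱 d).toLinearMap else if q = j then T else LinearMap.id

theorem slot_apply {k : ℕ} (j : Fin k) (d : ℤ) (T : Module.End K (OV 𝒱)) (Φ : Cochain 𝒱 k)
    (f : Fin k → OV 𝒱) : slot 𝒱 j d T Φ f =
      Φ fun q => if q < j then twist 𝒱 d (f q) else if q = j then T (f q) else f q := by
  simp only [slot, MultilinearMap.compLinearMapₗ_apply, MultilinearMap.compLinearMap_apply]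
  congr 1
  funext q
  split_ifs <;> rfl

/-- Only the argument j meets both an operator and a non-commuting twist, namely `T` and `twist d'`;
their exchange is the sign. -/
theorem slot_mul_slot_of_lt {k : ℕ} {j j' : Fin k} (hj : j < j') {d : ℤ} (d' : ℤ)
    {T : Module.End K (OV 𝒱)} (T' : Module.End K (OV 𝒱)) (hT : HasParity 𝒱 d T) :
    slot 𝒱 j d T * slot 𝒱 j' d' T' = sgn K (d * d') • (slot 𝒱 j' d' T' * slot 𝒱 j d T) := by
  ext Φ f
  simp only [Module.End.mul_apply, LinearMap.smul_apply, _root_.smul_apply, slot_apply]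
  refine cochain_eq_smul 𝒱 Φ j _ ?_ fun q hq => ?_
  · simp [hj, hT d', mul_comm d' d]
  · rcases lt_or_gt_of_ne hq with h | h
    · simp [h, h.trans hj, twist_comm 𝒱 d d']
    · simp [h.ne', h.not_gt]

theorem slot_mul_slot_of_ne {k : ℕ} {j j' : Fin k} (hj : j ≠ j') {d d' : ℤ}
    {T T' : Module.End K (OV 𝒱)} (hT : HasParity 𝒱 d T) (hT' : HasParity 𝒱 d' T') :
    slot 𝒱 j d T * slot 𝒱 j' d' T' = sgn K (d * d') • (slot 𝒱 j' d' T' * slot 𝒱 j d T) := by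
  rcases lt_or_gt_of_ne hj with h | h
  · exact slot_mul_slot_of_lt 𝒱 h d' T' hT
  · rw [slot_mul_slot_of_lt 𝒱 h d T hT', smul_smul, mul_comm d' d, sgn_mul_self, one_smul]

/-- A slot acts by precomposition, which reverses the order of the operators. -/
theorem slot_mul_slot_self {k : ℕ} (j : Fin k) (d d' : ℤ) (T T' : Module.End K (OV 𝒱)) :
    slot 𝒱 j d T * slot 𝒱 j d' T' = slot 𝒱 j (d + d') (T' * T) := by
  ext Φ f
  simp only [Module.End.mul_apply, slot_apply]
  congr 1
  funext q
  rcases lt_trichotomy q j with h | rfl | h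
  · simp [h, twist_twist, add_comm]
  · simp
  · simp [h.ne', h.not_gt]

theorem slot_add {k : ℕ} (j : Fin k) (d : ℤ) (T T' : Module.End K (OV 𝒱)) :
    slot 𝒱 j d (T + T') = slot 𝒱 j d T + slot 𝒱 j d T' := by
  ext Φ f
  simp only [LinearMap.add_apply, _root_.add_apply, slot_apply]
  refine cochain_eq_add 𝒱 Φ j ?_ (fun q hq => ?_) fun q hq => ?_ <;> simp_all

theorem slot_smul {k : ℕ} (j : Fin k) (d : ℤ) (c : K) (T : Module.End K (OV 𝒱)) :
    slot 𝒱 j d (c • T) = c • slot 𝒱 j d T := by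
  ext Φ f
  simp only [LinearMap.smul_apply, _root_.smul_apply, slot_apply]
  refine cochain_eq_smul 𝒱 Φ j _ ?_ (fun q hq => ?_) <;> simp_all

theorem slot_zero {k : ℕ} (j : Fin k) (d : ℤ) : slot 𝒱 j d (0 : Module.End K (OV 𝒱)) = 0 := by
  have := slot_smul 𝒱 j d (0 : K) 0
  rwa [zero_smul, zero_smul] at this

theorem slot_sum {k : ℕ} (j : Fin k) (d : ℤ) {ι : Type*} (s : Finset ι)
    (T : ι → Module.End K (OV 𝒱)) :
    slot 𝒱 j d (∑ i ∈ s, T i) = ∑ i ∈ s, slot 𝒱 j d (T i) := by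
  classical
  induction s using Finset.induction_on with
  | empty => simp [slot_zero]
  | insert a s ha ih => rw [Finset.sum_insert ha, Finset.sum_insert ha, slot_add, ih]

theorem slot_one {k : ℕ} (j : Fin k) {d : ℤ} (hd : Even d) :
    slot 𝒱 j d (1 : Module.End K (OV 𝒱)) = 1 := by
  ext Φ f
  simp only [slot_apply, Module.End.one_apply, twist_of_even 𝒱 hd, ite_self]

/-- Multiplication of the values of a cochain by a linear form of degree `-d`, with the Koszul sign
for the passage over the cochain. -/
def conjMul {k : ℕ} (d : ℤ) (ξ : Module.Dual K V) : Module.End K (Cochain 𝒱 k) where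
  toFun Φ := (LinearMap.mulLeft K (coord 𝒱 ξ) ∘ₗ (twist 𝒱 d).toLinearMap).compMultilinearMap
    (Φ.compLinearMap fun _ => (twist 𝒱 d).toLinearMap)
  map_add' Φ Ψ := by ext; simp [mul_add]
  map_smul' c Φ := by ext; simp

theorem conjMul_apply {k : ℕ} (d : ℤ) (ξ : Module.Dual K V) (Φ : Cochain 𝒱 k)
    (f : Fin k → OV 𝒱) : conjMul 𝒱 d ξ Φ f =
      coord 𝒱 ξ * twist 𝒱 d (Φ fun q => twist 𝒱 d (f q)) := rfl

theorem conjMul_mul_slot {k : ℕ} (j : Fin k) (d : ℤ) {d' : ℤ} (ξ : Module.Dual K V)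
    {T : Module.End K (OV 𝒱)} (hT : HasParity 𝒱 d' T) :
    conjMul 𝒱 d ξ * slot 𝒱 j d' T = sgn K (d * d') • (slot 𝒱 j d' T * conjMul 𝒱 d ξ) := by
  ext Φ f
  simp only [Module.End.mul_apply, LinearMap.smul_apply, _root_.smul_apply, slot_apply,
    conjMul_apply]
  rw [← mul_smul_comm, ← map_smul]
  congr 2
  refine cochain_eq_smul 𝒱 Φ j _ ?_ fun q hq => ?_
  · simp [hT d, smul_smul, sgn_mul_self]
  · simp only [hq, if_false]
    split_ifs
    · rw [twist_comm]
    · rfl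

theorem conjMul_mul_conjMul {k : ℕ} (d d' : ℤ) {ξ η : Module.Dual K V} (hξ : ξ ∈ dualDeg 𝒱 (-d))
    (hη : η ∈ dualDeg 𝒱 (-d')) : (conjMul 𝒱 d ξ * conjMul 𝒱 d' η : Module.End K (Cochain 𝒱 k)) =
      sgn K (d * d') • (conjMul 𝒱 d' η * conjMul 𝒱 d ξ) := by
  ext Φ f
  have h := coord_comm 𝒱 hξ hη
  rw [neg_mul_neg] at h
  simp only [Module.End.mul_apply, LinearMap.smul_apply, _root_.smul_apply,
    conjMul_apply, map_mul, twist_coord 𝒱 d hη, twist_coord 𝒱 d' hξ, mul_neg, sgn_neg,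
    mul_comm d' d, smul_mul_assoc, mul_smul_comm, ← mul_assoc, h, twist_comm 𝒱 d d']

/-- The graded commutator with the multiplication of the `j`-th argument by a linear form of
degree `-d`. -/
def contract {k : ℕ} (j : Fin k) (d : ℤ) (ξ : Module.Dual K V) : Module.End K (Cochain 𝒱 k) :=
  slot 𝒱 j d (LinearMap.mulLeft K (coord 𝒱 ξ)) - conjMul 𝒱 d ξ

/-- The canonical commutation relation on cochains. The summand `conjMul` commutes with every slot
up to the Koszul sign, as do distinct slots, so the only anomaly is the Leibniz term ξ(w) in a
common slot. -/
theorem contract_mul_slot {k : ℕ} (j j' : Fin k) (d d' : ℤ) {ξ : Module.Dual K V}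
    (hξ : ξ ∈ dualDeg 𝒱 (-d)) (w : 𝒱 d') :
    contract 𝒱 j d ξ * slot 𝒱 j' d' (partialD 𝒱 d' w) =
      (if j = j' then ξ (w : V) • 1 else 0) +
        sgn K (d * d') • (slot 𝒱 j' d' (partialD 𝒱 d' w) * contract 𝒱 j d ξ) := by
  have hx : HasParity 𝒱 d (LinearMap.mulLeft K (coord 𝒱 ξ)) := (hasParity_mulLeft 𝒱 hξ).neg
  have hw := hasParity_partialD 𝒱 d' w
  have hN := conjMul_mul_slot 𝒱 j' d ξ hw
  suffices h : slot 𝒱 j d (LinearMap.mulLeft K (coord 𝒱 ξ)) *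
      slot 𝒱 j' d' (partialD 𝒱 d' w) = (if j = j' then ξ (w : V) • 1 else 0) +
        sgn K (d * d') • (slot 𝒱 j' d' (partialD 𝒱 d' w) *
          slot 𝒱 j d (LinearMap.mulLeft K (coord 𝒱 ξ))) by
    ext1 Φ
    have h' := LinearMap.congr_fun h Φ
    have hN' := LinearMap.congr_fun hN Φ
    simp only [Module.End.mul_apply, LinearMap.add_apply, LinearMap.smul_apply, contract,
      LinearMap.sub_apply, map_sub] at h' hN' ⊢
    rw [h', hN', smul_sub, add_sub_assoc]
  split_ifs with h
  · subst h
    have hcomm : (partialD 𝒱 d' w : Module.End K (OV 𝒱)) * LinearMap.mulLeft K (coord 𝒱 ξ) =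
        ξ (w : V) • 1 + sgn K (d * d') • (LinearMap.mulLeft K (coord 𝒱 ξ) *
          (partialD 𝒱 d' w : Module.End K (OV 𝒱))) := by
      ext f
      have h := partialD_coord_mul 𝒱 d' w hξ f
      rw [mul_neg, sgn_neg, mul_comm] at h
      simpa using h
    rw [slot_mul_slot_self, slot_mul_slot_self, hcomm, slot_add, slot_smul, slot_smul,
      add_comm d' d]
    -- The anomaly still carries the twist by d + d' on the earlier arguments. It is trivial for d'
    -- = d, and otherwise ξ(w) = 0.
    by_cases hd : d' = d
    · rw [slot_one 𝒱 j (by rw [hd]; exact ⟨d, rfl⟩)]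
    · rw [hξ d' (by simpa using hd) w w.2, zero_smul, zero_smul]
  · rw [zero_add, slot_mul_slot_of_ne 𝒱 h hx hw]

theorem contract_mul_contract {k : ℕ} (j j' : Fin k) (d d' : ℤ) {ξ η : Module.Dual K V}
    (hξ : ξ ∈ dualDeg 𝒱 (-d)) (hη : η ∈ dualDeg 𝒱 (-d')) :
    contract 𝒱 j d ξ * contract 𝒱 j' d' η =
      sgn K (d * d') • (contract 𝒱 j' d' η * contract 𝒱 j d ξ) := by
  have hx : HasParity 𝒱 d (LinearMap.mulLeft K (coord 𝒱 ξ)) := (hasParity_mulLeft 𝒱 hξ).neg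
  have hy : HasParity 𝒱 d' (LinearMap.mulLeft K (coord 𝒱 η)) := (hasParity_mulLeft 𝒱 hη).neg
  have h1 : slot 𝒱 j d (LinearMap.mulLeft K (coord 𝒱 ξ)) *
      slot 𝒱 j' d' (LinearMap.mulLeft K (coord 𝒱 η)) = sgn K (d * d') •
        (slot 𝒱 j' d' (LinearMap.mulLeft K (coord 𝒱 η)) *
          slot 𝒱 j d (LinearMap.mulLeft K (coord 𝒱 ξ))) := by
    rcases eq_or_ne j j' with rfl | h
    · rw [slot_mul_slot_self, slot_mul_slot_self, add_comm d' d, ← slot_smul]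
      congr 1
      ext f
      have h := coord_comm 𝒱 hξ hη
      rw [neg_mul_neg] at h
      simp only [Module.End.mul_apply, LinearMap.smul_apply, LinearMap.mulLeft_apply, ← mul_assoc,
        h, smul_mul_assoc, smul_smul, sgn_mul_self, one_smul]
    · exact slot_mul_slot_of_ne 𝒱 h hx hy
  have h2 := conjMul_mul_slot 𝒱 j' d ξ hy
  have h3 := conjMul_mul_slot 𝒱 j d' η hx
  have h4 : slot 𝒱 j d (LinearMap.mulLeft K (coord 𝒱 ξ)) * conjMul 𝒱 d' η =
      sgn K (d * d') • (conjMul 𝒱 d' η * slot 𝒱 j d (LinearMap.mulLeft K (coord 𝒱 ξ))) := by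
    rw [h3, smul_smul, mul_comm d' d, sgn_mul_self, one_smul]
  ext1 Φ
  have h1' := LinearMap.congr_fun h1 Φ
  have h2' := LinearMap.congr_fun h2 Φ
  have h4' := LinearMap.congr_fun h4 Φ
  have h5' := LinearMap.congr_fun (conjMul_mul_conjMul 𝒱 (k := k) d d' hξ hη) Φ
  simp only [Module.End.mul_apply, LinearMap.smul_apply, contract,
    LinearMap.sub_apply, map_sub] at h1' h2' h4' h5' ⊢
  rw [h1', h2', h4', h5', smul_sub, smul_sub, smul_sub]
  abel

/-- The operator `(f_1, …, f_k) ↦ a f_1 ⋯ f_k`. -/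
def prodOp {k : ℕ} : OV 𝒱 →ₗ[K] Cochain 𝒱 k where
  toFun a := (LinearMap.mulLeft K a).compMultilinearMap (MultilinearMap.mkPiAlgebraFin K k (OV 𝒱))
  map_add' a a' := by ext; simp [add_mul]
  map_smul' c a := by ext; simp

theorem prodOp_apply {k : ℕ} (a : OV 𝒱) (f : Fin k → OV 𝒱) :
    prodOp 𝒱 a f = a * (List.ofFn f).prod := by
  simp [prodOp]

theorem prod_ofFn_insert {A : Type*} [Ring A] (t : A → A) (x : A) (h : ∀ f, t f * x = x * f)
    {k : ℕ} (j : Fin k) (f : Fin k → A) :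
    (List.ofFn fun q => if q < j then t (f q) else if q = j then x * f q else f q).prod =
      x * (List.ofFn f).prod := by
  induction k with
  | zero => exact j.elim0
  | succ k ih =>
    rw [List.ofFn_succ, List.ofFn_succ, List.prod_cons, List.prod_cons]
    induction j using Fin.cases with
    | zero => simp [Fin.succ_ne_zero, mul_assoc]
    | succ j =>
      have h1 := ih j fun q => f q.succ
      simp only [Fin.succ_lt_succ_iff, Fin.succ_inj, Fin.succ_pos, if_true]
      rw [h1, ← mul_assoc, h, mul_assoc]

theorem prod_ofFn_map {A : Type*} [Ring A] (t : A →* A) {k : ℕ} (f : Fin k → A) :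
    (List.ofFn fun q => t (f q)).prod = t (List.ofFn f).prod := by
  rw [map_list_prod, List.map_ofFn]; rfl

/-- In a graded commutative algebra a factor inserted at the j-th argument can be pulled to the
front, where it agrees with multiplication of the value. So these operators are annihilated. -/
theorem contract_prodOp {ι : Type*} [Fintype ι] [DecidableEq ι] (b : Module.Basis ι K V)
    {deg : ι → ℤ} (hdeg : ∀ α, b α ∈ 𝒱 (deg α)) {k : ℕ} (j : Fin k) (d : ℤ)
    {ξ : Module.Dual K V} (hξ : ξ ∈ dualDeg 𝒱 (-d)) (a : OV 𝒱) :
    contract 𝒱 j d ξ (prodOp 𝒱 a) = 0 := by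
  have hc : ∀ f, twist 𝒱 d f * coord 𝒱 ξ = coord 𝒱 ξ * f := by
    intro f
    rw [coord_mul_eq 𝒱 b hdeg hξ, ← twist_self 𝒱 d (twist 𝒱 (-d) f), twist_twist 𝒱 d (-d),
      add_neg_cancel, twist_zero]
  ext f
  rw [contract, LinearMap.sub_apply, _root_.sub_apply, slot_apply, prodOp_apply,
    conjMul_apply, prodOp_apply]
  have h1 := prod_ofFn_insert (twist 𝒱 d) (coord 𝒱 ξ) hc j f
  have h2 := prod_ofFn_map ((twist 𝒱 d : OV 𝒱 →ₐ[K] OV 𝒱) : OV 𝒱 →* OV 𝒱) f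
  simp only [MonoidHom.coe_coe] at h2
  simp only [LinearMap.mulLeft_apply]
  rw [h1, h2, map_mul, twist_self, ← mul_assoc, ← mul_assoc, ← hc (twist 𝒱 d a), twist_self,
    sub_self]
  rfl

/-- The value of a cochain at `(1, …, 1)`. -/
def evalOne {k : ℕ} : Cochain 𝒱 k →ₗ[K] OV 𝒱 where
  toFun Φ := Φ 1
  map_add' _ _ := rfl
  map_smul' _ _ := rfl

theorem evalOne_prodOp {k : ℕ} (a : OV 𝒱) : evalOne 𝒱 (prodOp 𝒱 (k := k) a) = a := by
  have h : (List.ofFn (1 : Fin k → OV 𝒱)).prod = 1 :=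
    List.prod_eq_one fun x hx => by
      obtain ⟨i, rfl⟩ := (List.mem_ofFn' _ _).1 hx
      rfl
  simp [evalOne, prodOp_apply, h]

theorem evalOne_slot {k : ℕ} (j : Fin k) (d : ℤ) (w : 𝒱 d) :
    evalOne 𝒱 ∘ₗ slot 𝒱 j d (partialD 𝒱 d w) = 0 := by
  ext Φ
  simp only [LinearMap.comp_apply, evalOne, LinearMap.coe_mk, AddHom.coe_mk, slot_apply,
    LinearMap.zero_apply]
  exact Φ.map_coord_zero j (by simp [partialD_one])

/-- The cochains that vanish when the `j`-th argument is a constant. -/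
def normalizedAt {k : ℕ} (j : Fin k) : Submodule K (Cochain 𝒱 k) where
  carrier := {Φ | ∀ f, f j = 1 → Φ f = 0}
  add_mem' := by
    intro Φ Ψ h h' f hf
    rw [_root_.add_apply, h f hf, h' f hf, add_zero]
  zero_mem' := fun _ _ => rfl
  smul_mem' := by
    intro c Φ h f hf
    rw [_root_.smul_apply, h f hf, smul_zero]

/-- A contraction elsewhere only twists the j-th argument or leaves it alone, and twists fix 1. -/
theorem contract_mem_normalizedAt {k : ℕ} {j j' : Fin k} (hj : j' ≠ j) (d : ℤ)
    (ξ : Module.Dual K V) {Φ : Cochain 𝒱 k} (hΦ : Φ ∈ normalizedAt 𝒱 j) :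
    contract 𝒱 j' d ξ Φ ∈ normalizedAt 𝒱 j := by
  intro f hf
  rw [contract, LinearMap.sub_apply, _root_.sub_apply, slot_apply, conjMul_apply,
    hΦ _ (by simp [hf, hj.symm]), hΦ _ (by simp [hf]), map_zero, mul_zero, sub_zero]

theorem partialWord_nil : partialWord 𝒱 [] = LinearMap.id := rfl

theorem partialWord_append (I I' : Word 𝒱) :
    partialWord 𝒱 (I ++ I') = partialWord 𝒱 I ∘ₗ partialWord 𝒱 I' := by
  simp [partialWord, Module.End.mul_eq_comp]

theorem partialWord_one {I : Word 𝒱} (hI : I ≠ []) : partialWord 𝒱 I 1 = 0 := by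
  rw [← List.dropLast_append_getLast hI, partialWord_append]
  simp [partialWord, partialD_one]

theorem polyDiffOp_apply {k : ℕ} (a : OV 𝒱) (I : Fin k → Word 𝒱) (f : Fin k → OV 𝒱) :
    polyDiffOp 𝒱 a I f = prodOp 𝒱 a fun j =>
      partialWord 𝒱 (I j) (twist 𝒱 (∑ l ∈ Finset.Ioi j, wordDeg (I l)) (f j)) := rfl

theorem polyDiffOp_mem_normalizedAt {k : ℕ} (a : OV 𝒱) {I : Fin k → Word 𝒱} {j : Fin k}
    (hI : I j ≠ []) : polyDiffOp 𝒱 a I ∈ normalizedAt 𝒱 j := by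
  intro f hf
  rw [polyDiffOp_apply]
  exact MultilinearMap.map_coord_zero _ j (by rw [hf, map_one, partialWord_one 𝒱 hI])

theorem polyDiffOp_nil {k : ℕ} (a : OV 𝒱) : polyDiffOp 𝒱 a (fun _ : Fin k => []) = prodOp 𝒱 a := by
  ext f
  rw [polyDiffOp_apply]
  congr 1
  funext j
  simp [partialWord_nil, wordDeg, twist_zero]

/-- The new derivative acts on f_j before the twist by the later words, and moving it inside that
twist gives the sign. On the earlier arguments the slot's twist is exactly the change in the total
degree of the later words. -/
theorem slot_polyDiffOp {k : ℕ} (j : Fin k) (l : Σ d : ℤ, 𝒱 d) (a : OV 𝒱) (I : Fin k → Word 𝒱) :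
    slot 𝒱 j l.1 (partialD 𝒱 l.1 l.2) (polyDiffOp 𝒱 a I) =
      sgn K (l.1 * ∑ q ∈ Finset.Ioi j, wordDeg (I q)) •
        polyDiffOp 𝒱 a (Function.update I j (I j ++ [l])) := by
  ext f
  rw [slot_apply, _root_.smul_apply, polyDiffOp_apply, polyDiffOp_apply]
  have hsum : ∀ q, ¬ q < j → ∑ r ∈ Finset.Ioi q, wordDeg (Function.update I j (I j ++ [l]) r) =
      ∑ r ∈ Finset.Ioi q, wordDeg (I r) := by
    intro q hq
    refine Finset.sum_congr rfl fun r hr => ?_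
    rw [Function.update_of_ne]
    rintro rfl
    exact hq (Finset.mem_Ioi.1 hr)
  refine cochain_eq_smul 𝒱 _ j _ ?_ fun q hq => ?_
  · rw [hsum j (lt_irrefl j)]
    simp only [lt_irrefl, if_false, if_true, Function.update_self, partialWord_append,
      LinearMap.comp_apply]
    have h1 : partialWord 𝒱 [l] = partialD 𝒱 l.1 l.2 := by simp [partialWord]
    rw [h1, ← map_smul, hasParity_partialD 𝒱 l.1 l.2, mul_comm]
  · rw [Function.update_of_ne hq]
    by_cases h : q < j
    · simp only [h, if_true, twist_twist]
      congr 3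
      rw [← Finset.add_sum_erase _ _ (Finset.mem_Ioi.2 h), ← Finset.add_sum_erase
        (Finset.Ioi q) (fun r => wordDeg (Function.update I j (I j ++ [l]) r))
        (Finset.mem_Ioi.2 h)]
      have h2 : ∑ r ∈ (Finset.Ioi q).erase j, wordDeg (Function.update I j (I j ++ [l]) r) =
          ∑ r ∈ (Finset.Ioi q).erase j, wordDeg (I r) :=
        Finset.sum_congr rfl fun r hr => by rw [Function.update_of_ne (Finset.ne_of_mem_erase hr)]
      rw [h2, Function.update_self]
      simp only [wordDeg, List.map_append, List.sum_append, List.map_cons, List.map_nil,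
        List.sum_cons, List.sum_nil]
      ring
    · simp only [h, hq, if_false, hsum q h]

end Slots

/-! ### Degrees of cochains. -/

section Degrees

variable {K : Type u} [Field K] {V : Type v} [AddCommGroup V] [Module K V]
  (𝒱 : ℤ → Submodule K V) [DirectSum.Decomposition 𝒱]

theorem IsCochainDeg.slot {k : ℕ} {e : ℤ} {Φ : Cochain 𝒱 k} (hΦ : IsCochainDeg 𝒱 e Φ)
    (j : Fin k) (d d' : ℤ) (T : Module.End K (OV 𝒱))
    (hT : ∀ a, ∀ f ∈ ovDeg 𝒱 a, T f ∈ ovDeg 𝒱 (a + d')) :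
    IsCochainDeg 𝒱 (e + d') (slot 𝒱 j d T Φ) := by
  intro a f hf
  rw [slot_apply]
  have h := hΦ (Function.update a j (a j + d')) (fun q => if q < j then twist 𝒱 d (f q) else
    if q = j then T (f q) else f q) ?_
  · rw [Finset.sum_update_of_mem (Finset.mem_univ j)] at h
    have hs := Finset.sum_sdiff (Finset.subset_univ {j}) (f := a)
    rw [Finset.sum_singleton] at hs
    convert h using 2
    linarith
  · intro q
    by_cases hq : q = j
    · subst hq
      simpa using hT _ _ (hf q)
    · rw [Function.update_of_ne hq]
      rw [if_neg hq]
      split_ifs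
      · rw [twist_of_mem 𝒱 d (hf q)]
        exact Submodule.smul_mem _ _ (hf q)
      · exact hf q

theorem IsCochainDeg.add {k : ℕ} {e : ℤ} {Φ Ψ : Cochain 𝒱 k} (hΦ : IsCochainDeg 𝒱 e Φ)
    (hΨ : IsCochainDeg 𝒱 e Ψ) : IsCochainDeg 𝒱 e (Φ + Ψ) :=
  fun a f hf => add_mem (hΦ a f hf) (hΨ a f hf)

theorem IsCochainDeg.smul {k : ℕ} {e : ℤ} {Φ : Cochain 𝒱 k} (hΦ : IsCochainDeg 𝒱 e Φ)
    (c : K) : IsCochainDeg 𝒱 e (c • Φ) :=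
  fun a f hf => Submodule.smul_mem _ _ (hΦ a f hf)

theorem isCochainDeg_zero {k : ℕ} (e : ℤ) : IsCochainDeg 𝒱 e (0 : Cochain 𝒱 k) :=
  fun _ _ _ => zero_mem _

theorem IsCochainDeg.sum {k : ℕ} {e : ℤ} {ι : Type*} (s : Finset ι) {Φ : ι → Cochain 𝒱 k}
    (h : ∀ i ∈ s, IsCochainDeg 𝒱 e (Φ i)) : IsCochainDeg 𝒱 e (∑ i ∈ s, Φ i) :=
  Finset.sum_induction _ _ (fun _ _ h h' => h.add 𝒱 h') (isCochainDeg_zero 𝒱 e) h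

theorem isCochainDeg_prodOp {k : ℕ} {e : ℤ} {a : OV 𝒱} (ha : a ∈ ovDeg 𝒱 e) :
    IsCochainDeg 𝒱 e (prodOp 𝒱 (k := k) a) := by
  intro c f hf
  rw [prodOp_apply, add_comm]
  refine mul_mem_ovDeg 𝒱 ha ?_
  induction k with
  | zero => simpa using ovDeg_one 𝒱
  | succ k ih =>
    rw [List.ofFn_succ, List.prod_cons, Fin.sum_univ_succ]
    exact mul_mem_ovDeg 𝒱 (hf 0) (ih _ _ fun i => hf i.succ)

theorem IsCochainDeg.contract {k : ℕ} {e : ℤ} {Φ : Cochain 𝒱 k} (hΦ : IsCochainDeg 𝒱 e Φ)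
    (j : Fin k) (d : ℤ) {ξ : Module.Dual K V} (hξ : ξ ∈ dualDeg 𝒱 (-d)) :
    IsCochainDeg 𝒱 (e - d) (contract 𝒱 j d ξ Φ) := by
  have h1 : IsCochainDeg 𝒱 (e - d) (PolyHoch.slot 𝒱 j d (LinearMap.mulLeft K (coord 𝒱 ξ)) Φ) := by
    refine hΦ.slot 𝒱 j d (-d) _ fun a f hf => ?_
    rw [add_comm]
    exact coord_mul_mem_ovDeg 𝒱 hξ hf
  have h2 : IsCochainDeg 𝒱 (e - d) (conjMul 𝒱 d ξ Φ) := by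
    intro a f hf
    have h3 := hΦ a (fun q => twist 𝒱 d (f q)) fun q => by
      rw [twist_of_mem 𝒱 d (hf q)]
      exact Submodule.smul_mem _ _ (hf q)
    rw [conjMul_apply, twist_of_mem 𝒱 d h3, mul_smul_comm]
    have h4 := coord_mul_mem_ovDeg 𝒱 hξ h3
    refine Submodule.smul_mem _ _ ?_
    convert h4 using 2
    ring
  exact fun a f hf => sub_mem (h1 a f hf) (h2 a f hf)

end Degrees

/-! ### Representations as sign-symmetric functions of two words. -/

section Coefficients

variable {K : Type u} [Field K] {V : Type v} [AddCommGroup V] [Module K V]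
  (𝒱 : ℤ → Submodule K V) [DirectSum.Decomposition 𝒱]
  {ι : Type*} [Fintype ι] [DecidableEq ι] (b : Module.Basis ι K V) {deg : ι → ℤ}
  (hdeg : ∀ α, b α ∈ 𝒱 (deg α))

/-- Working with the pair (length, tuple) in a sigma type avoids casts along an equality of lengths.
-/
theorem apply_length_get_ofFn {L : Type*} {M : Type*} (P : ∀ m, (Fin m → L) → M) {m : ℕ}
    (Λ : Fin m → L) : P (List.ofFn Λ).length (List.ofFn Λ).get = P m Λ :=
  congrArg (fun s : Σ n, Fin n → L => P s.1 s.2) (List.equivSigmaTuple.apply_symm_apply ⟨m, Λ⟩)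

theorem tensorCoeff_tprod {m : ℕ} (A : Fin m → ι) (w : Fin m → V) :
    tensorCoeff b A (PiTensorProduct.tprod K w) = ∏ i, b.coord (A i) (w i) := by
  simp [tensorCoeff]

theorem tensorCoeff_basis {m : ℕ} (A B : Fin m → ι) :
    tensorCoeff b A (PiTensorProduct.tprod K fun i => b (B i)) = if B = A then 1 else 0 := by
  rw [tensorCoeff_tprod]
  split_ifs with h
  · subst h; simp
  · obtain ⟨i, hi⟩ := Function.ne_iff.1 h
    exact Finset.prod_eq_zero (Finset.mem_univ i) (by simp [hi])

theorem tensor_eq_sum {m : ℕ} (t : ⨂[K] _ : Fin m, V) :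
    t = ∑ A : Fin m → ι, tensorCoeff b A t • PiTensorProduct.tprod K fun i => b (A i) := by
  have h : LinearMap.id = ∑ A : Fin m → ι, (tensorCoeff b A).smulRight
      (PiTensorProduct.tprod K fun i => b (A i)) := by
    refine PiTensorProduct.ext (Module.Basis.ext_multilinear (fun _ => b) fun B => ?_)
    simp [tensorCoeff_basis, Finset.sum_ite_eq]
  simpa using LinearMap.congr_fun h t

theorem tensor_ext {m : ℕ} {t t' : ⨂[K] _ : Fin m, V}
    (h : ∀ A : Fin m → ι, tensorCoeff b A t = tensorCoeff b A t') : t = t' := by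
  rw [tensor_eq_sum b t, tensor_eq_sum b t']
  simp only [h]

theorem end_ext {m n : ℕ} {f g : EndV K V m n}
    (h : ∀ J : Fin n → ι, f (PiTensorProduct.tprod K fun i => b (J i)) =
      g (PiTensorProduct.tprod K fun i => b (J i))) : f = g :=
  PiTensorProduct.ext (Module.Basis.ext_multilinear (fun _ => b) h)

theorem parityPart_basis (hdeg : ∀ α, b α ∈ 𝒱 (deg α)) (odd : Bool) (α : ι) :
    parityPart 𝒱 odd (b α) = if par deg α = odd then b α else 0 := by
  rw [parityPart, scaleDeg_of_mem 𝒱 _ (hdeg α), par]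
  split_ifs <;> simp

theorem permTensor_basis (hdeg : ∀ α, b α ∈ 𝒱 (deg α)) {m : ℕ} (σ : Equiv.Perm (Fin m))
    (A : Fin m → ι) :
    permTensor 𝒱 σ (PiTensorProduct.tprod K fun i => b (A i)) =
      koszulSign K σ (par deg ∘ A) • PiTensorProduct.tprod K fun i => b (A (σ.symm i)) := by
  simp only [permTensor, LinearMap.sum_apply, LinearMap.smul_apply, LinearMap.comp_apply,
    PiTensorProduct.map_tprod, LinearEquiv.coe_coe, PiTensorProduct.reindex_tprod]
  -- Basis vectors are homogeneous, so the projections to all other parity patterns kill the tensor.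
  rw [Finset.sum_eq_single (par deg ∘ A)]
  · congr 2
    funext i
    simp [parityPart_basis 𝒱 b hdeg]
  · intro ε _ hε
    obtain ⟨i, hi⟩ := Function.ne_iff.1 hε
    rw [MultilinearMap.map_coord_zero _ (σ i), smul_zero]
    rw [Equiv.symm_apply_apply, parityPart_basis 𝒱 b hdeg, 
      if_neg (show ¬ par deg (A i) = ε i from Ne.symm hi)]
  · simp

theorem tensorCoeff_permTensor (hdeg : ∀ α, b α ∈ 𝒱 (deg α)) {m : ℕ} (σ : Equiv.Perm (Fin m))
    (A : Fin m → ι) (t : ⨂[K] _ : Fin m, V) :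
    tensorCoeff b (A ∘ σ.symm) (permTensor 𝒱 σ t) =
      koszulSign K σ (par deg ∘ A) * tensorCoeff b A t := by
  have h : tensorCoeff b (A ∘ σ.symm) ∘ₗ permTensor 𝒱 σ =
      koszulSign K σ (par deg ∘ A) • tensorCoeff b A := by
    refine PiTensorProduct.ext (Module.Basis.ext_multilinear (fun _ => b) fun B => ?_)
    have h1 : (fun i => b (B (σ.symm i))) = fun i => b ((B ∘ σ.symm) i) := rfl
    simp only [LinearMap.compMultilinearMap_apply, LinearMap.comp_apply, LinearMap.smul_apply,
      permTensor_basis 𝒱 b hdeg, map_smul, h1, tensorCoeff_basis, smul_eq_mul,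
      σ.symm.surjective.injective_comp_right.eq_iff]
    split_ifs with h
    · rw [h]
    · simp
  exact LinearMap.congr_fun h t

variable {p : ℕ}

/-- The coefficient `Γ_J^A` of a representation on the corolla with the blocks `c`, as a function
of the pairs `(c_i, A_i)`; it is zero if some block is empty. -/
def coeffFun (ρ : RepFin 𝒱 p) (m n : ℕ) (Λ : Fin m → Fin (p + 1) × ι) (J : Fin n → ι) : K :=
  open Classical in
  if h : Function.Surjective fun i => (Λ i).1 then
    tensorCoeff b (fun i => (Λ i).2) (ρ.1 m n (Finsupp.single ⟨_, h⟩ 1)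
      (PiTensorProduct.tprod K fun i => b (J i)))
  else 0

theorem coeffFun_of_surjective (ρ : RepFin 𝒱 p) {m n : ℕ} (c : OrdPart m (p + 1)) (A : Fin m → ι)
    (J : Fin n → ι) : coeffFun 𝒱 b ρ m n (fun i => (c.1 i, A i)) J =
      tensorCoeff b A (ρ.1 m n (Finsupp.single c 1)
        (PiTensorProduct.tprod K fun i => b (J i))) :=
  dif_pos c.2

/-- Permuting the pairs (block, index) moves the corolla and the output tensor at once, so
equivariance of ρ leaves only the Koszul sign. -/
theorem coeffFun_perm_output (hdeg : ∀ α, b α ∈ 𝒱 (deg α)) (ρ : RepFin 𝒱 p) {m n : ℕ}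
    (σ : Equiv.Perm (Fin m)) (Λ : Fin m → Fin (p + 1) × ι) (J : Fin n → ι) :
    coeffFun 𝒱 b ρ m n (Λ ∘ σ.symm) J =
      koszulSign K σ (fun i => par deg (Λ i).2) * coeffFun 𝒱 b ρ m n Λ J := by
  have hsurj : Function.Surjective (fun i => ((Λ ∘ σ.symm) i).1) ↔
      Function.Surjective fun i => (Λ i).1 :=
    σ.symm.surjective_comp fun i => (Λ i).1
  by_cases h : Function.Surjective fun i => (Λ i).1
  · rw [coeffFun, coeffFun, dif_pos (hsurj.2 h), dif_pos h]
    have h1 := ρ.2.1.1 m n σ (Finsupp.single ⟨_, h⟩ 1)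
    rw [permGen, Finsupp.lmapDomain_apply, Finsupp.mapDomain_single] at h1
    have h2 : (⟨_, hsurj.2 h⟩ : OrdPart m (p + 1)) = OrdPart.perm σ ⟨_, h⟩ := rfl
    rw [h2, h1, LinearMap.comp_apply]
    exact tensorCoeff_permTensor 𝒱 b hdeg σ (fun i => (Λ i).2) _
  · rw [coeffFun, coeffFun, dif_neg (mt hsurj.1 h), dif_neg h, mul_zero]

theorem coeffFun_perm_input (hdeg : ∀ α, b α ∈ 𝒱 (deg α)) (ρ : RepFin 𝒱 p) {m n : ℕ}
    (τ : Equiv.Perm (Fin n)) (Λ : Fin m → Fin (p + 1) × ι) (J : Fin n → ι) :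
    coeffFun 𝒱 b ρ m n Λ (J ∘ τ.symm) =
      koszulSign K τ (par deg ∘ J) * coeffFun 𝒱 b ρ m n Λ J := by
  by_cases h : Function.Surjective fun i => (Λ i).1
  · rw [coeffFun, coeffFun, dif_pos h, dif_pos h]
    have h1 := LinearMap.congr_fun (ρ.2.1.2 m n τ (Finsupp.single ⟨_, h⟩ 1))
      (PiTensorProduct.tprod K fun i => b (J i))
    rw [LinearMap.comp_apply, permTensor_basis 𝒱 b hdeg, map_smul] at h1
    rw [← h1, map_smul, smul_eq_mul, ← mul_assoc, koszulSign_mul_self, one_mul]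
    rfl
  · rw [coeffFun, coeffFun, dif_neg h, dif_neg h, mul_zero]

/-- The coefficients of a representation as a function of words. -/
def coeff (ρ : RepFin 𝒱 p) (l : List (Fin (p + 1) × ι)) (w : List ι) : K :=
  coeffFun 𝒱 b ρ l.length w.length l.get w.get

theorem coeff_ofFn (ρ : RepFin 𝒱 p) {m n : ℕ} (Λ : Fin m → Fin (p + 1) × ι) (J : Fin n → ι) :
    coeff 𝒱 b ρ (List.ofFn Λ) (List.ofFn J) = coeffFun 𝒱 b ρ m n Λ J := by
  have h1 := apply_length_get_ofFn (fun m' Λ' => coeffFun 𝒱 b ρ m' (List.ofFn J).length Λ'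
    (List.ofFn J).get) Λ
  have h2 := apply_length_get_ofFn (fun n' J' => coeffFun 𝒱 b ρ m n' Λ J') J
  exact h1.trans h2

theorem exists_eq_ofFn {L : Type*} (l : List L) : ∃ (m : ℕ) (Λ : Fin m → L), l = List.ofFn Λ :=
  ⟨_, l.get, (List.ofFn_get l).symm⟩

theorem coeff_signSym_output (hdeg : ∀ α, b α ∈ 𝒱 (deg α)) (ρ : RepFin 𝒱 p) (w : List ι) :
    SignSym K (fun x : Fin (p + 1) × ι => par deg x.2) fun l => coeff 𝒱 b ρ l w := by
  obtain ⟨n, J, rfl⟩ := exists_eq_ofFn w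
  intro u x y v
  obtain ⟨m, Λ, i, h1, h2, h3, h4⟩ := exists_ofFn_swap u x y v
  rw [← h1, ← h2]
  beta_reduce
  rw [coeff_ofFn, coeff_ofFn]
  have h := coeffFun_perm_output 𝒱 b hdeg ρ (Equiv.swap i.castSucc i.succ) Λ J
  rw [Equiv.symm_swap, koszulSign_swap, h3, h4, swapSign_comm] at h
  exact h

theorem coeff_signSym_input (hdeg : ∀ α, b α ∈ 𝒱 (deg α)) (ρ : RepFin 𝒱 p)
    (l : List (Fin (p + 1) × ι)) : SignSym K (par deg) fun w => coeff 𝒱 b ρ l w := by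
  obtain ⟨m, Λ, rfl⟩ := exists_eq_ofFn l
  intro u x y v
  obtain ⟨n, J, i, h1, h2, h3, h4⟩ := exists_ofFn_swap u x y v
  rw [← h1, ← h2]
  beta_reduce
  rw [coeff_ofFn, coeff_ofFn]
  have h := coeffFun_perm_input 𝒱 b hdeg ρ (Equiv.swap i.castSucc i.succ) Λ J
  rw [Equiv.symm_swap, koszulSign_swap, Function.comp_apply, Function.comp_apply, h3, h4,
    swapSign_comm] at h
  exact h

theorem repFin_eq_zero_at {ρ : RepFin 𝒱 p} {m n : ℕ} (h : ∀ (l : List (Fin (p + 1) × ι))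
    (w : List ι), l.length = m → w.length = n → coeff 𝒱 b ρ l w = 0) : ρ.1 m n = 0 := by
  ext1 c
  refine LinearMap.ext_ring (end_ext b fun J => tensor_ext b fun A => ?_)
  have h1 := h (List.ofFn fun i => (c.1 i, A i)) (List.ofFn J) (by simp) (by simp)
  rw [coeff_ofFn, coeffFun_of_surjective] at h1
  simpa using h1

theorem repFin_ext {ρ ρ' : RepFin 𝒱 p} (h : ∀ l w, coeff 𝒱 b ρ l w = coeff 𝒱 b ρ' l w) :
    ρ = ρ' := by
  ext1
  funext m n
  ext1 c
  refine LinearMap.ext_ring (end_ext b fun J => tensor_ext b fun A => ?_)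
  have h1 := h (List.ofFn fun i => (c.1 i, A i)) (List.ofFn J)
  rw [coeff_ofFn, coeffFun_of_surjective, coeff_ofFn, coeffFun_of_surjective] at h1
  exact h1

theorem coeff_of_not_surjective {ρ : RepFin 𝒱 p} {l : List (Fin (p + 1) × ι)} {w : List ι}
    {j : Fin (p + 1)} (h : ∀ x ∈ l, x.1 ≠ j) : coeff 𝒱 b ρ l w = 0 := by
  rw [coeff, coeffFun, dif_neg]
  intro hs
  obtain ⟨i, hi⟩ := hs j
  exact h _ (List.get_mem l i) hi

/-! ### Representations with given coefficients -/

/-- The linear map with given matrix coefficients. -/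
def endOfCoeff {m n : ℕ} (γ : (Fin m → ι) → (Fin n → ι) → K) : EndV K V m n :=
  ∑ J : Fin n → ι, (tensorCoeff b J).smulRight
    (∑ A : Fin m → ι, γ A J • PiTensorProduct.tprod K fun i => b (A i))

theorem endOfCoeff_basis {m n : ℕ} (γ : (Fin m → ι) → (Fin n → ι) → K) (J : Fin n → ι) :
    endOfCoeff b γ (PiTensorProduct.tprod K fun i => b (J i)) =
      ∑ A : Fin m → ι, γ A J • PiTensorProduct.tprod K fun i => b (A i) := by
  simp [endOfCoeff, tensorCoeff_basis, Finset.sum_ite_eq]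

theorem tensorCoeff_endOfCoeff {m n : ℕ} (γ : (Fin m → ι) → (Fin n → ι) → K) (A : Fin m → ι)
    (J : Fin n → ι) : tensorCoeff b A (endOfCoeff b γ
      (PiTensorProduct.tprod K fun i => b (J i))) = γ A J := by
  simp [endOfCoeff_basis, tensorCoeff_basis]

/-- Here `h1` and `h2` become equivariance in the outputs and inputs, `h3` matches the absence of
corollas with an empty block, and `h4` is finiteness of the support. -/
theorem exists_repFin (hdeg : ∀ α, b α ∈ 𝒱 (deg α))
    (γ : List (Fin (p + 1) × ι) → List ι → K)
    (h1 : ∀ w, SignSym K (fun x : Fin (p + 1) × ι => par deg x.2) fun l => γ l w)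
    (h2 : ∀ l, SignSym K (par deg) fun w => γ l w)
    (h3 : ∀ l w j, (∀ x ∈ l, x.1 ≠ j) → γ l w = 0)
    (h4 : {mn : ℕ × ℕ | ∃ l w, l.length = mn.1 ∧ w.length = mn.2 ∧ γ l w ≠ 0}.Finite) :
    ∃ ρ : RepFin 𝒱 p, ∀ l w, coeff 𝒱 b ρ l w = γ l w := by
  let φ : ∀ m n : ℕ, OrdPart m (p + 1) → EndV K V m n := fun m n c =>
    endOfCoeff b fun A J => γ (List.ofFn fun i => (c.1 i, A i)) (List.ofFn J)
  let ρ : ∀ m n : ℕ, Gen K m p →ₗ[K] EndV K V m n := fun m n => Finsupp.linearCombination K (φ m n)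
  have hρ : ∀ m n c, ρ m n (Finsupp.single c 1) = φ m n c := by
    intro m n c
    simp [ρ]
  have hmem : ρ ∈ RepFin 𝒱 p := by
    refine ⟨⟨fun m n σ x => ?_, fun m n τ x => ?_⟩, h4.subset fun mn hmn => ?_⟩
    · suffices h : ρ m n ∘ₗ permGen K σ = (LinearMap.llcomp K _ _ _ (permTensor 𝒱 σ)) ∘ₗ ρ m n from
        LinearMap.congr_fun h x
      ext1 c
      refine LinearMap.ext_ring (end_ext b fun J => tensor_ext b fun A => ?_)
      -- Brings the multi-index to the form in which `tensorCoeff_permTensor` applies.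
      have hA : A = (A ∘ σ) ∘ σ.symm := by ext; simp
      simp only [LinearMap.comp_apply, Finsupp.lsingle_apply, permGen, Finsupp.lmapDomain_apply,
        Finsupp.mapDomain_single, hρ, LinearMap.llcomp_apply]
      conv_rhs => rw [hA, tensorCoeff_permTensor 𝒱 b hdeg]
      simp only [φ, tensorCoeff_endOfCoeff]
      have h := (h1 (List.ofFn J)).ofFn_perm σ fun i => (c.1 i, A (σ i))
      rw [smul_eq_mul] at h
      refine Eq.trans ?_ h
      congr 2
      funext i
      simp [OrdPart.perm]
    · suffices h : (LinearMap.lcomp K _ (permTensor 𝒱 τ)) ∘ₗ ρ m n = ρ m n from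
        LinearMap.congr_fun h x
      ext1 c
      refine LinearMap.ext_ring (end_ext b fun J => tensor_ext b fun A => ?_)
      simp only [LinearMap.comp_apply, Finsupp.lsingle_apply, hρ, LinearMap.lcomp_apply,
        permTensor_basis 𝒱 b hdeg, map_smul, φ, tensorCoeff_endOfCoeff]
      have h := (h2 (List.ofFn fun i => (c.1 i, A i))).ofFn_perm τ J
      have h' : (fun i => J (τ.symm i)) = J ∘ τ.symm := rfl
      rw [h', h, smul_smul, koszulSign_mul_self, one_smul]
    · by_contra hc
      refine hmn ?_
      ext1 c
      refine LinearMap.ext_ring (end_ext b fun J => tensor_ext b fun A => ?_)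
      simp only [LinearMap.comp_apply, Finsupp.lsingle_apply, hρ, φ, tensorCoeff_endOfCoeff]
      by_contra h
      exact hc ⟨List.ofFn fun i => (c.1 i, A i), List.ofFn J, by simp, by simp, by simpa using h⟩
  refine ⟨⟨ρ, hmem⟩, fun l w => ?_⟩
  obtain ⟨m, Λ, rfl⟩ := exists_eq_ofFn l
  obtain ⟨n, J, rfl⟩ := exists_eq_ofFn w
  rw [coeff_ofFn]
  by_cases h : Function.Surjective fun i => (Λ i).1
  · refine (coeffFun_of_surjective 𝒱 b ⟨ρ, hmem⟩ ⟨_, h⟩ (fun i => (Λ i).2) J).trans ?_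
    rw [hρ]
    simp only [φ, tensorCoeff_endOfCoeff]
  · rw [coeffFun, dif_neg h]
    simp only [Function.Surjective, not_forall, not_exists] at h
    obtain ⟨j, hj⟩ := h
    refine (h3 _ _ j fun x hx => ?_).symm
    obtain ⟨i, rfl⟩ := (List.mem_ofFn' _ _).1 hx
    exact hj i

/-- Basis tensors are homogeneous, and a homogeneous tensor has no coefficients at basis tensors of
another degree. -/
theorem isRepDeg_iff (hdeg : ∀ α, b α ∈ 𝒱 (deg α)) (e : ℤ) (ρ : RepFin 𝒱 p) :
    IsRepDeg 𝒱 e ρ ↔ ∀ l w, coeff 𝒱 b ρ l w ≠ 0 →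
      (l.map fun x => deg x.2).sum = (w.map deg).sum + e := by
  have hcoeff : ∀ {m : ℕ} (A : Fin m → ι) (a : ℤ) (t : ⨂[K] _ : Fin m, V),
      t ∈ tensorDeg 𝒱 m a → ∑ i, deg (A i) ≠ a → tensorCoeff b A t = 0 := by
    intro m A a t ht ha
    induction ht using Submodule.span_induction with
    | mem t h =>
      obtain ⟨w, a', hw, hs, rfl⟩ := h
      rw [tensorCoeff_tprod]
      have : ∃ i, a' i ≠ deg (A i) := by
        by_contra! h
        exact ha (by rw [← hs]; simp [h])
      obtain ⟨i, hi⟩ := this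
      exact Finset.prod_eq_zero (Finset.mem_univ i) (basis_coord_of_mem 𝒱 b hdeg _ hi (hw i))
    | zero => simp
    | add t t' _ _ h h' => rw [map_add, h, h', add_zero]
    | smul c t _ h => rw [map_smul, h, smul_zero]
  have hbasis : ∀ {m : ℕ} (A : Fin m → ι),
      PiTensorProduct.tprod K (fun i => b (A i)) ∈ tensorDeg 𝒱 m (∑ i, deg (A i)) :=
    fun A => Submodule.subset_span ⟨_, _, fun i => hdeg (A i), rfl, rfl⟩
  constructor
  · intro h l w hlw
    obtain ⟨m, Λ, rfl⟩ := exists_eq_ofFn l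
    obtain ⟨n, J, rfl⟩ := exists_eq_ofFn w
    rw [coeff_ofFn, coeffFun] at hlw
    split_ifs at hlw with hs
    · by_contra hne
      refine hlw (hcoeff _ _ _ (h m n _ _ _ (hbasis J)) ?_)
      simpa [List.map_ofFn, List.sum_ofFn] using hne
    · exact absurd rfl hlw
  · intro h m n x a t ht
    have hx : ∀ c : OrdPart m (p + 1), ρ.1 m n (Finsupp.single c 1) t ∈ tensorDeg 𝒱 m (a + e) := by
      intro c
      have hJ : ∀ J : Fin n → ι, tensorCoeff b J t •
          ρ.1 m n (Finsupp.single c 1) (PiTensorProduct.tprod K fun i => b (J i)) ∈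
            tensorDeg 𝒱 m (a + e) := by
        intro J
        by_cases hJa : ∑ i, deg (J i) = a
        · refine Submodule.smul_mem _ _ ?_
          rw [tensor_eq_sum b (ρ.1 m n _ _)]
          refine Submodule.sum_mem _ fun A _ => ?_
          by_cases h0 : tensorCoeff b A (ρ.1 m n (Finsupp.single c 1)
              (PiTensorProduct.tprod K fun i => b (J i))) = 0
          · rw [h0, zero_smul]; exact zero_mem _
          · have h1 := h (List.ofFn fun i => (c.1 i, A i)) (List.ofFn J) (by
              rwa [coeff_ofFn, coeffFun_of_surjective])
            simp only [List.map_ofFn, List.sum_ofFn, Function.comp_apply] at h1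
            rw [← hJa, ← h1]
            exact Submodule.smul_mem _ _ (hbasis A)
        · rw [hcoeff J a t ht hJa, zero_smul]
          exact zero_mem _
      rw [tensor_eq_sum b t, map_sum]
      refine Submodule.sum_mem _ fun J _ => ?_
      rw [map_smul]
      exact hJ J
    induction x using Finsupp.induction_linear with
    | zero => simp
    | add x y h1 h2 => rw [map_add]; exact add_mem h1 h2
    | single c r =>
      have : Finsupp.single c r = r • Finsupp.single c (1 : K) := by simp
      rw [this, map_smul]
      exact Submodule.smul_mem _ _ (hx c)

end Coefficients

/-! ### From monotone maps to all maps by orbit counting. -/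

section OrbitSum

variable {K : Type u} [Field K] [CharZero K]

/-- The monotone rearrangement of c is unique, so the permutations that sort c form a coset of its
stabilizer, the product of the symmetric groups of the fibres. -/
theorem card_perm_comp_monotone {m k : ℕ} (c : Fin m → Fin k)
    [Fintype {σ : Equiv.Perm (Fin m) // Monotone (c ∘ σ)}] :
    Fintype.card {σ : Equiv.Perm (Fin m) // Monotone (c ∘ σ)} =
      ∏ j, (Fintype.card {i // c i = j}).factorial := by
  rw [← DomMulAct.stabilizer_card c]
  refine Fintype.card_congr ((Equiv.mulRight (Tuple.sort c)⁻¹).subtypeEquiv fun σ => ?_)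
  rw [← Tuple.comp_sort_eq_comp_iff_monotone, Equiv.coe_mulRight]
  constructor
  · intro h
    rw [Equiv.Perm.coe_mul, ← Function.comp_assoc, h, Function.comp_assoc,
      ← Equiv.Perm.coe_mul, mul_inv_cancel]
    rfl
  · intro h
    have h2 := congrArg (· ∘ Tuple.sort c) h
    dsimp only at h2
    rw [Function.comp_assoc, ← Equiv.Perm.coe_mul, inv_mul_cancel_right] at h2
    exact h2

/-- A sum over all maps to `[k]` of a symmetric function, as a sum over the monotone maps. -/
theorem sum_eq_sum_monotone {M : Type*} [AddCommGroup M] [Module K M] {m k : ℕ}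
    (g : (Fin m → Fin k) → M) (hg : ∀ (σ : Equiv.Perm (Fin m)) c, g (c ∘ σ) = g c)
    [DecidablePred fun c : Fin m → Fin k => Monotone c] :
    ∑ c ∈ Finset.univ.filter (fun c : Fin m → Fin k => Monotone c),
      ((∏ j, ((Fintype.card {i // c i = j}).factorial : K))⁻¹) • g c =
        ((m.factorial : K)⁻¹) • ∑ c, g c := by
  classical
  have hm : (m.factorial : K) ≠ 0 := Nat.cast_ne_zero.2 (Nat.factorial_ne_zero m)
  rw [eq_inv_smul_iff₀ hm]
  let N : (Fin m → Fin k) → K := fun c => ∏ j, ((Fintype.card {i // c i = j}).factorial : K)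
  have hN0 : ∀ c, N c ≠ 0 := fun c =>
    Finset.prod_ne_zero_iff.2 fun j _ => Nat.cast_ne_zero.2 (Nat.factorial_ne_zero _)
  have hN : ∀ c (σ : Equiv.Perm (Fin m)), N (c ∘ σ) = N c := by
    intro c σ
    refine Finset.prod_congr rfl fun j _ => ?_
    congr 2
    exact Fintype.card_congr (σ.subtypeEquiv fun i => Iff.rfl)
  -- The pairs (c, σ) with c ∘ σ monotone are counted in two ways: here with σ fixed, below with c
  -- fixed.
  have h1 : ∀ σ : Equiv.Perm (Fin m),
      ∑ c, (if Monotone (c ∘ σ) then (N c)⁻¹ • g c else 0) =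
        ∑ c ∈ Finset.univ.filter (fun c : Fin m → Fin k => Monotone c), (N c)⁻¹ • g c := by
    intro σ
    rw [Finset.sum_filter]
    refine Fintype.sum_equiv (Equiv.arrowCongr σ⁻¹ (Equiv.refl (Fin k))) _ _ fun c => ?_
    have h2 : (Equiv.arrowCongr σ⁻¹ (Equiv.refl (Fin k))) c = c ∘ σ := rfl
    rw [h2, hN, hg]
  have h3 : ∀ c, ∑ σ : Equiv.Perm (Fin m), (if Monotone (c ∘ σ) then (N c)⁻¹ • g c else 0) =
      g c := by
    intro c
    rw [← Finset.sum_filter, Finset.sum_const, ← Fintype.card_subtype, card_perm_comp_monotone,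
      ← Nat.cast_smul_eq_nsmul K, smul_smul]
    have h4 : ((∏ j, (Fintype.card {i // c i = j}).factorial : ℕ) : K) = N c := by
      rw [Nat.cast_prod]
    rw [h4, mul_inv_cancel₀ (hN0 c), one_smul]
  rw [← Finset.sum_congr rfl fun c _ => h3 c, Finset.sum_comm, Finset.sum_congr rfl fun σ _ => h1 σ,
    Finset.sum_const, Finset.card_univ, Fintype.card_perm, Fintype.card_fin,
    ← Nat.cast_smul_eq_nsmul K]

end OrbitSum

/-! ### The operator of a representation as a sum over all words. -/

section Operators

variable {K : Type u} [Field K] {V : Type v} [AddCommGroup V] [Module K V]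
  (𝒱 : ℤ → Submodule K V) [DirectSum.Decomposition 𝒱]

/-- Letters are added from left to right. By monotonicity the blocks after that of the newest letter
are still empty, so `slot_polyDiffOp` gives no sign. -/
theorem polyDiffOp_blocks (a : OV 𝒱) {m k : ℕ} (c : Fin m → Fin k) (hc : Monotone c)
    (l : Fin m → Σ d : ℤ, 𝒱 d) :
    polyDiffOp 𝒱 a (fun j => ((List.finRange m).filter fun i => c i = j).map l) =
      (List.ofFn fun i => slot 𝒱 (c i) (l i).1 (partialD 𝒱 (l i).1 (l i).2)).reverse.prod
        (prodOp 𝒱 a) := by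
  induction m with
  | zero => simpa using polyDiffOp_nil 𝒱 a
  | succ m ih =>
    have h1 := ih (fun i => c i.castSucc) (fun i j h => hc (Fin.castSucc_le_castSucc_iff.2 h))
      (fun i => l i.castSucc)
    rw [List.ofFn_succ', List.concat_eq_append, List.reverse_append, List.reverse_singleton,
      List.singleton_append, List.prod_cons, Module.End.mul_apply, ← h1, slot_polyDiffOp]
    have h2 : ∀ q ∈ Finset.Ioi (c (Fin.last m)), wordDeg
        (((List.finRange m).filter fun i => c i.castSucc = q).map fun i => l i.castSucc) = 0 := by
      intro q hq
      have : (List.finRange m).filter (fun i => c i.castSucc = q) = [] := by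
        refine List.filter_eq_nil_iff.2 fun i _ => ?_
        have h3 := hc (Fin.le_last i.castSucc)
        have h4 := Finset.mem_Ioi.1 hq
        simpa using (h3.trans_lt h4).ne
      rw [this]
      rfl
    rw [Finset.sum_eq_zero h2, mul_zero]
    have h5 : sgn K 0 = 1 := by simp [sgn]
    rw [h5, one_smul]
    congr 1
    funext j
    rw [List.finRange_succ_last, List.filter_append, List.map_append, List.filter_map, List.map_map]
    by_cases hj : c (Fin.last m) = j
    · subst hj
      simp [Function.comp_def]
    · rw [Function.update_of_ne (Ne.symm hj)]
      simp [Function.comp_def, hj]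

variable {ι : Type*} [Fintype ι] [DecidableEq ι] (b : Module.Basis ι K V) {deg : ι → ℤ}
  (hdeg : ∀ α, b α ∈ 𝒱 (deg α)) {k : ℕ}

/-- The derivative along `e_α` of the `j`-th argument, for `x = (j, α)`. -/
def createB (x : Fin k × ι) : Module.End K (Cochain 𝒱 k) :=
  slot 𝒱 x.1 (deg x.2) (partialB 𝒱 b hdeg x.2)

/-- The graded commutator with the multiplication of the `j`-th argument by `x^α`, for
`x = (j, α)`. -/
def annihB (deg : ι → ℤ) (x : Fin k × ι) : Module.End K (Cochain 𝒱 k) :=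
  contract 𝒱 x.1 (deg x.2) (b.coord x.2)

/-- The parity of a letter. -/
def par₂ (deg : ι → ℤ) (x : Fin k × ι) : Bool := par deg x.2

/-- This is `contract_mul_slot` for dual bases: the Leibniz term is 1 when both slot and index agree
and 0 otherwise. -/
theorem ccr_cochains : CCR K (par₂ deg) (annihB 𝒱 b deg) (createB 𝒱 b hdeg (k := k)) := by
  rintro ⟨j, α⟩ ⟨j', β⟩
  have h := contract_mul_slot 𝒱 j j' (deg α) (deg β) (basis_coord_mem_dualDeg 𝒱 b hdeg α)
    ⟨b β, hdeg β⟩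
  rw [sgn_mul_eq_swapSign] at h
  refine h.trans ?_
  congr 1
  rcases eq_or_ne α β with rfl | hα
  · simp
  · simp [hα]

theorem createB_mul_createB (x y : Fin k × ι) : createB 𝒱 b hdeg x * createB 𝒱 b hdeg y =
    swapSign K (par₂ deg x) (par₂ deg y) • (createB 𝒱 b hdeg y * createB 𝒱 b hdeg x) := by
  obtain ⟨j, α⟩ := x
  obtain ⟨j', β⟩ := y
  have h0 := sgn_mul_eq_swapSign (K := K) (deg α) (deg β)
  rcases eq_or_ne j j' with rfl | h
  · simp only [createB, slot_mul_slot_self, ← slot_smul, add_comm (deg β)]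
    rw [partialB_mul_partialB]
    simp only [par₂, swapSign_comm]
  · have := slot_mul_slot_of_ne 𝒱 h (hasParity_partialD 𝒱 (deg α) ⟨b α, hdeg α⟩)
      (hasParity_partialD 𝒱 (deg β) ⟨b β, hdeg β⟩)
    rwa [h0] at this

include hdeg in
theorem annihB_mul_annihB (x y : Fin k × ι) : annihB 𝒱 b deg x * annihB 𝒱 b deg y =
    swapSign K (par₂ deg x) (par₂ deg y) • (annihB 𝒱 b deg y * annihB 𝒱 b deg x) := by
  have h := contract_mul_contract 𝒱 x.1 y.1 (deg x.2) (deg y.2)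
    (basis_coord_mem_dualDeg 𝒱 b hdeg x.2) (basis_coord_mem_dualDeg 𝒱 b hdeg y.2)
  rwa [sgn_mul_eq_swapSign] at h

include hdeg in
theorem annihB_prodOp (x : Fin k × ι) (a : OV 𝒱) : annihB 𝒱 b deg x (prodOp 𝒱 a) = 0 :=
  contract_prodOp 𝒱 b hdeg x.1 (deg x.2) (basis_coord_mem_dualDeg 𝒱 b hdeg x.2) a

theorem evalOne_createB (x : Fin k × ι) : evalOne 𝒱 ∘ₗ createB 𝒱 b hdeg x = 0 :=
  evalOne_slot 𝒱 x.1 (deg x.2) ⟨b x.2, hdeg x.2⟩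

/-- The operator obtained from multiplication by `a` by the derivatives along the letters of a
word, where the derivatives along the last letters stand first. -/
def wordOp (l : List (Fin k × ι)) (a : OV 𝒱) : Cochain 𝒱 k :=
  opWord (createB 𝒱 b hdeg) l.reverse (prodOp 𝒱 a)

theorem wordOp_signSym (a : OV 𝒱) :
    SignSym K (par₂ deg) fun l : List (Fin k × ι) => wordOp 𝒱 b hdeg l a := by
  have h := (opWord_signSym (createB_mul_createB 𝒱 b hdeg (k := k))).reverse
  intro u x y v
  exact LinearMap.congr_fun (h u x y v) (prodOp 𝒱 a)

theorem polyDiffOp_blockWord (a : OV 𝒱) {m : ℕ} (c : OrdPart m k) (hc : Monotone c.1)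
    (A : Fin m → ι) : polyDiffOp 𝒱 a (blockWord 𝒱 b deg hdeg c A) =
      wordOp 𝒱 b hdeg (List.ofFn fun i => (c.1 i, A i)) a := by
  refine (polyDiffOp_blocks 𝒱 a c.1 hc fun i => ⟨deg (A i), b (A i), hdeg (A i)⟩).trans ?_
  rw [wordOp, opWord, List.map_reverse, List.map_ofFn]
  rfl

theorem length_blockWord {m : ℕ} (c : OrdPart m k) (A : Fin m → ι) (j : Fin k) :
    (blockWord 𝒱 b deg hdeg c A j).length = Fintype.card {i // c.1 i = j} := by
  rw [blockWord, List.length_map, Fintype.card_subtype, ← List.toFinset_card_of_nodup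
    ((List.nodup_finRange m).filter _)]
  congr 1
  ext i
  simp

theorem blockWord_ne_nil {m : ℕ} (c : OrdPart m k) (A : Fin m → ι) (j : Fin k) :
    blockWord 𝒱 b deg hdeg c A j ≠ [] := by
  obtain ⟨i, hi⟩ := c.2 j
  rw [← List.length_pos_iff, length_blockWord]
  exact Fintype.card_pos_iff.2 ⟨⟨i, hi⟩⟩

theorem sum_length_blockWord {m : ℕ} (c : OrdPart m k) (A : Fin m → ι) :
    ∑ j, (blockWord 𝒱 b deg hdeg c A j).length = m := by
  simp only [length_blockWord]
  rw [← Fintype.card_sigma]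
  simpa using Fintype.card_congr (Equiv.sigmaFiberEquiv c.1)

variable [CharZero K] {p : ℕ}

/-- The factorials of the block lengths are the stabilizer orders of the orbit count, so they turn
into a single 1/m! once the sum runs over all placements of letters in blocks. This unrestricted
form is what the Fock space lemmas accept. -/
theorem symbolPart_eq (ρ : RepFin 𝒱 p) (m n : ℕ) : symbolPart 𝒱 b deg hdeg ρ m n =
    ((m.factorial : K)⁻¹ * (n.factorial : K)⁻¹) • ∑ J : Fin n → ι, ∑ Λ : Fin m → Fin (p + 1) × ι,
      coeff 𝒱 b ρ (List.ofFn Λ) (List.ofFn J) •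
        wordOp 𝒱 b hdeg (List.ofFn Λ) (monomialX 𝒱 b (List.ofFn J)) := by
  classical
  let h : List (Fin (p + 1) × ι) → (Fin n → ι) → Cochain 𝒱 (p + 1) := fun l J =>
    coeff 𝒱 b ρ l (List.ofFn J) • wordOp 𝒱 b hdeg l (monomialX 𝒱 b (List.ofFn J))
  let g : (Fin m → Fin (p + 1)) → Cochain 𝒱 (p + 1) := fun c =>
    ∑ J : Fin n → ι, ∑ A : Fin m → ι, h (List.ofFn fun i => (c i, A i)) J
  -- With all parities even, `SignSym` means plain symmetry: the signs of the coefficient and of the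
  -- operator cancel.
  have hsym : ∀ J, SignSym K (fun _ => false) fun l => h l J := by
    intro J u x y v
    have h1 := (coeff_signSym_output 𝒱 b hdeg ρ (List.ofFn J)).smul
      (wordOp_signSym 𝒱 b hdeg (monomialX 𝒱 b (List.ofFn J))) u x y v
    simpa [swapSign] using h1
  have hg : ∀ (σ : Equiv.Perm (Fin m)) c, g (c ∘ σ) = g c := by
    intro σ c
    refine Finset.sum_congr rfl fun J _ => ?_
    rw [← (Equiv.arrowCongr σ⁻¹ (Equiv.refl ι)).sum_comp]
    refine Finset.sum_congr rfl fun A _ => ?_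
    have h1 := (hsym J).ofFn_perm σ⁻¹ fun i => (c i, A i)
    have h2 : koszulSign K σ⁻¹ ((fun _ => false) ∘ fun i => (c i, A i)) = 1 :=
      Finset.prod_eq_one fun i _ => Finset.prod_eq_one fun j _ => if_neg (by simp)
    rw [h2, one_smul] at h1
    exact h1
  have hJ : ∀ J : Fin n → ι, monomialX 𝒱 b (List.ofFn J) =
      (List.ofFn fun i => coord 𝒱 (b.coord (J i))).prod := by
    intro J
    rw [monomialX_eq, List.map_ofFn]
    rfl
  have hsum : ∑ c, g c = ∑ J : Fin n → ι, ∑ Λ : Fin m → Fin (p + 1) × ι, h (List.ofFn Λ) J := by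
    rw [Finset.sum_comm]
    refine Finset.sum_congr rfl fun J _ => ?_
    rw [← Fintype.sum_prod_type' (f := fun (c : Fin m → Fin (p + 1)) (A : Fin m → ι) =>
      h (List.ofFn fun i => (c i, A i)) J),
      ← (Equiv.arrowProdEquivProdArrow (Fin m) (fun _ => Fin (p + 1)) fun _ => ι).sum_comp]
    rfl
  have hns : ∀ c, ¬ Function.Surjective c → g c = 0 := by
    intro c hc
    refine Finset.sum_eq_zero fun J _ => Finset.sum_eq_zero fun A _ => ?_
    simp only [h]
    rw [coeff_ofFn, coeffFun, dif_neg hc, zero_smul]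
  have hterm : ∀ c : OrdPart m (p + 1), Monotone c.1 →
      (∑ J : Fin n → ι, ∑ A : Fin m → ι,
        (tensorCoeff b A (ρ.1 m n (Finsupp.single c 1) (PiTensorProduct.tprod K fun i => b (J i))) /
          ((Nat.factorial n : K) *
            ∏ j, (Nat.factorial (blockWord 𝒱 b deg hdeg c A j).length : K))) •
          polyDiffOp 𝒱 (List.ofFn fun i => coord 𝒱 (b.coord (J i))).prod
            (blockWord 𝒱 b deg hdeg c A)) =
      (n.factorial : K)⁻¹ •
        ((∏ j, ((Fintype.card {i // c.1 i = j}).factorial : K))⁻¹) • g c.1 := by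
    intro c hc
    simp only [g, h, Finset.smul_sum]
    refine Finset.sum_congr rfl fun J _ => Finset.sum_congr rfl fun A _ => ?_
    simp only [length_blockWord]
    rw [polyDiffOp_blockWord 𝒱 b hdeg _ c hc, hJ, coeff_ofFn, coeffFun_of_surjective, smul_smul,
      smul_smul, div_eq_mul_inv, mul_inv, mul_comm, mul_assoc]
  rw [mul_comm, mul_smul, ← hsum, ← sum_eq_sum_monotone g hg, Finset.smul_sum]
  -- The maps with an empty block, which are no corollas, may be added because their coefficients
  -- are zero.
  have hfilter : ∑ c ∈ Finset.univ.filter (fun c : Fin m → Fin (p + 1) =>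
      Monotone c ∧ Function.Surjective c), (n.factorial : K)⁻¹ •
        ((∏ j, ((Fintype.card {i // c i = j}).factorial : K))⁻¹) • g c =
      ∑ c ∈ Finset.univ.filter (fun c : Fin m → Fin (p + 1) => Monotone c), (n.factorial : K)⁻¹ •
        ((∏ j, ((Fintype.card {i // c i = j}).factorial : K))⁻¹) • g c := by
    refine Finset.sum_subset (fun c hc => ?_) fun c hc hc' => ?_
    · simp only [Finset.mem_filter] at hc ⊢
      exact ⟨hc.1, hc.2.1⟩
    · simp only [Finset.mem_filter, Finset.mem_univ, true_and] at hc hc'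
      rw [hns c fun hs => hc' ⟨hc, hs⟩, smul_zero, smul_zero]
  rw [← hfilter, symbolPart]
  refine Finset.sum_nbij (fun c => c.1.1) (fun c _ => ?_) (fun c _ c' _ hcc => ?_)
    (fun c hc => ?_) fun c _ => hterm c.1 c.2
  · simpa using ⟨c.2, c.1.2⟩
  · exact Subtype.ext (Subtype.ext hcc)
  · simp only [Finset.coe_filter, Finset.mem_univ, true_and] at hc
    exact ⟨⟨⟨c, hc.2⟩, hc.1⟩, by simp, rfl⟩

end Operators

/-! ### Orthogonality of different Fock degrees. -/

section Fock

variable {K : Type u} [Field K] {L : Type*} [Fintype L] [DecidableEq L] {C : Type*}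
  [AddCommGroup C] [Module K C] {A Cr : L → Module.End K C} {par : L → Bool}

theorem apply_fockDeg_succ {N : Type*} [AddCommGroup N] [Module K N] {θ : C →ₗ[K] N}
    (hθ : ∀ x, θ ∘ₗ Cr x = 0) {W : Submodule K C} {m : ℕ} {Φ : C}
    (hΦ : Φ ∈ fockDeg Cr W (m + 1)) : θ Φ = 0 := by
  induction hΦ using Submodule.span_induction with
  | mem Φ h =>
    obtain ⟨l, v, hl, hv, rfl⟩ := h
    obtain ⟨x, l, rfl⟩ := List.exists_cons_of_length_eq_add_one hl
    rw [opWord_cons]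
    exact LinearMap.congr_fun (hθ x) _
  | zero => simp
  | add Φ Ψ _ _ h1 h2 => rw [map_add, h1, h2, add_zero]
  | smul c Φ _ h => rw [map_smul, h, smul_zero]

/-- With too few annihilators a creation operator is left for θ to kill; with too many the vacuum is
annihilated. -/
theorem CCR.pairing_fockDeg (hAC : CCR K par A Cr) {N : Type*} [AddCommGroup N] [Module K N]
    {θ : C →ₗ[K] N} (hθ : ∀ x, θ ∘ₗ Cr x = 0) {W : Submodule K C}
    (hW : ∀ v ∈ W, ∀ x, A x v = 0) {l : List L} {m : ℕ} {Φ : C}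
    (hΦ : Φ ∈ fockDeg Cr W m) (hl : l.length ≠ m) : θ (opWord A l Φ) = 0 := by
  rcases lt_or_gt_of_ne hl with h | h
  · obtain ⟨q, rfl⟩ := Nat.exists_eq_add_of_lt h
    exact apply_fockDeg_succ hθ (hAC.opWord_mem_fockDeg hW l hΦ)
  · rw [hAC.opWord_eq_zero hW l hΦ h, map_zero]

theorem fockDeg_zero_le {W : Submodule K C} : fockDeg Cr W 0 ≤ W := by
  refine Submodule.span_le.2 ?_
  rintro _ ⟨l, v, hl, hv, rfl⟩
  rw [List.length_eq_zero_iff] at hl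
  subst hl
  exact hv

end Fock

/-! ### Reading off coefficients, and bijectivity. -/

section Extraction

variable {K : Type u} [Field K] {V : Type v} [AddCommGroup V] [Module K V]
  (𝒱 : ℤ → Submodule K V) [DirectSum.Decomposition 𝒱]
  {ι : Type*} [Fintype ι] [DecidableEq ι] (b : Module.Basis ι K V) {deg : ι → ℤ}
  (hdeg : ∀ α, b α ∈ 𝒱 (deg α)) {k : ℕ}

/-- The functional that reads off the coefficient of the operator attached to a representation. -/
def extract (l : List (Fin k × ι)) (w : List ι) : Cochain 𝒱 k →ₗ[K] K :=
  (evalZero 𝒱).toLinearMap ∘ₗ opWord (partialB 𝒱 b hdeg) w.reverse ∘ₗ evalOne 𝒱 ∘ₗ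
    opWord (annihB 𝒱 b deg) l

theorem extract_apply (l : List (Fin k × ι)) (w : List ι) (Φ : Cochain 𝒱 k) :
    extract 𝒱 b hdeg l w Φ = evalZero 𝒱 (opWord (partialB 𝒱 b hdeg) w.reverse
      (evalOne 𝒱 (opWord (annihB 𝒱 b deg) l Φ))) := rfl

/-- The span of the operators of order `m` with coefficients of polynomial degree `n`. -/
def fockBi (k m n : ℕ) : Submodule K (Cochain 𝒱 k) :=
  fockDeg (createB 𝒱 b hdeg) ((monomialSpan 𝒱 b n).map (prodOp 𝒱)) m

include hdeg in
theorem vacuum_cochains {n : ℕ} : ∀ v ∈ (monomialSpan 𝒱 b n).map (prodOp 𝒱 (k := k)), ∀ x,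
    annihB 𝒱 b deg x v = 0 := by
  rintro _ ⟨a, -, rfl⟩ x
  exact annihB_prodOp 𝒱 b hdeg x a

theorem prodOp_evalOne_of_mem_fockBi {n : ℕ} {Φ : Cochain 𝒱 k} (hΦ : Φ ∈ fockBi 𝒱 b hdeg k 0 n) :
    evalOne 𝒱 Φ ∈ monomialSpan 𝒱 b n ∧ prodOp 𝒱 (evalOne 𝒱 Φ) = Φ := by
  obtain ⟨a, ha, rfl⟩ := fockDeg_zero_le hΦ
  rw [evalOne_prodOp]
  exact ⟨ha, rfl⟩

theorem opWord_annihB_mem {m n : ℕ} {Φ : Cochain 𝒱 k} (hΦ : Φ ∈ fockBi 𝒱 b hdeg k m n)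
    {l : List (Fin k × ι)} (hl : l.length = m) :
    opWord (annihB 𝒱 b deg) l Φ ∈ fockBi 𝒱 b hdeg k 0 n := by
  subst hl
  exact (ccr_cochains 𝒱 b hdeg).opWord_mem_fockDeg (vacuum_cochains 𝒱 b hdeg) l hΦ

/-- Orthogonality is used twice: on cochains for the order m, then on polynomials for the degree n
of the remaining coefficient. -/
theorem extract_fockBi {m n : ℕ} {Φ : Cochain 𝒱 k} (hΦ : Φ ∈ fockBi 𝒱 b hdeg k m n)
    {l : List (Fin k × ι)} {w : List ι} (h : ¬ (l.length = m ∧ w.length = n)) :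
    extract 𝒱 b hdeg l w Φ = 0 := by
  rw [extract_apply]
  by_cases hl : l.length = m
  · have h1 := prodOp_evalOne_of_mem_fockBi 𝒱 b hdeg (opWord_annihB_mem 𝒱 b hdeg hΦ hl)
    exact (ccr_polynomials 𝒱 b hdeg).pairing_fockDeg (θ := (evalZero 𝒱).toLinearMap)
      (evalZero_comp_mulX 𝒱 b) (vacuum_polynomials 𝒱 b hdeg) (monomialSpan_le_fockDeg 𝒱 b n h1.1)
      (by simpa using fun hw => h ⟨hl, hw⟩)
  · rw [(ccr_cochains 𝒱 b hdeg).pairing_fockDeg (evalOne_createB 𝒱 b hdeg)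
      (vacuum_cochains 𝒱 b hdeg) hΦ hl, map_zero, map_zero]

theorem opWord_annihB_normalizedAt {l : List (Fin k × ι)} {j : Fin k} (hl : ∀ x ∈ l, x.1 ≠ j)
    {Φ : Cochain 𝒱 k} (hΦ : Φ ∈ normalizedAt 𝒱 j) :
    opWord (annihB 𝒱 b deg) l Φ ∈ normalizedAt 𝒱 j := by
  induction l with
  | nil => exact hΦ
  | cons x l ih =>
    rw [opWord_cons]
    exact contract_mem_normalizedAt 𝒱 (hl x (by simp)) _ _
      (ih fun y hy => hl y (List.mem_cons_of_mem x hy))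

/-- Contractions away from j keep the operator zero on constants in the j-th argument, so its value
at (1, …, 1) vanishes. This supplies the condition on missing blocks in `exists_repFin`. -/
theorem extract_normalizedAt {l : List (Fin k × ι)} {w : List ι} {j : Fin k}
    (hl : ∀ x ∈ l, x.1 ≠ j) {Φ : Cochain 𝒱 k} (hΦ : Φ ∈ normalizedAt 𝒱 j) :
    extract 𝒱 b hdeg l w Φ = 0 := by
  have h : evalOne 𝒱 (opWord (annihB 𝒱 b deg) l Φ) = 0 :=
    opWord_annihB_normalizedAt 𝒱 b hl hΦ 1 rfl
  rw [extract_apply, h, map_zero, map_zero]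

theorem extract_signSym_output (w : List ι) (Φ : Cochain 𝒱 k) :
    SignSym K (par₂ deg) fun l : List (Fin k × ι) => extract 𝒱 b hdeg l w Φ := by
  intro u x y v
  have h := LinearMap.congr_fun (opWord_signSym (annihB_mul_annihB 𝒱 b hdeg (k := k)) u x y v) Φ
  simp only [extract_apply, h, LinearMap.smul_apply, map_smul]

theorem extract_signSym_input (l : List (Fin k × ι)) (Φ : Cochain 𝒱 k) :
    SignSym K (par deg) fun w => extract 𝒱 b hdeg l w Φ := by
  intro u x y v
  have h := LinearMap.congr_fun ((opWord_signSym (partialB_mul_partialB 𝒱 b hdeg)).reverse u x y v)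
    (evalOne 𝒱 (opWord (annihB 𝒱 b deg) l Φ))
  simp only [extract_apply]
  rw [h, LinearMap.smul_apply, map_smul]

/-- Contractions lower the degree by the letters of l, derivatives raise it by those of w, and
evaluation at the origin detects only degree zero. -/
theorem extract_degree {e : ℤ} {Φ : Cochain 𝒱 k} (hΦ : IsCochainDeg 𝒱 e Φ)
    {l : List (Fin k × ι)} {w : List ι} (h : extract 𝒱 b hdeg l w Φ ≠ 0) :
    (l.map fun x => deg x.2).sum = (w.map deg).sum + e := by
  have h1 : ∀ l : List (Fin k × ι), IsCochainDeg 𝒱 (e - (l.map fun x => deg x.2).sum)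
      (opWord (annihB 𝒱 b deg) l Φ) := by
    intro l
    induction l with
    | nil => simpa [opWord_nil] using hΦ
    | cons x l ih =>
      have h2 := ih.contract 𝒱 x.1 (deg x.2) (basis_coord_mem_dualDeg 𝒱 b hdeg x.2)
      rw [opWord_cons, List.map_cons, List.sum_cons, add_comm, ← sub_sub]
      exact h2
  have h2 : ∀ (w : List ι) (c : ℤ) (f : OV 𝒱), f ∈ ovDeg 𝒱 c →
      opWord (partialB 𝒱 b hdeg) w f ∈ ovDeg 𝒱 (c + (w.map deg).sum) := by
    intro w c f hf
    induction w with
    | nil => simpa [opWord_nil] using hf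
    | cons α w ih =>
      have h3 := partialD_mem_ovDeg 𝒱 (deg α) ⟨b α, hdeg α⟩ ih
      rw [opWord_cons, List.map_cons, List.sum_cons, add_comm (deg α), ← add_assoc]
      exact h3
  have h3 := h2 w.reverse _ _ (h1 l (fun _ => 0) 1 fun _ => ovDeg_one 𝒱)
  by_contra hne
  refine h (evalZero_of_mem 𝒱 h3 ?_)
  simp only [Finset.sum_const_zero, zero_add, List.map_reverse, List.sum_reverse]
  omega

theorem isCochainDeg_wordOp (l : List (Fin k × ι)) {c : ℤ} {a : OV 𝒱} (ha : a ∈ ovDeg 𝒱 c) :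
    IsCochainDeg 𝒱 (c + (l.map fun x => deg x.2).sum) (wordOp 𝒱 b hdeg l a) := by
  rw [wordOp, ← List.sum_reverse, ← List.map_reverse]
  induction l.reverse with
  | nil => simpa [opWord_nil] using isCochainDeg_prodOp 𝒱 ha
  | cons x l ih =>
    have h := ih.slot 𝒱 x.1 (deg x.2) (deg x.2) (partialB 𝒱 b hdeg x.2)
      fun c f hf => partialD_mem_ovDeg 𝒱 _ _ hf
    rw [opWord_cons, List.map_cons, List.sum_cons, add_comm (deg x.2), ← add_assoc]
    exact h

include hdeg in
theorem monomialX_mem_ovDeg (J : List ι) : monomialX 𝒱 b J ∈ ovDeg 𝒱 (-(J.map deg).sum) := by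
  induction J with
  | nil => simpa [monomialX, opWord_nil] using ovDeg_one 𝒱
  | cons α J ih =>
    have h := coord_mul_mem_ovDeg 𝒱 (basis_coord_mem_dualDeg 𝒱 b hdeg α) ih
    rw [List.map_cons, List.sum_cons, neg_add]
    simpa [monomialX, opWord_cons, mulX] using h

/-! ### Polydifferential operators in a basis -/

theorem slot_partialD_eq_sum (j : Fin k) (d : ℤ) (w : 𝒱 d) :
    slot 𝒱 j d (partialD 𝒱 d w) = ∑ α, b.coord α (w : V) • createB 𝒱 b hdeg (j, α) := by
  rw [partialD_eq_sum 𝒱 b hdeg, slot_sum]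
  refine Finset.sum_congr rfl fun α _ => ?_
  rw [slot_smul]
  by_cases h : d = deg α
  · rw [createB, ← h]
  · rw [basis_coord_of_mem 𝒱 b hdeg α h w.2, zero_smul, zero_smul]

/-- Induction on the total number of letters: the last letter of some nonempty word is removed, and
`slot_polyDiffOp` restores it up to a sign. -/
theorem polyDiffOp_mem_fockBi {n : ℕ} {a : OV 𝒱} (ha : a ∈ monomialSpan 𝒱 b n) {m : ℕ}
    {I : Fin k → Word 𝒱} (hI : ∑ j, (I j).length = m) :
    polyDiffOp 𝒱 a I ∈ fockBi 𝒱 b hdeg k m n := by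
  induction m generalizing I with
  | zero =>
    have h : I = fun _ => [] := by
      funext j
      simpa using Finset.sum_eq_zero_iff.1 hI j (Finset.mem_univ j)
    rw [h, polyDiffOp_nil]
    exact Submodule.subset_span ⟨[], _, rfl, ⟨a, ha, rfl⟩, rfl⟩
  | succ m ih =>
    have h : ∃ j, I j ≠ [] := by
      by_contra! h
      simp [h] at hI
    obtain ⟨j, hj⟩ := h
    have h1 := slot_polyDiffOp 𝒱 j ((I j).getLast hj) a (Function.update I j (I j).dropLast)
    rw [Function.update_self, Function.update_idem, List.dropLast_append_getLast,
      Function.update_eq_self] at h1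
    have h2 : ∑ q, (Function.update I j (I j).dropLast q).length = m := by
      rw [← Finset.add_sum_erase _ _ (Finset.mem_univ j)] at hI ⊢
      have h3 : ∑ q ∈ Finset.univ.erase j, (Function.update I j (I j).dropLast q).length =
          ∑ q ∈ Finset.univ.erase j, (I q).length :=
        Finset.sum_congr rfl fun q hq => by rw [Function.update_of_ne (Finset.ne_of_mem_erase hq)]
      have h4 := List.length_pos_iff.2 hj
      rw [h3, Function.update_self, List.length_dropLast]
      omega
    have h3 : slot 𝒱 j ((I j).getLast hj).1 (partialD 𝒱 _ ((I j).getLast hj).2)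
        (polyDiffOp 𝒱 a (Function.update I j (I j).dropLast)) ∈ fockBi 𝒱 b hdeg k (m + 1) n := by
      rw [slot_partialD_eq_sum 𝒱 b hdeg, LinearMap.sum_apply]
      refine Submodule.sum_mem _ fun α _ => ?_
      rw [LinearMap.smul_apply]
      exact Submodule.smul_mem _ _ (create_mem_fockDeg _ (ih h2))
    rw [h1] at h3
    -- The exponent is irrelevant: any `sgn` is its own inverse, so the sign can be removed inside
    -- the subspace.
    generalize ((I j).getLast hj).1 * _ = s at h3
    have h4 := Submodule.smul_mem _ (sgn K s) h3
    rwa [smul_smul, sgn_mul_self, one_smul] at h4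

theorem prod_coord_mem_monomialSpan {n : ℕ} (ξ : Fin n → Module.Dual K V) :
    (List.ofFn fun i => coord 𝒱 (ξ i)).prod ∈ monomialSpan 𝒱 b n := by
  induction n with
  | zero => exact Submodule.subset_span ⟨[], rfl, by simp [monomialX_eq]⟩
  | succ n ih =>
    rw [List.ofFn_succ, List.prod_cons, coord_eq_sum 𝒱 b, Finset.sum_mul]
    refine Submodule.sum_mem _ fun α _ => ?_
    rw [smul_mul_assoc]
    refine Submodule.smul_mem _ _ ?_
    have h := ih fun i => ξ i.succ
    generalize (List.ofFn fun i : Fin n => coord 𝒱 (ξ i.succ)).prod = g at h ⊢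
    induction h using Submodule.span_induction with
    | mem f h =>
      obtain ⟨J, hJ, rfl⟩ := h
      exact Submodule.subset_span ⟨α :: J, by simp [hJ], by simp [monomialX_eq]⟩
    | zero => simp
    | add f g _ _ h1 h2 => rw [mul_add]; exact add_mem h1 h2
    | smul c f _ h => rw [mul_smul_comm]; exact Submodule.smul_mem _ _ h

theorem polyDiffBi_le_fockBi (p m n : ℕ) : PolyDiffBi 𝒱 p m n ≤ fockBi 𝒱 b hdeg (p + 1) m n := by
  refine Submodule.span_le.2 ?_
  rintro _ ⟨ξ, I, -, hI, rfl⟩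
  exact polyDiffOp_mem_fockBi 𝒱 b hdeg (prod_coord_mem_monomialSpan 𝒱 b ξ) hI

theorem polyDiffBi_le_polyDiff (p m n : ℕ) : PolyDiffBi 𝒱 p m n ≤ PolyDiff 𝒱 p :=
  Submodule.span_mono fun _ ⟨_, I, hI, _, h⟩ => ⟨_, I, hI, h⟩

variable {p : ℕ}

theorem symbolPart_mem_polyDiffBi (ρ : RepFin 𝒱 p) (m n : ℕ) :
    symbolPart 𝒱 b deg hdeg ρ m n ∈ PolyDiffBi 𝒱 p m n :=
  Submodule.sum_mem _ fun c _ => Submodule.sum_mem _ fun J _ => Submodule.sum_mem _ fun A _ =>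
    Submodule.smul_mem _ _ (Submodule.subset_span ⟨fun i => b.coord (J i),
      blockWord 𝒱 b deg hdeg c.1 A, blockWord_ne_nil 𝒱 b hdeg c.1 A,
      sum_length_blockWord 𝒱 b hdeg c.1 A, rfl⟩)

theorem symbolPart_of_eq_zero {ρ : RepFin 𝒱 p} {m n : ℕ} (h : ρ.1 m n = 0) :
    symbolPart 𝒱 b deg hdeg ρ m n = 0 := by
  simp [symbolPart, h]

theorem symbolOp_eq_sum (ρ : RepFin 𝒱 p) {s : Finset (ℕ × ℕ)}
    (hs : ∀ m n, ρ.1 m n ≠ 0 → (m, n) ∈ s) :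
    symbolOp 𝒱 b deg hdeg ρ = ∑ mn ∈ s, symbolPart 𝒱 b deg hdeg ρ mn.1 mn.2 := by
  refine finsum_eq_sum_of_support_subset _ fun mn h => hs mn.1 mn.2 fun h0 => h ?_
  exact symbolPart_of_eq_zero 𝒱 b hdeg h0

theorem symbolOp_mem_polyDiff (ρ : RepFin 𝒱 p) : symbolOp 𝒱 b deg hdeg ρ ∈ PolyDiff 𝒱 p := by
  rw [symbolOp_eq_sum 𝒱 b hdeg ρ (s := ρ.2.2.toFinset) fun m n h => by simpa using h]
  exact Submodule.sum_mem _ fun mn _ =>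
    polyDiffBi_le_polyDiff 𝒱 p _ _ (symbolPart_mem_polyDiffBi 𝒱 b hdeg ρ _ _)

theorem symbolOp_of_support {ρ : RepFin 𝒱 p} {m n : ℕ}
    (h : ∀ m' n', (m', n') ≠ (m, n) → ρ.1 m' n' = 0) :
    symbolOp 𝒱 b deg hdeg ρ = symbolPart 𝒱 b deg hdeg ρ m n := by
  rw [symbolOp_eq_sum 𝒱 b hdeg ρ (s := {(m, n)}), Finset.sum_singleton]
  intro m' n' h'
  by_contra hne
  exact h' (h m' n' (by simpa using hne))

theorem coeff_add (ρ ρ' : RepFin 𝒱 p) (l : List (Fin (p + 1) × ι)) (w : List ι) :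
    coeff 𝒱 b (ρ + ρ') l w = coeff 𝒱 b ρ l w + coeff 𝒱 b ρ' l w := by
  simp only [coeff, coeffFun]
  split_ifs <;> simp

theorem coeff_smul (c : K) (ρ : RepFin 𝒱 p) (l : List (Fin (p + 1) × ι)) (w : List ι) :
    coeff 𝒱 b (c • ρ) l w = c * coeff 𝒱 b ρ l w := by
  simp only [coeff, coeffFun]
  split_ifs <;> simp

variable [CharZero K]

theorem symbolPart_add (ρ ρ' : RepFin 𝒱 p) (m n : ℕ) : symbolPart 𝒱 b deg hdeg (ρ + ρ') m n =
    symbolPart 𝒱 b deg hdeg ρ m n + symbolPart 𝒱 b deg hdeg ρ' m n := by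
  simp only [symbolPart_eq, coeff_add, add_smul, Finset.sum_add_distrib, smul_add]

theorem symbolPart_smul (c : K) (ρ : RepFin 𝒱 p) (m n : ℕ) :
    symbolPart 𝒱 b deg hdeg (c • ρ) m n = c • symbolPart 𝒱 b deg hdeg ρ m n := by
  simp only [symbolPart_eq, coeff_smul, mul_smul, ← Finset.smul_sum]
  rw [smul_comm _ c, smul_comm _ c]

/-- The map from representations to operators, as a linear map. -/
def symbolLin : RepFin 𝒱 p →ₗ[K] Cochain 𝒱 (p + 1) where
  toFun ρ := symbolOp 𝒱 b deg hdeg ρ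
  map_add' ρ ρ' := by
    classical
    have hs : ∀ ρ'' : RepFin 𝒱 p, (∀ m n, ρ''.1 m n ≠ 0 → ρ.1 m n ≠ 0 ∨ ρ'.1 m n ≠ 0) →
        symbolOp 𝒱 b deg hdeg ρ'' = ∑ mn ∈ ρ.2.2.toFinset ∪ ρ'.2.2.toFinset,
          symbolPart 𝒱 b deg hdeg ρ'' mn.1 mn.2 :=
      fun ρ'' h => symbolOp_eq_sum 𝒱 b hdeg ρ'' fun m n h' => by simpa using h m n h'
    rw [hs ρ fun m n h => Or.inl h, hs ρ' fun m n h => Or.inr h, hs (ρ + ρ') fun m n h => ?_,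
      ← Finset.sum_add_distrib]
    · exact Finset.sum_congr rfl fun mn _ => symbolPart_add 𝒱 b hdeg ρ ρ' _ _
    · by_contra! hc
      exact h (by simp [hc.1, hc.2])
  map_smul' c ρ := by
    rw [symbolOp_eq_sum 𝒱 b hdeg (c • ρ) (s := ρ.2.2.toFinset) fun m n h => ?_,
      symbolOp_eq_sum 𝒱 b hdeg ρ (s := ρ.2.2.toFinset) fun m n h => by simpa using h,
      RingHom.id_apply, Finset.smul_sum]
    · exact Finset.sum_congr rfl fun mn _ => symbolPart_smul 𝒱 b hdeg c ρ _ _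
    · simp only [Set.Finite.mem_toFinset, Set.mem_ofPred_eq]
      intro h0
      exact h (by simp [h0])

theorem symbolPart_eq_wordSum (ρ : RepFin 𝒱 p) (m n : ℕ) : symbolPart 𝒱 b deg hdeg ρ m n =
    ((m.factorial : K)⁻¹ * (n.factorial : K)⁻¹) • ∑ J : Fin n → ι,
      wordSum (createB 𝒱 b hdeg) m (fun l => coeff 𝒱 b ρ l.reverse (List.ofFn J))
        (prodOp 𝒱 (monomialX 𝒱 b (List.ofFn J))) := by
  rw [symbolPart_eq]
  congr 1
  refine Finset.sum_congr rfl fun J _ => ?_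
  have h := sum_words_reverse m fun l => coeff 𝒱 b ρ l.reverse (List.ofFn J) •
    opWord (createB 𝒱 b hdeg) l (prodOp 𝒱 (monomialX 𝒱 b (List.ofFn J)))
  simp only [List.reverse_reverse] at h
  exact h

/-- The pairing on cochains produces m! and leaves the coefficients as a polynomial; the pairing on
that polynomial produces n!. Together they cancel the normalization of the symbol. -/
theorem extract_symbolPart (ρ : RepFin 𝒱 p) (m n : ℕ) (l : List (Fin (p + 1) × ι)) (w : List ι) :
    extract 𝒱 b hdeg l w (symbolPart 𝒱 b deg hdeg ρ m n) =
      if l.length = m ∧ w.length = n then coeff 𝒱 b ρ l w else 0 := by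
  split_ifs with h
  · obtain ⟨rfl, rfl⟩ := h
    have h1 : ∀ J : Fin w.length → ι, evalOne 𝒱 (opWord (annihB 𝒱 b deg) l
        (wordSum (createB 𝒱 b hdeg) l.length (fun l => coeff 𝒱 b ρ l.reverse (List.ofFn J))
          (prodOp 𝒱 (monomialX 𝒱 b (List.ofFn J))))) =
        (l.length.factorial : K) • coeff 𝒱 b ρ l (List.ofFn J) • monomialX 𝒱 b (List.ofFn J) := by
      intro J
      have h2 := (ccr_cochains 𝒱 b hdeg).pairing_wordSum
        (fun x => annihB_prodOp 𝒱 b hdeg x (monomialX 𝒱 b (List.ofFn J))) (evalOne 𝒱)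
        (evalOne_createB 𝒱 b hdeg) l.reverse l.length
        (coeff_signSym_output 𝒱 b hdeg ρ (List.ofFn J)).reverse
      rw [List.reverse_reverse, if_pos List.length_reverse, evalOne_prodOp, mul_smul] at h2
      exact h2
    have h2 := evalZero_partial_wordSum 𝒱 b hdeg w w.length (coeff_signSym_input 𝒱 b hdeg ρ l)
    rw [if_pos rfl] at h2
    have hm : (l.length.factorial : K) ≠ 0 := Nat.cast_ne_zero.2 (Nat.factorial_ne_zero _)
    have hn : (w.length.factorial : K) ≠ 0 := Nat.cast_ne_zero.2 (Nat.factorial_ne_zero _)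
    rw [symbolPart_eq_wordSum, map_smul, extract_apply, map_sum, map_sum,
      Finset.sum_congr rfl fun J _ => h1 J, ← Finset.smul_sum, map_smul, map_smul]
    -- The sum over J of coefficient times monomial is itself a `wordSum`, created from 1 by the
    -- coordinates.
    change _ • (_ • evalZero 𝒱 (opWord (partialB 𝒱 b hdeg) w.reverse
      (wordSum (mulX 𝒱 b) w.length (fun w => coeff 𝒱 b ρ l w) 1))) = _
    rw [h2, smul_eq_mul, smul_eq_mul]
    field_simp
  · exact extract_fockBi 𝒱 b hdeg
      (polyDiffBi_le_fockBi 𝒱 b hdeg p m n (symbolPart_mem_polyDiffBi 𝒱 b hdeg ρ m n)) h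

theorem extract_symbolOp (ρ : RepFin 𝒱 p) (l : List (Fin (p + 1) × ι)) (w : List ι) :
    extract 𝒱 b hdeg l w (symbolOp 𝒱 b deg hdeg ρ) = coeff 𝒱 b ρ l w := by
  classical
  rw [symbolOp_eq_sum 𝒱 b hdeg ρ (s := insert (l.length, w.length) ρ.2.2.toFinset)
    fun m n h => by simpa using Or.inr h, map_sum,
    Finset.sum_eq_single_of_mem (l.length, w.length) (Finset.mem_insert_self _ _)]
  · rw [extract_symbolPart, if_pos ⟨rfl, rfl⟩]
  · rintro ⟨m, n⟩ _ hne
    rw [extract_symbolPart, if_neg]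
    rintro ⟨rfl, rfl⟩
    exact hne rfl

theorem symbolLin_injective : Function.Injective (symbolLin 𝒱 b hdeg (p := p)) := by
  intro ρ ρ' h
  refine repFin_ext 𝒱 b fun l w => ?_
  rw [← extract_symbolOp 𝒱 b hdeg, ← extract_symbolOp 𝒱 b hdeg]
  exact congrArg (extract 𝒱 b hdeg l w) h

/-- The extracted functions of words satisfy the conditions of `exists_repFin`. The resulting symbol
equals Φ by Taylor's formula for the coefficient polynomials and the resolution of the identity for
the derivatives. -/
theorem exists_symbolOp_eq {m n : ℕ} {Φ : Cochain 𝒱 (p + 1)}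
    (hΦ : Φ ∈ fockBi 𝒱 b hdeg (p + 1) m n) (hn : ∀ j, Φ ∈ normalizedAt 𝒱 j) :
    ∃ ρ : RepFin 𝒱 p, symbolOp 𝒱 b deg hdeg ρ = Φ := by
  obtain ⟨ρ, hρ⟩ := exists_repFin 𝒱 b hdeg (fun l w => extract 𝒱 b hdeg l w Φ)
    (fun w => extract_signSym_output 𝒱 b hdeg w Φ) (fun l => extract_signSym_input 𝒱 b hdeg l Φ)
    (fun l w j hl => extract_normalizedAt 𝒱 b hdeg hl (hn j))
    ((Set.finite_singleton (m, n)).subset (by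
      rintro ⟨m', n'⟩ ⟨l, w, rfl, rfl, h⟩
      by_contra hne
      exact h (extract_fockBi 𝒱 b hdeg hΦ fun ⟨h1, h2⟩ => hne (by simp [h1, h2]))))
  refine ⟨ρ, ?_⟩
  rw [symbolOp_of_support 𝒱 b hdeg (m := m) (n := n), symbolPart_eq]
  · have hm0 : (m.factorial : K) ≠ 0 := Nat.cast_ne_zero.2 (Nat.factorial_ne_zero _)
    have hn0 : (n.factorial : K) ≠ 0 := Nat.cast_ne_zero.2 (Nat.factorial_ne_zero _)
    -- After m annihilations Φ is multiplication by a polynomial of degree n; Taylor's formula sums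
    -- its monomials back, with a factor n!.
    have h1 : ∀ Λ : Fin m → Fin (p + 1) × ι, ∑ J : Fin n → ι,
        coeff 𝒱 b ρ (List.ofFn Λ) (List.ofFn J) •
          wordOp 𝒱 b hdeg (List.ofFn Λ) (monomialX 𝒱 b (List.ofFn J)) =
        (n.factorial : K) • opWord (createB 𝒱 b hdeg) (List.ofFn Λ).reverse
          (opWord (annihB 𝒱 b deg) (List.ofFn Λ) Φ) := by
      intro Λ
      have h2 := prodOp_evalOne_of_mem_fockBi 𝒱 b hdeg
        (opWord_annihB_mem 𝒱 b hdeg hΦ (l := List.ofFn Λ) (by simp))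
      have h3 := sum_taylor 𝒱 b hdeg h2.1
      simp only [hρ, wordOp, extract_apply]
      conv_lhs => simp only [← map_smul, ← map_sum]
      rw [h3, map_smul, map_smul, h2.2]
    rw [Finset.sum_comm, Finset.sum_congr rfl fun Λ _ => h1 Λ, ← Finset.smul_sum]
    have h2 := sum_words_reverse m fun l => opWord (createB 𝒱 b hdeg) l
      (opWord (annihB 𝒱 b deg) l.reverse Φ)
    have h3 := (ccr_cochains 𝒱 b hdeg).sum_create_annihilate (createB_mul_createB 𝒱 b hdeg)
      (vacuum_cochains 𝒱 b hdeg) hΦ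
    simp only [List.reverse_reverse] at h2
    rw [h2, h3, smul_smul, smul_smul]
    have h4 : (m.factorial : K)⁻¹ * (n.factorial : K)⁻¹ * n.factorial * m.factorial = 1 := by
      field_simp
    rw [h4, one_smul]
  · intro m' n' hne
    refine repFin_eq_zero_at 𝒱 b fun l w hl hw => ?_
    rw [hρ]
    refine extract_fockBi 𝒱 b hdeg hΦ ?_
    rintro ⟨h1, h2⟩
    exact hne (by rw [← hl, ← hw, h1, h2])

theorem polyDiff_le_range : PolyDiff 𝒱 p ≤ LinearMap.range (symbolLin 𝒱 b hdeg (p := p)) := by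
  refine Submodule.span_le.2 ?_
  rintro _ ⟨a, I, hI, rfl⟩
  have ha : a ∈ Submodule.span K (Set.range (monomialX 𝒱 b)) := by
    rw [span_monomialX]; trivial
  induction ha using Submodule.span_induction with
  | mem a h =>
    obtain ⟨J, rfl⟩ := h
    exact exists_symbolOp_eq 𝒱 b hdeg
      (polyDiffOp_mem_fockBi 𝒱 b hdeg (Submodule.subset_span ⟨J, rfl, rfl⟩) rfl)
      fun j => polyDiffOp_mem_normalizedAt 𝒱 _ (hI j)
  | zero =>
    have h : polyDiffOp 𝒱 0 I = 0 := by
      ext f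
      rw [polyDiffOp_apply, map_zero]
      rfl
    rw [h]
    exact zero_mem _
  | add a a' _ _ h1 h2 =>
    have h : polyDiffOp 𝒱 (a + a') I = polyDiffOp 𝒱 a I + polyDiffOp 𝒱 a' I := by
      ext f
      rw [polyDiffOp_apply, map_add]
      rfl
    rw [h]
    exact add_mem h1 h2
  | smul c a _ h1 =>
    have h : polyDiffOp 𝒱 (c • a) I = c • polyDiffOp 𝒱 a I := by
      ext f
      rw [polyDiffOp_apply, map_smul]
      rfl
    rw [h]
    exact Submodule.smul_mem _ _ h1

/-- The isomorphism between representations and polydifferential operators given by a basis. -/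
def symbolEquiv : RepFin 𝒱 p ≃ₗ[K] PolyDiff 𝒱 p :=
  LinearEquiv.ofBijective ((symbolLin 𝒱 b hdeg).codRestrict _ (symbolOp_mem_polyDiff 𝒱 b hdeg)) <| by
    constructor
    · intro ρ ρ' h
      exact symbolLin_injective 𝒱 b hdeg (congrArg Subtype.val h)
    · rintro ⟨Φ, hΦ⟩
      obtain ⟨ρ, hρ⟩ := polyDiff_le_range 𝒱 b hdeg hΦ
      exact ⟨ρ, Subtype.ext hρ⟩

theorem isRepDeg_iff_isCochainDeg (e : ℤ) (ρ : RepFin 𝒱 p) :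
    IsRepDeg 𝒱 e ρ ↔ IsCochainDeg 𝒱 e (symbolOp 𝒱 b deg hdeg ρ) := by
  rw [isRepDeg_iff 𝒱 b hdeg]
  constructor
  · intro h
    rw [symbolOp_eq_sum 𝒱 b hdeg ρ (s := ρ.2.2.toFinset) fun m n h => by simpa using h]
    refine IsCochainDeg.sum 𝒱 _ fun mn _ => ?_
    rw [symbolPart_eq]
    refine IsCochainDeg.smul 𝒱 (IsCochainDeg.sum 𝒱 _ fun J _ => IsCochainDeg.sum 𝒱 _
      fun Λ _ => ?_) _
    by_cases h0 : coeff 𝒱 b ρ (List.ofFn Λ) (List.ofFn J) = 0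
    · rw [h0, zero_smul]
      exact isCochainDeg_zero 𝒱 e
    · have h1 := isCochainDeg_wordOp 𝒱 b hdeg (List.ofFn Λ)
        (monomialX_mem_ovDeg 𝒱 b hdeg (List.ofFn J))
      rw [h _ _ h0, neg_add_cancel_left] at h1
      exact h1.smul 𝒱 _
  · intro h l w h0
    rw [← extract_symbolOp 𝒱 b hdeg] at h0
    exact extract_degree 𝒱 b hdeg h h0

theorem support_iff_mem_polyDiffBi (m n : ℕ) (ρ : RepFin 𝒱 p) :
    (∀ m' n', (m', n') ≠ (m, n) → ρ.1 m' n' = 0) ↔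
      symbolOp 𝒱 b deg hdeg ρ ∈ PolyDiffBi 𝒱 p m n := by
  constructor
  · intro h
    rw [symbolOp_of_support 𝒱 b hdeg h]
    exact symbolPart_mem_polyDiffBi 𝒱 b hdeg ρ m n
  · intro h m' n' hne
    refine repFin_eq_zero_at 𝒱 b fun l w hl hw => ?_
    rw [← extract_symbolOp 𝒱 b hdeg]
    refine extract_fockBi 𝒱 b hdeg (polyDiffBi_le_fockBi 𝒱 b hdeg p m n h) ?_
    rintro ⟨h1, h2⟩
    exact hne (by rw [← hl, ← hw, h1, h2])

end Extraction

/-! ### The differentials square to zero -/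

section AlternatingSums

variable {K : Type u} [Field K] {M : Type*} [AddCommGroup M] [Module K M]

/-- The terms at (i, j + 1) and (j, i) agree by the simplicial identity and have opposite signs. -/
theorem alternating_sum_range (n : ℕ) (F : ℕ → ℕ → M)
    (h : ∀ i j, i ≤ j → j < n → F i (j + 1) = F j i) :
    ∑ i ∈ Finset.range n, ∑ j ∈ Finset.range (n + 1), (-1 : K) ^ (i + j) • F i j = 0 := by
  induction n with
  | zero => simp
  | succ n ih =>
    -- Passing from n to n + 1 adds one column and one row; they cancel each other.
    have h1 : ∑ i ∈ Finset.range (n + 1), (-1 : K) ^ (i + (n + 1)) • F i (n + 1) =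
        -∑ i ∈ Finset.range (n + 1), (-1 : K) ^ (n + i) • F n i := by
      rw [← Finset.sum_neg_distrib]
      refine Finset.sum_congr rfl fun i hi => ?_
      rw [h i n (Finset.mem_range_succ_iff.1 hi) (Nat.lt_succ_self n), ← neg_smul]
      congr 1
      ring
    have h2 : ∀ i ∈ Finset.range (n + 1),
        ∑ j ∈ Finset.range (n + 1 + 1), (-1 : K) ^ (i + j) • F i j =
          ∑ j ∈ Finset.range (n + 1), (-1 : K) ^ (i + j) • F i j +
            (-1 : K) ^ (i + (n + 1)) • F i (n + 1) :=
      fun i _ => Finset.sum_range_succ _ _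
    rw [Finset.sum_congr rfl h2, Finset.sum_add_distrib, h1, Finset.sum_range_succ,
      ih fun i j hij hj => h i j hij (hj.trans (Nat.lt_succ_self n)), zero_add, add_neg_cancel]

theorem alternating_sum_fin {n : ℕ} (F : Fin n → Fin (n + 1) → M)
    (h : ∀ i j : Fin n, i ≤ j → F i j.succ = F j i.castSucc) :
    ∑ i : Fin n, ∑ j : Fin (n + 1), ((-1 : K) ^ (i : ℕ) * (-1 : K) ^ (j : ℕ)) • F i j = 0 := by
  let F' : ℕ → ℕ → M := fun i j => if h : i < n ∧ j < n + 1 then F ⟨i, h.1⟩ ⟨j, h.2⟩ else 0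
  have h1 := alternating_sum_range (K := K) n F' fun i j hij hj => by
    simp only [F']
    rw [dif_pos ⟨by omega, by omega⟩, dif_pos ⟨hj, by omega⟩]
    exact h ⟨i, by omega⟩ ⟨j, hj⟩ hij
  rw [Finset.sum_range] at h1
  simp only [Finset.sum_range] at h1
  rw [← h1]
  refine Finset.sum_congr rfl fun i _ => Finset.sum_congr rfl fun j _ => ?_
  simp only [F', dif_pos (And.intro i.2 j.2), pow_add]

end AlternatingSums

theorem predAbove_val {k : ℕ} (i : Fin k) (x : Fin (k + 1)) :
    (i.predAbove x : ℕ) = if (i : ℕ) < x then (x : ℕ) - 1 else x := by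
  simp only [Fin.predAbove, Fin.lt_def, Fin.val_castSucc]
  split_ifs <;> simp

/-- The simplicial identity for codegeneracies, which makes the merges of blocks cancel in δ². -/
theorem predAbove_predAbove_of_le {k : ℕ} {i j : Fin (k + 1)} (h : i ≤ j) (x : Fin (k + 3)) :
    i.predAbove (j.succ.predAbove x) = j.predAbove (i.castSucc.predAbove x) := by
  ext
  simp only [predAbove_val, Fin.val_succ, Fin.val_castSucc]
  have : (i : ℕ) ≤ j := h
  grind

theorem genDiff_comp_genDiff (K : Type u) [Field K] (m p : ℕ) :
    genDiff K m p ∘ₗ genDiff K m (p + 1) = 0 := by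
  refine Finsupp.lhom_ext fun c a => ?_
  have h := alternating_sum_fin (K := K) (fun (i : Fin (p + 1)) (j : Fin (p + 1 + 1)) =>
    Finsupp.single (OrdPart.merge i (OrdPart.merge j c)) a) fun i j hij => by
      congr 1
      exact Subtype.ext (funext fun x => predAbove_predAbove_of_le hij (c.1 x))
  rw [Finset.sum_comm] at h
  simp only [genDiff, LinearMap.comp_apply, LinearMap.sum_apply, LinearMap.smul_apply,
    Finsupp.lmapDomain_apply, Finsupp.mapDomain_single, map_sum, map_smul, LinearMap.zero_apply]
  rw [← h]
  refine Finset.sum_congr rfl fun j _ => ?_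
  rw [Finset.smul_sum]
  refine Finset.sum_congr rfl fun i _ => ?_
  rw [smul_smul, mul_comm]

section Graded

variable {K : Type u} [Field K] {V : Type v} [AddCommGroup V] [Module K V]
  (𝒱 : ℤ → Submodule K V) [DirectSum.Decomposition 𝒱]

theorem repDiff_repDiff {p : ℕ} (ρ : RepFin 𝒱 p) : repDiff 𝒱 (p + 1) (repDiff 𝒱 p ρ) = 0 := by
  ext1
  funext m n
  change (ρ.1 m n ∘ₗ genDiff K m p) ∘ₗ genDiff K m (p + 1) = 0
  rw [LinearMap.comp_assoc, genDiff_comp_genDiff, LinearMap.comp_zero]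

theorem cochain_neg_smul {k : ℕ} (c : K) (Φ : Cochain 𝒱 k) : (-c) • Φ = -(c • Φ) :=
  neg_smul c Φ

/-- The first summand of the Hochschild differential,
`(f_0, …, f_k) ↦ (-1)^{|f_0||Φ|} f_0 Φ(f_1, …, f_k)`. -/
def leftD {k : ℕ} : Cochain 𝒱 k →ₗ[K] Cochain 𝒱 (k + 1) :=
  leftMul 𝒱 (evenPart 𝒱) + leftMul 𝒱 (oddPart 𝒱) ∘ₗ parityConj 𝒱

theorem leftD_apply {k : ℕ} (Φ : Cochain 𝒱 k) (f : Fin (k + 1) → OV 𝒱) :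
    leftD 𝒱 Φ f = evenPart 𝒱 (f 0) * Φ (fun q => f q.succ) +
      oddPart 𝒱 (f 0) * twist 𝒱 1 (Φ fun q => twist 𝒱 1 (f q.succ)) := rfl

theorem innerMul_apply {k : ℕ} (i : Fin k) (Φ : Cochain 𝒱 k) (f : Fin (k + 1) → OV 𝒱) :
    innerMul 𝒱 i Φ f = Φ (mulAt i f) := rfl

theorem rightMul_apply {k : ℕ} (Φ : Cochain 𝒱 k) (f : Fin (k + 1) → OV 𝒱) :
    rightMul 𝒱 Φ f = Φ (fun q => f q.castSucc) * f (Fin.last k) := rfl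

theorem mulAt_succ_zero {A : Type*} [Ring A] {k : ℕ} (i : Fin k) (f : Fin (k + 2) → A) :
    mulAt i.succ f 0 = f 0 := by simp [mulAt]

theorem mulAt_succ_succ {A : Type*} [Ring A] {k : ℕ} (i q : Fin k) (f : Fin (k + 2) → A) :
    mulAt i.succ f q.succ = mulAt i (fun r => f r.succ) q := by
  simp only [mulAt, Fin.succ_lt_succ_iff, Fin.succ_inj, Fin.succ_castSucc]

theorem mulAt_zero_zero {A : Type*} [Ring A] {k : ℕ} (f : Fin (k + 2) → A) :
    mulAt 0 f 0 = f 0 * f 1 := by simp [mulAt]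

theorem mulAt_zero_succ {A : Type*} [Ring A] {k : ℕ} (q : Fin k) (f : Fin (k + 2) → A) :
    mulAt 0 f q.succ = f q.succ.succ := by simp [mulAt]

theorem mulAt_last_castSucc {A : Type*} [Ring A] {k : ℕ} (q : Fin k) (f : Fin (k + 2) → A) :
    mulAt (Fin.last k) f q.castSucc = f q.castSucc.castSucc := by
  simp [mulAt, Fin.castSucc_lt_last]

theorem mulAt_last_last {A : Type*} [Ring A] {k : ℕ} (f : Fin (k + 2) → A) :
    mulAt (Fin.last k) f (Fin.last k) = f (Fin.last k).castSucc * f (Fin.last (k + 1)) := by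
  simp [mulAt]

theorem mulAt_castSucc_castSucc {A : Type*} [Ring A] {k : ℕ} (i q : Fin k) (f : Fin (k + 2) → A) :
    mulAt i.castSucc f q.castSucc = mulAt i (fun r => f r.castSucc) q := by
  simp only [mulAt, Fin.castSucc_lt_castSucc_iff, Fin.castSucc_inj, Fin.succ_castSucc]

theorem mulAt_castSucc_last {A : Type*} [Ring A] {k : ℕ} (i : Fin k) (f : Fin (k + 2) → A) :
    mulAt i.castSucc f (Fin.last k) = f (Fin.last (k + 1)) := by
  simp [mulAt, (Fin.castSucc_lt_last i).not_gt, (Fin.castSucc_lt_last i).ne']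

theorem mulAt_map {A : Type*} [Ring A] (t : A →+* A) {k : ℕ} (i q : Fin k) (f : Fin (k + 1) → A) :
    mulAt i (fun r => t (f r)) q = t (mulAt i f q) := by
  simp only [mulAt]
  split_ifs <;> simp

theorem innerMul_innerMul {k : ℕ} {i j : Fin k} (h : i ≤ j) (Φ : Cochain 𝒱 k) :
    innerMul 𝒱 j.succ (innerMul 𝒱 i Φ) = innerMul 𝒱 i.castSucc (innerMul 𝒱 j Φ) := by
  ext f
  simp only [innerMul_apply]
  congr 1
  funext q
  have h' : (i : ℕ) ≤ j := h
  simp only [mulAt, Fin.lt_def, Fin.ext_iff, Fin.val_castSucc, Fin.val_succ]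
  rcases lt_trichotomy (q : ℕ) i with h1 | h1 | h1 <;>
    rcases lt_trichotomy (q : ℕ) j with h2 | h2 | h2 <;>
    first
      | omega
      | (simp [h1, h2, h1.not_gt, h2.not_gt, h1.ne', h2.ne']; done)
      | grind [mul_assoc]

/-- Associativity at the left end, with the parity of f_0 f_1 split into the parities of its two
factors. -/
theorem innerMul_zero_leftD [CharZero K] {k : ℕ} (Φ : Cochain 𝒱 k) :
    innerMul 𝒱 0 (leftD 𝒱 Φ) = leftD 𝒱 (leftD 𝒱 Φ) := by
  ext f
  simp only [innerMul_apply, leftD_apply, mulAt_zero_zero, mulAt_zero_succ, evenPart_mul,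
    oddPart_mul, evenPart_twist, oddPart_twist, map_add, map_mul, map_smul, twist_self,
    twist_evenPart, twist_oddPart]
  have h1 : sgn K 1 = -1 := by simp [sgn]
  simp only [h1, Fin.succ_zero_eq_one, neg_one_smul, neg_neg]
  noncomm_ring

theorem innerMul_succ_leftD {k : ℕ} (i : Fin k) (Φ : Cochain 𝒱 k) :
    innerMul 𝒱 i.succ (leftD 𝒱 Φ) = leftD 𝒱 (innerMul 𝒱 i Φ) := by
  ext f
  simp only [innerMul_apply, leftD_apply, mulAt_succ_zero, mulAt_succ_succ]
  congr 4
  funext q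
  exact (mulAt_map (twist 𝒱 1 : OV 𝒱 →+* OV 𝒱) i q fun r => f r.succ).symm

theorem rightMul_leftD {k : ℕ} (Φ : Cochain 𝒱 k) :
    rightMul 𝒱 (leftD 𝒱 Φ) = leftD 𝒱 (rightMul 𝒱 Φ) := by
  ext f
  simp only [rightMul_apply, leftD_apply, map_mul, twist_self, add_mul, mul_assoc]
  rfl

theorem innerMul_castSucc_rightMul {k : ℕ} (i : Fin k) (Φ : Cochain 𝒱 k) :
    innerMul 𝒱 i.castSucc (rightMul 𝒱 Φ) = rightMul 𝒱 (innerMul 𝒱 i Φ) := by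
  ext f
  simp only [innerMul_apply, rightMul_apply, mulAt_castSucc_castSucc, mulAt_castSucc_last]

theorem innerMul_last_rightMul {k : ℕ} (Φ : Cochain 𝒱 k) :
    innerMul 𝒱 (Fin.last k) (rightMul 𝒱 Φ) = rightMul 𝒱 (rightMul 𝒱 Φ) := by
  ext f
  simp only [innerMul_apply, rightMul_apply, mulAt_last_castSucc, mulAt_last_last, mul_assoc]

theorem hochDiff_apply {k : ℕ} (Φ : Cochain 𝒱 k) : hochDiff 𝒱 k Φ =
    -leftD 𝒱 Φ + ∑ i : Fin k, (-1 : K) ^ (i : ℕ) • innerMul 𝒱 i Φ +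
      (-1 : K) ^ k • rightMul 𝒱 Φ := by
  rw [hochDiff]
  simp only [LinearMap.add_apply, LinearMap.neg_apply, LinearMap.sum_apply, LinearMap.smul_apply]
  rfl

/-- The summands behave like the cofaces of a cosimplicial object. The inner ones cancel among
themselves by `alternating_sum_fin`; the two ends are matched by `hL` and `hR` with what the inner
terms leave over, and the mixed terms commute. -/
theorem hochDiff_hochDiff [CharZero K] {k : ℕ} (Φ : Cochain 𝒱 k) :
    hochDiff 𝒱 (k + 1) (hochDiff 𝒱 k Φ) = 0 := by
  have hL : ∑ j : Fin (k + 1), (-1 : K) ^ (j : ℕ) • innerMul 𝒱 j (leftD 𝒱 Φ) =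
      leftD 𝒱 (leftD 𝒱 Φ) - ∑ i : Fin k, (-1 : K) ^ (i : ℕ) • leftD 𝒱 (innerMul 𝒱 i Φ) := by
    rw [Fin.sum_univ_succ, innerMul_zero_leftD, sub_eq_add_neg, ← Finset.sum_neg_distrib]
    simp only [Fin.val_zero, pow_zero, one_smul, Fin.val_succ, pow_succ, mul_neg, mul_one,
      cochain_neg_smul, innerMul_succ_leftD]
  have hR : ∑ j : Fin (k + 1), (-1 : K) ^ (j : ℕ) • innerMul 𝒱 j (rightMul 𝒱 Φ) =
      ∑ i : Fin k, (-1 : K) ^ (i : ℕ) • rightMul 𝒱 (innerMul 𝒱 i Φ) +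
        (-1 : K) ^ k • rightMul 𝒱 (rightMul 𝒱 Φ) := by
    rw [Fin.sum_univ_castSucc, innerMul_last_rightMul]
    simp only [innerMul_castSucc_rightMul, Fin.val_castSucc, Fin.val_last]
  have hI : ∑ j : Fin (k + 1), (-1 : K) ^ (j : ℕ) •
      innerMul 𝒱 j (∑ i : Fin k, (-1 : K) ^ (i : ℕ) • innerMul 𝒱 i Φ) = 0 := by
    have h := alternating_sum_fin (K := K) (fun (i : Fin k) (j : Fin (k + 1)) =>
      innerMul 𝒱 j (innerMul 𝒱 i Φ)) fun i j hij => innerMul_innerMul 𝒱 hij Φ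
    rw [Finset.sum_comm] at h
    rw [← h]
    refine Finset.sum_congr rfl fun j _ => ?_
    rw [map_sum, Finset.smul_sum]
    refine Finset.sum_congr rfl fun i _ => ?_
    rw [map_smul, smul_smul, mul_comm]
  have hI' : ∑ j : Fin (k + 1), (-1 : K) ^ (j : ℕ) • innerMul 𝒱 j (hochDiff 𝒱 k Φ) =
      -(∑ j : Fin (k + 1), (-1 : K) ^ (j : ℕ) • innerMul 𝒱 j (leftD 𝒱 Φ)) +
        (-1 : K) ^ k • ∑ j : Fin (k + 1), (-1 : K) ^ (j : ℕ) • innerMul 𝒱 j (rightMul 𝒱 Φ) := by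
    rw [← add_zero (-∑ j : Fin (k + 1), _), ← hI, ← Finset.sum_neg_distrib, ← Finset.sum_add_distrib,
      Finset.smul_sum, ← Finset.sum_add_distrib]
    refine Finset.sum_congr rfl fun j _ => ?_
    rw [hochDiff_apply, map_add, map_add, map_neg, map_smul, smul_add, smul_add, smul_neg,
      smul_comm]
  have hLS : leftD 𝒱 (∑ i : Fin k, (-1 : K) ^ (i : ℕ) • innerMul 𝒱 i Φ) =
      ∑ i : Fin k, (-1 : K) ^ (i : ℕ) • leftD 𝒱 (innerMul 𝒱 i Φ) := by
    simp only [map_sum, map_smul]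
  have hRS : rightMul 𝒱 (∑ i : Fin k, (-1 : K) ^ (i : ℕ) • innerMul 𝒱 i Φ) =
      ∑ i : Fin k, (-1 : K) ^ (i : ℕ) • rightMul 𝒱 (innerMul 𝒱 i Φ) := by
    simp only [map_sum, map_smul]
  rw [hochDiff_apply, hI', hL, hR, hochDiff_apply, map_add, map_add, map_add, map_add, hLS, hRS,
    map_neg, map_neg, map_smul, map_smul, rightMul_leftD, pow_succ, mul_neg_one, cochain_neg_smul]
  generalize (∑ i : Fin k, (-1 : K) ^ (i : ℕ) • leftD 𝒱 (innerMul 𝒱 i Φ)) = A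
  generalize (∑ i : Fin k, (-1 : K) ^ (i : ℕ) • rightMul 𝒱 (innerMul 𝒱 i Φ)) = B
  generalize (-1 : K) ^ k = c
  simp only [smul_add, smul_neg]
  abel

end Graded

/-! ### Transport of sums over words. -/

section Fock

variable {K : Type u} [Field K] {L L' : Type*} [Fintype L] [Fintype L'] [DecidableEq L]
  {C C' : Type*} [AddCommGroup C] [Module K C] [AddCommGroup C'] [Module K C']

/-- A map that intertwines creation operators along a partial map `π` of the letters. -/
theorem map_wordSum {I : C →ₗ[K] C'} {Cr : L → Module.End K C} {Cr' : L' → Module.End K C'}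
    (c : L' → Prop) [DecidablePred c] (π : L' → L)
    (hI : ∀ x v, I (Cr x v) = ∑ y, if c y ∧ π y = x then Cr' y (I v) else 0) (m : ℕ)
    (G : List L → K) (v : C) :
    I (wordSum Cr m G v) =
      wordSum Cr' m (fun l => if ∀ y ∈ l, c y then G (l.map π) else 0) (I v) := by
  induction m generalizing G with
  | zero => simp [wordSum_zero]
  | succ m ih =>
    rw [wordSum_succ, wordSum_succ, map_sum]
    simp only [hI, ih]
    rw [Finset.sum_comm]
    refine Finset.sum_congr rfl fun y _ => ?_
    by_cases hy : c y
    · simp [hy]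
    · have h : (fun l : List L' => if ∀ z ∈ y :: l, c z then G ((y :: l).map π) else 0) =
          fun l => (0 : K) * 0 := by
        funext l
        simp [hy]
      rw [h, wordSum_smul, zero_smul, map_zero]
      simp [hy]

end Fock

/-! ### The Hochschild differential on words of derivatives. -/

section Graded

variable {K : Type u} [Field K] {V : Type v} [AddCommGroup V] [Module K V]
  (𝒱 : ℤ → Submodule K V) [DirectSum.Decomposition 𝒱]

/-- The slot at `j.succ` twists f_0 as well, which puts a sign on its odd part only; that is the
sign which `T` acquires in the parity conjugate of Φ. -/
theorem leftD_slot {k : ℕ} (j : Fin k) {d : ℤ} {T : Module.End K (OV 𝒱)} (hT : HasParity 𝒱 d T)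
    (Φ : Cochain 𝒱 k) : leftD 𝒱 (slot 𝒱 j d T Φ) = slot 𝒱 j.succ d T (leftD 𝒱 Φ) := by
  ext f
  simp only [leftD_apply, slot_apply, Fin.succ_pos, if_true, evenPart_twist, oddPart_twist,
    Fin.succ_lt_succ_iff, Fin.succ_inj]
  congr 1
  rw [smul_mul_assoc, ← mul_smul_comm, ← map_smul]
  congr 2
  refine cochain_eq_smul 𝒱 Φ j _ ?_ fun q hq => ?_
  · simp only [lt_irrefl, if_false, if_true]
    rw [hT 1, smul_smul, one_mul, sgn_mul_self, one_smul]
  · simp only [hq, if_false]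
    split_ifs
    · exact twist_comm 𝒱 d 1 _
    · rfl

theorem rightMul_slot {k : ℕ} (j : Fin k) (d : ℤ) (T : Module.End K (OV 𝒱)) (Φ : Cochain 𝒱 k) :
    rightMul 𝒱 (slot 𝒱 j d T Φ) = slot 𝒱 j.castSucc d T (rightMul 𝒱 Φ) := by
  ext f
  simp only [rightMul_apply, slot_apply, Fin.castSucc_lt_castSucc_iff, Fin.castSucc_inj,
    (Fin.castSucc_lt_last j).not_gt, (Fin.castSucc_lt_last j).ne', if_false]

theorem innerMul_slot_of_lt {k : ℕ} {i j : Fin k} (h : j < i) (d : ℤ) (T : Module.End K (OV 𝒱))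
    (Φ : Cochain 𝒱 k) :
    innerMul 𝒱 i (slot 𝒱 j d T Φ) = slot 𝒱 j.castSucc d T (innerMul 𝒱 i Φ) := by
  ext f
  simp only [innerMul_apply, slot_apply]
  congr 1
  funext q
  have h' : (j : ℕ) < i := h
  simp only [mulAt, Fin.lt_def, Fin.ext_iff, Fin.val_castSucc, Fin.val_succ]
  rcases lt_trichotomy (q : ℕ) j with h1 | h1 | h1
  · simp [h1, h1.trans h']
  · simp [h1, h']
  · have h2 : ¬ (q : ℕ) + 1 < j := by omega
    have h3 : ¬ (q : ℕ) + 1 = j := by omega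
    simp [h1.not_gt, h1.ne', h2, h3]

theorem innerMul_slot_of_gt {k : ℕ} {i j : Fin k} (h : i < j) (d : ℤ) (T : Module.End K (OV 𝒱))
    (Φ : Cochain 𝒱 k) :
    innerMul 𝒱 i (slot 𝒱 j d T Φ) = slot 𝒱 j.succ d T (innerMul 𝒱 i Φ) := by
  ext f
  simp only [innerMul_apply, slot_apply]
  congr 1
  funext q
  have h' : (i : ℕ) < j := h
  simp only [mulAt, Fin.lt_def, Fin.ext_iff, Fin.val_castSucc, Fin.val_succ]
  rcases lt_trichotomy (q : ℕ) j with h1 | h1 | h1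
  · have h2 : (q : ℕ) < j + 1 := by omega
    simp only [h1, h2, add_lt_add_iff_right, if_true]
    split_ifs <;> simp
  · simp [h1, h'.not_gt, h'.ne']
  · have h2 : ¬ (q : ℕ) < j + 1 := by omega
    have h4 : ¬ (q : ℕ) < i := by omega
    have h5 : ¬ (q : ℕ) = i := by omega
    simp [h1.not_gt, h1.ne', h4, h5]

/-- The Leibniz rule on f_i f_{i+1}. Its twist of the first factor is precisely the Koszul sign
built into the slot at `i.succ`. -/
theorem innerMul_slot_self {k : ℕ} (i : Fin k) (d : ℤ) (w : 𝒱 d) (Φ : Cochain 𝒱 k) :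
    innerMul 𝒱 i (slot 𝒱 i d (partialD 𝒱 d w) Φ) =
      slot 𝒱 i.castSucc d (partialD 𝒱 d w) (innerMul 𝒱 i Φ) +
        slot 𝒱 i.succ d (partialD 𝒱 d w) (innerMul 𝒱 i Φ) := by
  ext f
  rw [_root_.add_apply]
  simp only [innerMul_apply, slot_apply]
  refine cochain_eq_add 𝒱 Φ i ?_ (fun q hq => ?_) fun q hq => ?_
  · have h1 : ¬ i.succ < i.castSucc := (Fin.castSucc_lt_succ (i := i)).not_gt
    have h2 : i.succ ≠ i.castSucc := (Fin.castSucc_lt_succ (i := i)).ne'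
    simp [mulAt, partialD_mul, h1, h2]
  · have hq' : (q : ℕ) ≠ i := fun h => hq (Fin.ext h)
    simp only [mulAt, Fin.lt_def, Fin.ext_iff, Fin.val_castSucc, Fin.val_succ]
    rcases lt_or_gt_of_ne hq' with h1 | h1
    · simp [h1]
    · have h2 : ¬ (q : ℕ) + 1 < i := by omega
      have h3 : ¬ (q : ℕ) + 1 = i := by omega
      simp [h1.not_gt, hq', h2, h3]
  · have hq' : (q : ℕ) ≠ i := fun h => hq (Fin.ext h)
    simp only [mulAt, Fin.lt_def, Fin.ext_iff, Fin.val_castSucc, Fin.val_succ]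
    rcases lt_or_gt_of_ne hq' with h1 | h1
    · have h2 : (q : ℕ) < i + 1 := by omega
      simp [h1, h2]
    · simp [h1.not_gt, hq']

theorem prod_ofFn_mulAt {A : Type*} [Ring A] {k : ℕ} (i : Fin k) (f : Fin (k + 1) → A) :
    (List.ofFn (mulAt i f)).prod = (List.ofFn f).prod := by
  induction k with
  | zero => exact i.elim0
  | succ k ih =>
    induction i using Fin.cases with
    | zero =>
      rw [List.ofFn_succ, List.ofFn_succ (f := f), List.ofFn_succ (f := fun q => f q.succ)]
      simp only [mulAt_zero_zero, mulAt_zero_succ, List.prod_cons, mul_assoc]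
      rfl
    | succ i =>
      rw [List.ofFn_succ, List.ofFn_succ (f := f)]
      simp only [mulAt_succ_zero, mulAt_succ_succ, List.prod_cons]
      congr 1
      exact ih i fun r => f r.succ

theorem innerMul_prodOp {k : ℕ} (i : Fin k) (a : OV 𝒱) :
    innerMul 𝒱 i (prodOp 𝒱 a) = prodOp 𝒱 a := by
  ext f
  rw [innerMul_apply, prodOp_apply, prodOp_apply, prod_ofFn_mulAt]

theorem rightMul_prodOp {k : ℕ} (a : OV 𝒱) :
    rightMul 𝒱 (prodOp 𝒱 a : Cochain 𝒱 k) = prodOp 𝒱 a := by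
  ext f
  rw [rightMul_apply, prodOp_apply, prodOp_apply, List.ofFn_succ', List.concat_eq_append,
    List.prod_append, List.prod_singleton, mul_assoc]

variable {ι : Type*} [Fintype ι] [DecidableEq ι] (b : Module.Basis ι K V) {deg : ι → ℤ}
  (hdeg : ∀ α, b α ∈ 𝒱 (deg α))

include b hdeg in
theorem leftD_prodOp [CharZero K] {k : ℕ} (a : OV 𝒱) :
    leftD 𝒱 (prodOp 𝒱 a : Cochain 𝒱 k) = prodOp 𝒱 a := by
  ext f
  have h1 := prod_ofFn_map ((twist 𝒱 1 : OV 𝒱 →ₐ[K] OV 𝒱) : OV 𝒱 →* OV 𝒱)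
    fun q : Fin k => f q.succ
  simp only [MonoidHom.coe_coe] at h1
  obtain ⟨h2, h3⟩ := evenPart_oddPart_comm 𝒱 b hdeg (f 0)
  rw [leftD_apply, prodOp_apply, prodOp_apply, prodOp_apply, h1, map_mul, twist_self, ← mul_assoc,
    ← mul_assoc, h2, h3, ← add_mul, ← mul_add, evenPart_add_oddPart, List.ofFn_succ,
    List.prod_cons, mul_assoc]

/-- The effect of a map of positions on letters. -/
def relabel {k k' : ℕ} (π : Fin k' → Fin k) (x : Fin k' × ι) : Fin k × ι := (π x.1, x.2)

/-- The sum has one nonzero term, at the shifted position. It is written as a sum over a fibre of a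
codegeneracy to fit `map_wordSum` together with the other summands of d_H. -/
theorem leftD_createB {p : ℕ} (x : Fin (p + 1) × ι) (Φ : Cochain 𝒱 (p + 1)) :
    leftD 𝒱 (createB 𝒱 b hdeg x Φ) = ∑ y : Fin (p + 2) × ι,
      if y.1 ≠ 0 ∧ relabel (Fin.predAbove 0) y = x then createB 𝒱 b hdeg y (leftD 𝒱 Φ)
        else 0 := by
  obtain ⟨j, α⟩ := x
  rw [Finset.sum_eq_single_of_mem (j.succ, α) (Finset.mem_univ _)]
  · rw [if_pos ⟨Fin.succ_ne_zero j, by simp [relabel]⟩]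
    exact leftD_slot 𝒱 j (hasParity_partialD 𝒱 _ _) Φ
  · rintro ⟨q, β⟩ _ hne
    refine if_neg ?_
    rintro ⟨h1, h2⟩
    obtain ⟨q, rfl⟩ := Fin.exists_succ_eq.2 h1
    simp only [relabel, Prod.mk.injEq, Fin.predAbove_zero_succ] at h2
    exact hne (by rw [h2.1, h2.2])

theorem rightMul_createB {p : ℕ} (x : Fin (p + 1) × ι) (Φ : Cochain 𝒱 (p + 1)) :
    rightMul 𝒱 (createB 𝒱 b hdeg x Φ) = ∑ y : Fin (p + 2) × ι,
      if y.1 ≠ Fin.last (p + 1) ∧ relabel (Fin.predAbove (Fin.last p)) y = x then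
        createB 𝒱 b hdeg y (rightMul 𝒱 Φ) else 0 := by
  obtain ⟨j, α⟩ := x
  rw [Finset.sum_eq_single_of_mem (j.castSucc, α) (Finset.mem_univ _)]
  · rw [if_pos ⟨(Fin.castSucc_lt_last j).ne, by simp [relabel]⟩]
    exact rightMul_slot 𝒱 j _ _ Φ
  · rintro ⟨q, β⟩ _ hne
    refine if_neg ?_
    rintro ⟨h1, h2⟩
    obtain ⟨q, rfl⟩ := Fin.exists_castSucc_eq.2 h1
    simp only [relabel, Prod.mk.injEq, Fin.predAbove_last_castSucc] at h2
    exact hne (by rw [h2.1, h2.2])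

/-- The i-th codegeneracy has two points over i, matching the two Leibniz terms, and one point over
any other position. -/
theorem innerMul_createB {k : ℕ} (i : Fin k) (x : Fin k × ι) (Φ : Cochain 𝒱 k) :
    innerMul 𝒱 i (createB 𝒱 b hdeg x Φ) = ∑ y : Fin (k + 1) × ι,
      if True ∧ relabel i.predAbove y = x then createB 𝒱 b hdeg y (innerMul 𝒱 i Φ) else 0 := by
  obtain ⟨j, α⟩ := x
  simp only [true_and]
  rw [← Finset.sum_filter]
  rcases lt_trichotomy j i with h | h | h
  · have h1 : Finset.univ.filter (fun y : Fin (k + 1) × ι => relabel i.predAbove y = (j, α)) =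
        {(j.castSucc, α)} := by
      ext ⟨q, β⟩
      have h' : (j : ℕ) < i := h
      simp only [relabel, Finset.mem_filter, Finset.mem_univ, true_and, Finset.mem_singleton,
        Prod.mk.injEq, Fin.ext_iff, predAbove_val, Fin.val_castSucc]
      grind
    rw [h1, Finset.sum_singleton]
    exact innerMul_slot_of_lt 𝒱 h _ _ Φ
  · subst h
    have h1 : Finset.univ.filter (fun y : Fin (k + 1) × ι => relabel j.predAbove y = (j, α)) =
        {(j.castSucc, α), (j.succ, α)} := by
      ext ⟨q, β⟩
      simp only [relabel, Finset.mem_filter, Finset.mem_univ, true_and, Finset.mem_singleton,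
        Finset.mem_insert, Prod.mk.injEq, Fin.ext_iff, predAbove_val, Fin.val_castSucc,
        Fin.val_succ]
      grind
    rw [h1, Finset.sum_pair (by simp [Fin.ext_iff])]
    exact innerMul_slot_self 𝒱 j _ _ Φ
  · have h1 : Finset.univ.filter (fun y : Fin (k + 1) × ι => relabel i.predAbove y = (j, α)) =
        {(j.succ, α)} := by
      ext ⟨q, β⟩
      have h' : (i : ℕ) < j := h
      simp only [relabel, Finset.mem_filter, Finset.mem_univ, true_and, Finset.mem_singleton,
        Prod.mk.injEq, Fin.ext_iff, predAbove_val, Fin.val_succ]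
      grind
    rw [h1, Finset.sum_singleton]
    exact innerMul_slot_of_gt 𝒱 h _ _ Φ

/-! ### The differential of representations on coefficients -/

variable {p : ℕ}

theorem coeff_repDiff (ρ : RepFin 𝒱 p) {l : List (Fin (p + 2) × ι)} (w : List ι)
    (hl : ∀ q, ∃ x ∈ l, x.1 = q) : coeff 𝒱 b (repDiff 𝒱 p ρ) l w =
      ∑ i : Fin (p + 1), (-1 : K) ^ (i : ℕ) * coeff 𝒱 b ρ (l.map (relabel i.predAbove)) w := by
  obtain ⟨m, Λ, rfl⟩ := exists_eq_ofFn l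
  obtain ⟨n, J, rfl⟩ := exists_eq_ofFn w
  have hs : Function.Surjective fun i => (Λ i).1 := by
    intro q
    obtain ⟨x, hx, rfl⟩ := hl q
    obtain ⟨i, rfl⟩ := (List.mem_ofFn' _ _).1 hx
    exact ⟨i, rfl⟩
  rw [coeff_ofFn, coeffFun, dif_pos hs]
  change tensorCoeff b _ (ρ.1 m n (genDiff K m p (Finsupp.single _ 1)) _) = _
  simp only [genDiff, LinearMap.sum_apply, LinearMap.smul_apply, Finsupp.lmapDomain_apply,
    Finsupp.mapDomain_single, map_sum, map_smul, smul_eq_mul]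
  refine Finset.sum_congr rfl fun i _ => ?_
  rw [List.map_ofFn, coeff_ofFn]
  congr 1
  exact (coeffFun_of_surjective 𝒱 b ρ (OrdPart.merge i ⟨_, hs⟩) (fun i => (Λ i).2) J).symm

/-- If the word misses two positions, each relabelled word misses one and every term is zero. If it
misses only q, the terms left are those that merge q with a neighbour, or drop q at an end. There
are two of them, with the same relabelled word and opposite signs. -/
theorem sum_codegeneracies (G : List (Fin (p + 1) × ι) → K)
    (hG : ∀ l, (∃ j, ∀ x ∈ l, x.1 ≠ j) → G l = 0) {l : List (Fin (p + 2) × ι)} {q : Fin (p + 2)}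
    (hq : ∀ x ∈ l, x.1 ≠ q) :
    -(if ∀ x ∈ l, x.1 ≠ 0 then G (l.map (relabel (Fin.predAbove 0))) else 0) +
      ∑ i : Fin (p + 1), (-1 : K) ^ (i : ℕ) * G (l.map (relabel i.predAbove)) +
      (-1 : K) ^ (p + 1) * (if ∀ x ∈ l, x.1 ≠ Fin.last (p + 1) then
        G (l.map (relabel (Fin.predAbove (Fin.last p)))) else 0) = 0 := by
  have hmap : ∀ (i : Fin (p + 1)) (j : Fin (p + 1)),
      (∀ x ∈ l, i.predAbove x.1 ≠ j) → G (l.map (relabel i.predAbove)) = 0 := by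
    intro i j h
    refine hG _ ⟨j, fun y hy => ?_⟩
    obtain ⟨x, hx, rfl⟩ := List.mem_map.1 hy
    exact h x hx
  by_cases h2 : ∃ q', q' ≠ q ∧ ∀ x ∈ l, x.1 ≠ q'
  · obtain ⟨q', hne, hq'⟩ := h2
    have h0 : ∀ i : Fin (p + 1), G (l.map (relabel i.predAbove)) = 0 := by
      intro i
      have hne' : (q' : ℕ) ≠ q := fun h => hne (Fin.ext h)
      -- If the fibre {i, i + 1} consists of the two missing positions, then i is missed after
      -- relabelling. Otherwise a missing position outside that fibre is alone in its own fibre.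
      by_cases h : (q : ℕ) = i ∨ (q : ℕ) = i + 1
      · by_cases h' : (q' : ℕ) = i ∨ (q' : ℕ) = i + 1
        · refine hmap i i fun x hx he => ?_
          have h3 : (x.1 : ℕ) ≠ q := fun h => hq x hx (Fin.ext h)
          have h4 : (x.1 : ℕ) ≠ q' := fun h => hq' x hx (Fin.ext h)
          rw [Fin.ext_iff, predAbove_val] at he
          split_ifs at he <;> omega
        · refine hmap i (i.predAbove q') fun x hx he => ?_
          have h4 : (x.1 : ℕ) ≠ q' := fun h => hq' x hx (Fin.ext h)
          rw [Fin.ext_iff, predAbove_val, predAbove_val] at he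
          split_ifs at he <;> omega
      · refine hmap i (i.predAbove q) fun x hx he => ?_
        have h4 : (x.1 : ℕ) ≠ q := fun h => hq x hx (Fin.ext h)
        rw [Fin.ext_iff, predAbove_val, predAbove_val] at he
        split_ifs at he <;> omega
    simp [h0]
  · push Not at h2
    have hiff : ∀ q', (∀ x ∈ l, x.1 ≠ q') ↔ q' = q := by
      intro q'
      constructor
      · intro h
        by_contra hne
        obtain ⟨x, hx, h3⟩ := h2 q' hne
        exact h x hx h3
      · rintro rfl
        exact hq
    let g := G (l.map (relabel (Fin.predAbove 0 q).predAbove))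
    have hg : ∀ i : Fin (p + 1), (q : ℕ) = i ∨ (q : ℕ) = i + 1 →
        G (l.map (relabel i.predAbove)) = g := by
      intro i hi
      simp only [g]
      congr 1
      refine List.map_congr_left fun x hx => ?_
      have h3 : (x.1 : ℕ) ≠ q := fun h => hq x hx (Fin.ext h)
      simp only [relabel, Prod.mk.injEq, Fin.ext_iff, predAbove_val, and_true, Fin.val_zero]
      grind
    -- Only i = q and i = q - 1 contribute. Written as a difference, the sum telescopes, once the
    -- sum over all positions is split at its last and at its first term.
    have h1 : ∀ i : Fin (p + 1), (-1 : K) ^ (i : ℕ) * G (l.map (relabel i.predAbove)) =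
        (if i.castSucc = q then (-1 : K) ^ (i.castSucc : ℕ) * g else 0) -
          (if i.succ = q then (-1 : K) ^ (i.succ : ℕ) * g else 0) := by
      intro i
      simp only [Fin.ext_iff, Fin.val_castSucc, Fin.val_succ]
      by_cases h3 : (i : ℕ) = q
      · have h4 : ¬ (i : ℕ) + 1 = q := by omega
        rw [if_pos h3, if_neg h4, hg i (Or.inl h3.symm), sub_zero]
      · by_cases h4 : (i : ℕ) + 1 = q
        · rw [if_neg h3, if_pos h4, hg i (Or.inr h4.symm), pow_succ]
          ring
        · rw [if_neg h3, if_neg h4, sub_zero, hmap i (i.predAbove q), mul_zero]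
          intro x hx he
          have h5 : (x.1 : ℕ) ≠ q := fun h => hq x hx (Fin.ext h)
          rw [Fin.ext_iff, predAbove_val, predAbove_val] at he
          split_ifs at he <;> omega
    have h3 := Fin.sum_univ_castSucc fun r : Fin (p + 2) =>
      if r = q then (-1 : K) ^ (r : ℕ) * g else 0
    have h4 := Fin.sum_univ_succ fun r : Fin (p + 2) =>
      if r = q then (-1 : K) ^ (r : ℕ) * g else 0
    simp only [hiff, h1, Finset.sum_sub_distrib]
    have h5 : (if (0 : Fin (p + 2)) = q then G (l.map (relabel (Fin.predAbove 0))) else 0) =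
        if (0 : Fin (p + 2)) = q then (-1 : K) ^ ((0 : Fin (p + 2)) : ℕ) * g else 0 := by
      split_ifs with h
      · rw [hg 0 (Or.inl (by rw [← h]; rfl)), Fin.val_zero, pow_zero, one_mul]
      · rfl
    have h6 : (-1 : K) ^ (p + 1) * (if Fin.last (p + 1) = q then
        G (l.map (relabel (Fin.predAbove (Fin.last p)))) else 0) =
        if Fin.last (p + 1) = q then (-1 : K) ^ ((Fin.last (p + 1)) : ℕ) * g else 0 := by
      split_ifs with h
      · rw [hg (Fin.last p) (Or.inr (by rw [← h]; rfl)), Fin.val_last]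
      · rw [mul_zero]
    rw [h5, h6]
    linear_combination h4 - h3

/-- The outer terms vanish on words that use all positions, and both sides vanish on the other
words. This gives δ the shape of d_H uniformly in the word. -/
theorem coeff_repDiff_eq (ρ : RepFin 𝒱 p) (l : List (Fin (p + 2) × ι)) (w : List ι) :
    coeff 𝒱 b (repDiff 𝒱 p ρ) l w =
    -(if ∀ x ∈ l, x.1 ≠ 0 then coeff 𝒱 b ρ (l.map (relabel (Fin.predAbove 0))) w else 0) +
      ∑ i : Fin (p + 1), (-1 : K) ^ (i : ℕ) * coeff 𝒱 b ρ (l.map (relabel i.predAbove)) w +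
      (-1 : K) ^ (p + 1) * (if ∀ x ∈ l, x.1 ≠ Fin.last (p + 1) then
        coeff 𝒱 b ρ (l.map (relabel (Fin.predAbove (Fin.last p)))) w else 0) := by
  by_cases h : ∃ q, ∀ x ∈ l, x.1 ≠ q
  · obtain ⟨q, hq⟩ := h
    rw [coeff_of_not_surjective 𝒱 b hq, sum_codegeneracies (fun l => coeff 𝒱 b ρ l w) _ hq]
    rintro l ⟨j, hj⟩
    exact coeff_of_not_surjective 𝒱 b hj
  · push Not at h
    have h0 : ∀ q, ¬ ∀ x ∈ l, x.1 ≠ q := fun q h' => by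
      obtain ⟨x, hx, hxq⟩ := h q
      exact h' x hx hxq
    rw [coeff_repDiff 𝒱 b ρ w h, if_neg (h0 _), if_neg (h0 _), neg_zero, zero_add, mul_zero,
      add_zero]

variable [CharZero K]

theorem symbolPart_repDiff (ρ : RepFin 𝒱 p) (m n : ℕ) :
    symbolPart 𝒱 b deg hdeg (repDiff 𝒱 p ρ) m n =
      hochDiff 𝒱 (p + 1) (symbolPart 𝒱 b deg hdeg ρ m n) := by
  rw [symbolPart_eq_wordSum, symbolPart_eq_wordSum, map_smul, map_sum]
  congr 1
  refine Finset.sum_congr rfl fun J _ => ?_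
  -- Each summand of d_H intertwines creation operators and fixes the vacuum `prodOp`, so all become
  -- sums over the same words and only coefficients remain to be compared.
  rw [hochDiff_apply,
    map_wordSum (fun y : Fin (p + 2) × ι => y.1 ≠ 0) (relabel (Fin.predAbove 0))
      (leftD_createB 𝒱 b hdeg),
    map_wordSum (fun y : Fin (p + 2) × ι => y.1 ≠ Fin.last (p + 1))
      (relabel (Fin.predAbove (Fin.last p))) (rightMul_createB 𝒱 b hdeg),
    Finset.sum_congr rfl fun i _ => by
      rw [map_wordSum (fun _ : Fin (p + 2) × ι => True) (relabel i.predAbove)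
        (innerMul_createB 𝒱 b hdeg i)],
    leftD_prodOp 𝒱 b hdeg, rightMul_prodOp]
  simp only [innerMul_prodOp, ← wordSum_smul]
  simp only [wordSum]
  rw [Finset.sum_comm, ← Finset.sum_neg_distrib, ← Finset.sum_add_distrib,
    ← Finset.sum_add_distrib]
  refine Finset.sum_congr rfl fun Λ _ => ?_
  rw [← Finset.sum_smul, ← cochain_neg_smul, ← add_smul, ← add_smul, coeff_repDiff_eq]
  simp only [List.map_reverse, List.mem_reverse, implies_true, if_true]
  congr!

theorem symbolOp_repDiff (ρ : RepFin 𝒱 p) :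
    symbolOp 𝒱 b deg hdeg (repDiff 𝒱 p ρ) = hochDiff 𝒱 (p + 1) (symbolOp 𝒱 b deg hdeg ρ) := by
  rw [symbolOp_eq_sum 𝒱 b hdeg ρ (s := ρ.2.2.toFinset) fun m n h => by simpa using h,
    symbolOp_eq_sum 𝒱 b hdeg (repDiff 𝒱 p ρ) (s := ρ.2.2.toFinset) fun m n h => ?_, map_sum]
  · exact Finset.sum_congr rfl fun mn _ => symbolPart_repDiff 𝒱 b hdeg ρ mn.1 mn.2
  · simp only [Set.Finite.mem_toFinset, Set.mem_ofPred_eq]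
    intro h0
    refine h ?_
    change ρ.1 m n ∘ₗ genDiff K m p = 0
    rw [h0, LinearMap.zero_comp]

-- Every polydifferential operator is a symbol, and d_H of a symbol is the symbol of δ of the
-- representation.
include b hdeg in
theorem hochDiff_mem_polyDiff {Φ : Cochain 𝒱 (p + 1)} (hΦ : Φ ∈ PolyDiff 𝒱 p) :
    hochDiff 𝒱 (p + 1) Φ ∈ PolyDiff 𝒱 (p + 1) := by
  obtain ⟨ρ, rfl⟩ := polyDiff_le_range 𝒱 b hdeg hΦ
  have h := symbolOp_mem_polyDiff 𝒱 b hdeg (repDiff 𝒱 p ρ)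
  rw [symbolOp_repDiff] at h
  exact h

end Graded

/-! ### Independence of the homogeneous basis. -/

section Products

variable {K : Type u} [Field K] {C : Type*} [AddCommGroup C] [Module K C] {ι : Type*} [Fintype ι]

theorem prod_ofFn_sum {m : ℕ} (κ : Fin m → ι → K) (T : Fin m → ι → Module.End K C) :
    (List.ofFn fun i => ∑ x, κ i x • T i x).prod =
      ∑ A : Fin m → ι, (∏ i, κ i (A i)) • (List.ofFn fun i => T i (A i)).prod := by
  classical
  have h := (MultilinearMap.mkPiAlgebraFin K m (Module.End K C)).map_sum fun i x => κ i x • T i x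
  simp only [MultilinearMap.map_smul_univ, MultilinearMap.mkPiAlgebraFin_apply] at h
  exact h

theorem prod_reverse_ofFn_sum {m : ℕ} (κ : Fin m → ι → K) (T : Fin m → ι → Module.End K C) :
    (List.ofFn fun i => ∑ x, κ i x • T i x).reverse.prod =
      ∑ A : Fin m → ι, (∏ i, κ i (A i)) • (List.ofFn fun i => T i (A i)).reverse.prod := by
  classical
  have h0 : ∀ S : Fin m → Module.End K C,
      (MultilinearMap.mkPiAlgebraFin K m (Module.End K C)).domDomCongr Fin.revPerm S =
        (List.ofFn S).reverse.prod := by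
    intro S
    rw [MultilinearMap.domDomCongr_apply, MultilinearMap.mkPiAlgebraFin_apply]
    congr 1
    refine List.ext_getElem (by simp) fun i h1 h2 => ?_
    simp only [List.getElem_reverse, List.getElem_ofFn, List.length_ofFn, Fin.revPerm_apply]
    congr 1
    ext
    simp only [Fin.rev]
    omega
  have h := ((MultilinearMap.mkPiAlgebraFin K m (Module.End K C)).domDomCongr
    Fin.revPerm).map_sum fun i x => κ i x • T i x
  simp only [MultilinearMap.map_smul_univ] at h
  simp only [h0] at h
  exact h

theorem sum_smul_sub_sum_smul (c : ι → K) (x y : ι → C) :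
    ∑ i, c i • x i - ∑ i, c i • y i = ∑ i, c i • (x i - y i) := by
  simp only [smul_sub, Finset.sum_sub_distrib]

end Products

section BasisChange

variable {K : Type u} [Field K] {V : Type v} [AddCommGroup V] [Module K V]
  (𝒱 : ℤ → Submodule K V) [DirectSum.Decomposition 𝒱]
  {ι ι' : Type*} [Fintype ι] [DecidableEq ι] [Fintype ι'] [DecidableEq ι']
  (b : Module.Basis ι K V) {deg : ι → ℤ} (hdeg : ∀ α, b α ∈ 𝒱 (deg α))
  (b' : Module.Basis ι' K V) {deg' : ι' → ℤ} (hdeg' : ∀ α, b' α ∈ 𝒱 (deg' α))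

theorem contract_sum {k : ℕ} (j : Fin k) (d : ℤ) (c : ι → K) (ξ : ι → Module.Dual K V) :
    contract 𝒱 j d (∑ α, c α • ξ α) = ∑ α, c α • contract 𝒱 j d (ξ α) := by
  have h1 : LinearMap.mulLeft K (coord 𝒱 (∑ α, c α • ξ α)) =
      ∑ α, c α • (LinearMap.mulLeft K (coord 𝒱 (ξ α)) : Module.End K (OV 𝒱)) := by
    ext f
    simp [Finset.sum_mul]
  have h2 : (conjMul 𝒱 d (∑ α, c α • ξ α) : Module.End K (Cochain 𝒱 k)) =
      ∑ α, c α • conjMul 𝒱 d (ξ α) := by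
    ext Φ f
    simp [conjMul_apply, Finset.sum_mul, LinearMap.sum_apply]
  rw [contract, h1, h2, slot_sum]
  simp only [slot_smul]
  exact sum_smul_sub_sum_smul (C := Module.End K (Cochain 𝒱 k)) c _ _

include hdeg hdeg' in
theorem annihB_basis_change {k : ℕ} (j : Fin k) (α' : ι') : annihB 𝒱 b' deg' (j, α') =
    ∑ α, b'.coord α' (b α) • annihB 𝒱 b deg (j, α) := by
  have h1 : b'.coord α' = ∑ α, b'.coord α' (b α) • b.coord α := by
    refine b.ext fun β => ?_
    simp [Finsupp.single_apply]
  rw [annihB]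
  conv_lhs => rw [h1]
  rw [contract_sum]
  refine Finset.sum_congr rfl fun α _ => ?_
  -- The contraction depends on the degree through its twists; the coefficient vanishes unless the
  -- two degrees coincide.
  by_cases h : deg α = deg' α'
  · rw [annihB, h]
  · rw [basis_coord_of_mem 𝒱 b' hdeg' α' h (hdeg α), zero_smul, zero_smul]

theorem partialB_basis_change (β' : ι') : partialB 𝒱 b' hdeg' β' =
    ∑ β, b.coord β (b' β') • partialB 𝒱 b hdeg β :=
  partialD_eq_sum 𝒱 b hdeg _ _

theorem extract_basis_change {k m n : ℕ} (c : Fin m → Fin k) (A' : Fin m → ι') (J' : Fin n → ι')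
    (Φ : Cochain 𝒱 k) :
    extract 𝒱 b' hdeg' (List.ofFn fun i => (c i, A' i)) (List.ofFn J') Φ =
      ∑ A : Fin m → ι, ∑ J : Fin n → ι,
        ((∏ i, b'.coord (A' i) (b (A i))) * ∏ i, b.coord (J i) (b' (J' i))) *
          extract 𝒱 b hdeg (List.ofFn fun i => (c i, A i)) (List.ofFn J) Φ := by
  have h1 : (opWord (annihB 𝒱 b' deg') (List.ofFn fun i => (c i, A' i)) :
      Module.End K (Cochain 𝒱 k)) = ∑ A : Fin m → ι, (∏ i, b'.coord (A' i) (b (A i))) •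
        opWord (annihB 𝒱 b deg) (List.ofFn fun i => (c i, A i)) := by
    have h := prod_ofFn_sum (fun i α => b'.coord (A' i) (b α))
      fun i α => (annihB 𝒱 b deg (c i, α) : Module.End K (Cochain 𝒱 k))
    simp only [opWord, List.map_ofFn]
    refine Eq.trans ?_ h
    congr 2
    funext i
    exact annihB_basis_change 𝒱 b hdeg b' hdeg' (c i) (A' i)
  have h2 : opWord (partialB 𝒱 b' hdeg') (List.ofFn J').reverse =
      ∑ J : Fin n → ι, (∏ i, b.coord (J i) (b' (J' i))) •
        opWord (partialB 𝒱 b hdeg) (List.ofFn J).reverse := by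
    have h := prod_reverse_ofFn_sum (fun i β => b.coord β (b' (J' i)))
      fun _ β => partialB 𝒱 b hdeg β
    simp only [opWord, List.map_reverse, List.map_ofFn]
    refine Eq.trans ?_ h
    congr 3
    funext i
    exact partialB_basis_change 𝒱 b hdeg b' hdeg' (J' i)
  simp only [extract_apply, h1, h2, LinearMap.sum_apply, LinearMap.smul_apply, map_sum, map_smul,
    smul_eq_mul, Finset.mul_sum, mul_assoc]

variable {p : ℕ}

/-- The matrices are those of `extract_basis_change`, which is what makes the comparison of symbols
possible. -/
theorem coeff_basis_change (ρ : RepFin 𝒱 p) {m n : ℕ} (c : Fin m → Fin (p + 1))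
    (A' : Fin m → ι') (J' : Fin n → ι') :
    coeff 𝒱 b' ρ (List.ofFn fun i => (c i, A' i)) (List.ofFn J') =
      ∑ A : Fin m → ι, ∑ J : Fin n → ι,
        ((∏ i, b'.coord (A' i) (b (A i))) * ∏ i, b.coord (J i) (b' (J' i))) *
          coeff 𝒱 b ρ (List.ofFn fun i => (c i, A i)) (List.ofFn J) := by
  simp only [coeff_ofFn]
  by_cases hc : Function.Surjective c
  · have h1 : PiTensorProduct.tprod K (fun i => b' (J' i)) =
        ∑ J : Fin n → ι, (∏ i, b.coord (J i) (b' (J' i))) •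
          PiTensorProduct.tprod K fun i => b (J i) := by
      simp only [← MultilinearMap.map_smul_univ]
      rw [← MultilinearMap.map_sum (PiTensorProduct.tprod K)
        fun (i : Fin n) β => b.coord β (b' (J' i)) • b β]
      congr 1
      funext i
      exact (b.sum_repr (b' (J' i))).symm
    have h2 : ∀ t : ⨂[K] _ : Fin m, V, tensorCoeff b' A' t =
        ∑ A : Fin m → ι, (∏ i, b'.coord (A' i) (b (A i))) * tensorCoeff b A t := by
      intro t
      conv_lhs => rw [tensor_eq_sum b t]
      simp only [map_sum, map_smul, tensorCoeff_tprod, smul_eq_mul, mul_comm]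
    rw [coeffFun_of_surjective 𝒱 b' ρ ⟨c, hc⟩, h2]
    refine Finset.sum_congr rfl fun A _ => ?_
    rw [h1, map_sum, map_sum, Finset.mul_sum]
    refine Finset.sum_congr rfl fun J _ => ?_
    rw [coeffFun_of_surjective 𝒱 b ρ ⟨c, hc⟩, map_smul, map_smul, smul_eq_mul, mul_assoc]
  · rw [coeffFun, dif_neg hc]
    refine (Finset.sum_eq_zero fun A _ => Finset.sum_eq_zero fun J _ => ?_).symm
    rw [coeffFun, dif_neg hc, mul_zero]

/-- By surjectivity in the second basis, the first symbol is the second symbol of some ρ'.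
Extraction in the second basis shows that ρ' and ρ have the same coefficients, so no direct change
of variables in the formula is needed. -/
theorem symbolOp_basis_change [CharZero K] (ρ : RepFin 𝒱 p) :
    symbolOp 𝒱 b deg hdeg ρ = symbolOp 𝒱 b' deg' hdeg' ρ := by
  obtain ⟨ρ', hρ'⟩ := polyDiff_le_range 𝒱 b' hdeg' (symbolOp_mem_polyDiff 𝒱 b hdeg ρ)
  have h : ρ' = ρ := by
    refine repFin_ext 𝒱 b' fun l w => ?_
    obtain ⟨m, Λ, rfl⟩ := exists_eq_ofFn l
    obtain ⟨n, J', rfl⟩ := exists_eq_ofFn w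
    have h1 := extract_symbolOp 𝒱 b' hdeg' ρ' (List.ofFn Λ) (List.ofFn J')
    have h2 : symbolOp 𝒱 b' deg' hdeg' ρ' = symbolOp 𝒱 b deg hdeg ρ := hρ'
    rw [← h1, h2]
    refine (extract_basis_change 𝒱 b hdeg b' hdeg' (fun i => (Λ i).1) (fun i => (Λ i).2) J'
      _).trans ?_
    simp only [extract_symbolOp]
    exact (coeff_basis_change 𝒱 b b' ρ (fun i => (Λ i).1) (fun i => (Λ i).2) J').symm
  subst h
  exact hρ'.symm

theorem exists_homogeneous_basis [FiniteDimensional K V] : ∃ (N : ℕ) (b : Module.Basis (Fin N) K V)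
    (deg : Fin N → ℤ), ∀ α, b α ∈ 𝒱 (deg α) := by
  classical
  let B := (DirectSum.Decomposition.isInternal 𝒱).collectedBasis
    fun e => Module.Basis.ofVectorSpace K (𝒱 e)
  have : Finite (Σ e, Module.Basis.ofVectorSpaceIndex K (𝒱 e)) := Module.Finite.finite_basis B
  obtain ⟨N, ⟨e⟩⟩ := Finite.exists_equiv_fin (Σ e, Module.Basis.ofVectorSpaceIndex K (𝒱 e))
  refine ⟨N, B.reindex e, fun α => (e.symm α).1, fun α => ?_⟩
  rw [Module.Basis.reindex_apply]
  exact (DirectSum.Decomposition.isInternal 𝒱).collectedBasis_mem _ _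

end BasisChange

end PolyHoch

end

theorem proposition3p3p2 {K : Type*} [Field K] [CharZero K] {V : Type*} [AddCommGroup V]
    [Module K V] [FiniteDimensional K V] (𝒱 : ℤ → Submodule K V) [DirectSum.Decomposition 𝒱] :
    (∀ (p : ℕ) (ρ : PolyHoch.RepFin 𝒱 p),
      PolyHoch.repDiff 𝒱 (p + 1) (PolyHoch.repDiff 𝒱 p ρ) = 0) ∧
    (∀ (k : ℕ) (Φ : PolyHoch.Cochain 𝒱 k),
      PolyHoch.hochDiff 𝒱 (k + 1) (PolyHoch.hochDiff 𝒱 k Φ) = 0) ∧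
    (∀ (p : ℕ), ∀ Φ ∈ PolyHoch.PolyDiff 𝒱 p,
      PolyHoch.hochDiff 𝒱 (p + 1) Φ ∈ PolyHoch.PolyDiff 𝒱 (p + 1)) ∧
    ∃ i : ∀ p : ℕ, PolyHoch.RepFin 𝒱 p ≃ₗ[K] PolyHoch.PolyDiff 𝒱 p,
      (∀ (p : ℕ) (ρ : PolyHoch.RepFin 𝒱 p),
        ((i (p + 1) (PolyHoch.repDiff 𝒱 p ρ) : PolyHoch.PolyDiff 𝒱 (p + 1)) :
            PolyHoch.Cochain 𝒱 (p + 2)) =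
          PolyHoch.hochDiff 𝒱 (p + 1) (i p ρ : PolyHoch.PolyDiff 𝒱 p)) ∧
      (∀ (N : ℕ) (b : Module.Basis (Fin N) K V) (deg : Fin N → ℤ)
        (hdeg : ∀ α, b α ∈ 𝒱 (deg α)) (p : ℕ) (ρ : PolyHoch.RepFin 𝒱 p),
        (i p ρ : PolyHoch.Cochain 𝒱 (p + 1)) = PolyHoch.symbolOp 𝒱 b deg hdeg ρ) ∧
      (∀ (p : ℕ) (e : ℤ) (ρ : PolyHoch.RepFin 𝒱 p),
        PolyHoch.IsRepDeg 𝒱 e ρ ↔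
          PolyHoch.IsCochainDeg 𝒱 e (i p ρ : PolyHoch.Cochain 𝒱 (p + 1))) ∧
      (∀ (p m n : ℕ) (ρ : PolyHoch.RepFin 𝒱 p),
        (∀ m' n' : ℕ, (m', n') ≠ (m, n) → ρ.1 m' n' = 0) ↔
          (i p ρ : PolyHoch.Cochain 𝒱 (p + 1)) ∈ PolyHoch.PolyDiffBi 𝒱 p m n) := by
  obtain ⟨N, b, deg, hdeg⟩ := PolyHoch.exists_homogeneous_basis 𝒱
  exact ⟨fun p ρ => PolyHoch.repDiff_repDiff 𝒱 ρ, fun k Φ => PolyHoch.hochDiff_hochDiff 𝒱 Φ,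
    fun p Φ hΦ => PolyHoch.hochDiff_mem_polyDiff 𝒱 b hdeg hΦ,
    fun p => PolyHoch.symbolEquiv 𝒱 b hdeg,
    fun p ρ => PolyHoch.symbolOp_repDiff 𝒱 b hdeg ρ,
    fun N' b' deg' hdeg' p ρ => PolyHoch.symbolOp_basis_change 𝒱 b hdeg b' hdeg' ρ,
    fun p e ρ => PolyHoch.isRepDeg_iff_isCochainDeg 𝒱 b hdeg e ρ,
    fun p m n ρ => PolyHoch.support_iff_mem_polyDiffBi 𝒱 b hdeg m n ρ⟩
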